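/- Let $0<p<1$, $\lambda^\pm>0$, $\beta=\frac{2}{2-p}$, and write $s^\pm=\max\{\pm s,0\}$, $H=\{x\in\mathbb{R}^2: x_1>0\}$, $\Pi=\{x_1=0\}$, $B_R^+=B_R(0)\cap H$. For $M>0$ let $P_\infty(M)$ be the class of all functions $u$ on $H$ such that (a) $u$ is a global minimizer in $H$: for every $R>0$, $u\in W^{1,2}(B_R^+)$, $u=0$ on $B_R\cap\Pi$ in the sense of traces, and $$\int_{B_R^+}\big(|\nabla u|^2+2\lambda^+(u^+)^p+2\lambda^-(u^-)^p\big)\,dx\le \int_{B_R^+}\big(|\nabla v|^2+2\lambda^+(v^+)^p+2\lambda^-(v^-)^p\big)\,dx$$ for all $v\in W^{1,2}(B_R^+)$ with $v-u\in W^{1,2}_0(B_R^+)$; (b) $0\in\Gamma^+\cup\Gamma^-$, where $\Gamma^\pm=\partial\{x\in H:\pm u(x)>0\}$ (boundary in $\mathbb{R}^2$), the value $u(x)$ being understood as the limit of the means of $u$ over discs shrinking to $x$; (c) $\|u\|_{L^\infty(B_R^+)}\le MR^\beta$ for all $R>0$. **Theorem.** There are constants $c^+,c^->0$, depending only on $p$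 and $\lambda^\pm$, such that for every $M>0$ and every $u\in P_\infty(M)$ that is homogeneous of degree $\beta$, i.e. $u(tx)=t^\beta u(x)$ for all $t>0$ and almost every $x\in H$, one of the following holds: 1. $0\in\Gamma^+\setminus\Gamma^-$ (a one-phase non-negative point) and $u(x)=c^+(x_1^+)^\beta$ for almost every $x\in H$; 2. $0\in\Gamma^-\setminus\Gamma^+$ (a one-phase non-positive point) and $u(x)=-c^-(x_1^+)^\beta$ for almost every $x\in H$. -/

import Mathlib

open MeasureTheory Filter Topology Metric
open scoped ENNReal ContDiff

noncomputable section

namespace TwoPhase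

/-- The Euclidean plane; the coordinate `x₁` is `x 0`. -/
abbrev Plane := EuclideanSpace ℝ (Fin 2)

/-- The open half plane `{x₁ > 0}`. -/
def halfPlane : Set Plane := {x | 0 < x 0}

/-- The half disc `B_R⁺`, centred at the origin. -/
def halfBall (R : ℝ) : Set Plane := ball 0 R ∩ halfPlane

/-- `φ ∈ C_c^∞(D)`. -/
def IsTest (D : Set Plane) (φ : Plane → ℝ) : Prop :=
  ContDiff ℝ ∞ φ ∧ HasCompactSupport φ ∧ tsupport φ ⊆ D

/-- `g` is the weak gradient of `u` in `D`. -/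
def IsWeakGradient (D : Set Plane) (u : Plane → ℝ) (g : Plane → Plane) : Prop :=
  ∀ φ, IsTest D φ → ∫ x in D, u x • gradient φ x = - ∫ x in D, φ x • g x

/-- `u ∈ W^{1,2}(D)`, with weak gradient `g`. -/
structure IsW12 (D : Set Plane) (u : Plane → ℝ) (g : Plane → Plane) : Prop where
  memLp : MemLp u 2 (volume.restrict D)
  memLp_grad : MemLp g 2 (volume.restrict D)
  weak : IsWeakGradient D u g

/-- `w`, with weak gradient `k`, lies in the `W^{1,2}(D)`-closure of the restrictions to `D` of
functions in `C_c^∞(A)`. For `A = D` this is `w ∈ W₀^{1,2}(D)`; for `A = {x₁ > 0}` and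
`D = B_R⁺` it says that `w` has zero trace on the flat part `B_R ∩ {x₁ = 0}` of `∂B_R⁺`. -/
def IsLimitOfTests (A D : Set Plane) (w : Plane → ℝ) (k : Plane → Plane) : Prop :=
  ∀ ε : ℝ≥0∞, 0 < ε → ∃ φ, IsTest A φ ∧
    eLpNorm (fun x => w x - φ x) 2 (volume.restrict D) ≤ ε ∧
    eLpNorm (fun x => k x - gradient φ x) 2 (volume.restrict D) ≤ ε

/-- The energy `∫_D |∇u|² + 2λ⁺(u⁺)^p + 2λ⁻(u⁻)^p`, where `g = ∇u`. -/
def energy (p lamP lamM : ℝ) (D : Set Plane) (u : Plane → ℝ) (g : Plane → Plane) : ℝ :=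
  ∫ x in D, (‖g x‖ ^ 2 + 2 * lamP * (max (u x) 0) ^ p + 2 * lamM * (max (-u x) 0) ^ p)

/-- `u` minimizes the energy in `B_R⁺`: it is in `W^{1,2}(B_R⁺)`, vanishes on the flat part of the
boundary, and has the least energy among all `v ∈ W^{1,2}(B_R⁺)` with the boundary values of `u`
on the whole of `∂B_R⁺`. -/
def IsMinimizer (p lamP lamM R : ℝ) (u : Plane → ℝ) : Prop :=
  ∃ g, IsW12 (halfBall R) u g ∧ IsLimitOfTests halfPlane (halfBall R) u g ∧
    ∀ v h, IsW12 (halfBall R) v h →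
      IsLimitOfTests (halfBall R) (halfBall R) (fun x => v x - u x) (fun x => h x - g x) →
      energy p lamP lamM (halfBall R) u g ≤ energy p lamP lamM (halfBall R) v h

/-- A (global) minimizer in the half plane `{x₁ > 0}`. -/
def IsGlobalMinimizer (p lamP lamM : ℝ) (u : Plane → ℝ) : Prop :=
  ∀ R : ℝ, 0 < R → IsMinimizer p lamP lamM R u

/-- The phase `Ω⁺ = {u > 0}` in the half plane. A Sobolev function is given up to null sets only,
so its value at `x` is taken to be the limit of its means over shrinking discs; this is `u x`
wherever `u` is continuous. -/
def posPhase (u : Plane → ℝ) : Set Plane :=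
  {x ∈ halfPlane | ∃ l : ℝ, 0 < l ∧ Tendsto (fun r => ⨍ y in ball x r, u y) (𝓝[>] 0) (𝓝 l)}

/-- The phase `Ω⁻ = {u < 0}` in the half plane. -/
def negPhase (u : Plane → ℝ) : Set Plane :=
  {x ∈ halfPlane | ∃ l : ℝ, l < 0 ∧ Tendsto (fun r => ⨍ y in ball x r, u y) (𝓝[>] 0) (𝓝 l)}

/-- `Γ⁺ = ∂Ω⁺`, the boundary being taken in the whole plane. -/
def GammaP (u : Plane → ℝ) : Set Plane := frontier (posPhase u)

/-- `Γ⁻ = ∂Ω⁻`, the boundary being taken in the whole plane. -/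
def GammaM (u : Plane → ℝ) : Set Plane := frontier (negPhase u)

/-- The exponent `β = 2 / (2 - p)`. -/
def beta (p : ℝ) : ℝ := 2 / (2 - p)

/-- The class `P_∞(M)`. -/
structure PInfty (p lamP lamM M : ℝ) (u : Plane → ℝ) : Prop where
  minimizer : IsGlobalMinimizer p lamP lamM u
  zero_mem : (0 : Plane) ∈ GammaP u ∪ GammaM u
  growth : ∀ R : ℝ, 0 < R → ∀ᵐ x ∂(volume.restrict (halfBall R)), |u x| ≤ M * R ^ beta p

/-- `u` is homogeneous of degree `b` in the half plane, as a function given up to null sets. -/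
def IsHomogeneous (b : ℝ) (u : Plane → ℝ) : Prop :=
  ∀ t : ℝ, 0 < t → ∀ᵐ x ∂(volume.restrict halfPlane), u (t • x) = t ^ b * u x

end TwoPhase

end

/-!
A homogeneous minimizer has the form `r ^ β * f θ` with `-π/2 < θ < π/2`, so that the theorem is a
statement about functions of one variable. It asserts that `f` is `c⁺ cos ^ β`, `-c⁻ cos ^ β`, or
zero, and the last case is excluded since then neither phase has a boundary.

*Reduction.* By Fubini's theorem the homogeneity, which holds for each dilation up to a null set,
gives a measurable `f` (`exists_angular_part`). Along half circles the zero trace controls the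
radial means of smooth approximations uniformly, hence `f` is continuous and vanishes at `±π/2`
(`exists_continuous_angular_part`). The only competitors needed are `u + η(r) ζ(θ)` in the half
disc of radius three, with a fixed bump function `η` supported in `1 < r < 2` and an arbitrary test
function `ζ`. They lead to an inequality for `f` alone (`IsProfile`, `exists_isProfile`).

*The equation on an arc.* Where `f > 0` the inequality gives `f'' = p λ⁺ f ^ (p - 1) - β² f`
(`IsProfile.equation`). On a maximal interval `(a, b)` of positivity (`IsArc`) the quantity
`E = f'² + β² f² - 2 λ⁺ f ^ p` is constant and nonnegative, and `√E` is the slope of `f` at the end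
points. Sturm comparison with `sin (β (x - a))` shows that `b - a > π / β > π / 2`
(`IsArc.pi_div_two_lt`), so that there is at most one arc, of either sign. For `g = f ^ (1 / β)` one
has `g'' + g = -(β - 1) E β⁻² g ^ (1 - 2 β)`. The Wronskian of `g` and `sin (x - a)` then shows
that `b - a ≠ π` if `E > 0` (`IsArc.sub_ne_pi`), and that `f` is a multiple of
`sin (x - a) ^ β` and `b - a = π` if `E = 0`, the factor being determined by `E = 0` at the
midpoint (`IsArc.eq_of_energy_zero`).

*No kinks.* If `E > 0`, then the single arc has an end point inside `(-π/2, π/2)`, beyond which `f`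
is zero, although its slope there is `±√E ≠ 0`. A perturbation of height `s δ` on an interval of
length `δ` around it lowers the Dirichlet energy by an amount of order `s δ`, at a cost of order
`s² δ` and `(s δ) ^ p δ`; for `s` small and then `δ → 0` this contradicts minimality
(`HasKinkBound.false_of_slope`). Therefore `E = 0`, and the arc is the whole of `(-π/2, π/2)`.
-/

namespace TwoPhase

/-! ### Polar coordinates in the half plane -/

/-- The point with polar coordinates `(r, θ)`. -/
noncomputable def polar (q : ℝ × ℝ) : Plane := !₂[q.1 * Real.cos q.2, q.1 * Real.sin q.2]

/-- The range `(-π/2, π/2)` of the polar angle in the half plane. -/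
abbrev angles : Set ℝ := Set.Ioo (-(Real.pi / 2)) (Real.pi / 2)

/-- The measure `r dr` on `(0, ∞)`. -/
noncomputable def radialMeasure : Measure ℝ :=
  (volume.restrict (Set.Ioi 0)).withDensity ENNReal.ofReal

/-- The area measure of the half plane in polar coordinates. -/
noncomputable abbrev polarMeasure : Measure (ℝ × ℝ) :=
  radialMeasure.prod (volume.restrict angles)

instance : SFinite radialMeasure := by unfold radialMeasure; infer_instance

@[simp] lemma polar_zero (q : ℝ × ℝ) : polar q 0 = q.1 * Real.cos q.2 := rfl
@[simp] lemma polar_one (q : ℝ × ℝ) : polar q 1 = q.1 * Real.sin q.2 := rfl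

lemma contDiff_polar : ContDiff ℝ ∞ polar := by
  rw [contDiff_euclidean]
  intro i
  fin_cases i
  · exact contDiff_fst.mul (Real.contDiff_cos.comp contDiff_snd)
  · exact contDiff_fst.mul (Real.contDiff_sin.comp contDiff_snd)

lemma continuous_polar : Continuous polar := contDiff_polar.continuous

lemma isOpen_halfPlane : IsOpen halfPlane :=
  isOpen_lt continuous_const (EuclideanSpace.proj (𝕜 := ℝ) (0 : Fin 2)).continuous

lemma norm_polar {q : ℝ × ℝ} (h : 0 ≤ q.1) : ‖polar q‖ = q.1 := by
  rw [EuclideanSpace.norm_eq, Fin.sum_univ_two, Real.sqrt_eq_iff_mul_self_eq (by positivity) h]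
  simp only [polar_zero, polar_one, Real.norm_eq_abs, sq_abs]
  nlinarith [Real.sin_sq_add_cos_sq q.2]

lemma smul_polar (t r θ : ℝ) : t • polar (r, θ) = polar (t * r, θ) := by
  ext i
  fin_cases i <;> simp [mul_assoc]

lemma polar_mem_halfPlane {r θ : ℝ} (hr : 0 < r) (hθ : θ ∈ angles) :
    polar (r, θ) ∈ halfPlane :=
  mul_pos hr (Real.cos_pos_of_mem_Ioo hθ)

lemma polar_mem_halfPlane_iff {r θ : ℝ} (hr : 0 < r) (hθ : θ ∈ Set.Ioo (-Real.pi) Real.pi) :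
    polar (r, θ) ∈ halfPlane ↔ θ ∈ angles := by
  refine ⟨fun h => ?_, polar_mem_halfPlane hr⟩
  have h' : 0 < Real.cos θ := (pos_iff_pos_of_mul_pos h).1 hr
  by_contra hc
  rcases not_and_or.1 hc with h1 | h1
  · have := Real.cos_nonpos_of_pi_div_two_le_of_le (x := -θ) (by linarith) (by linarith [hθ.1])
    rw [Real.cos_neg] at this
    linarith
  · have := Real.cos_nonpos_of_pi_div_two_le_of_le (x := θ) (by linarith) (by linarith [hθ.2])
    linarith

/-- Integration over the half plane in polar coordinates. -/
lemma measurePreserving_polar :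
    MeasurePreserving polar polarMeasure (volume.restrict halfPlane) := by
  refine ⟨continuous_polar.measurable, ?_⟩
  ext s hs
  rw [Measure.map_apply continuous_polar.measurable hs, Measure.restrict_apply hs]
  let e : MeasurableEquiv (ℝ × ℝ) Plane :=
    MeasurableEquiv.finTwoArrow.symm.trans (MeasurableEquiv.toLp 2 (Fin 2 → ℝ))
  have he : MeasurePreserving e := (volume_preserving_finTwoArrow ℝ).symm.trans
    (EuclideanSpace.volume_preserving_symm_measurableEquiv_toLp (Fin 2)).symm
  have hep : ∀ q, e (polarCoord.symm q) = polar q := fun q => by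
    ext i
    fin_cases i <;> rfl
  have hsH : MeasurableSet (s ∩ halfPlane) := hs.inter isOpen_halfPlane.measurableSet
  rw [← he.measure_preimage hsH.nullMeasurableSet, ← lintegral_indicator_one
    (e.measurable hsH), ← lintegral_comp_polarCoord_symm]
  unfold polarMeasure radialMeasure
  rw [prod_withDensity_left (by fun_prop), Measure.prod_restrict,
    withDensity_apply _ (continuous_polar.measurable hs), Measure.restrict_restrict
    (continuous_polar.measurable hs), ← lintegral_indicator, ← lintegral_indicator]
  · congr 1
    ext ⟨r, θ⟩
    by_cases hr : 0 < r
    swap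
    · simp [Set.indicator, hr]
    by_cases hθ : θ ∈ Set.Ioo (-Real.pi) Real.pi
    · have hq := polar_mem_halfPlane_iff hr hθ
      by_cases hs' : polar (r, θ) ∈ s <;> by_cases ha : θ ∈ angles <;>
      simp_all [Set.indicator]
    · have : θ ∉ angles := fun h =>
        hθ ⟨by linarith [h.1, Real.pi_pos], by linarith [h.2, Real.pi_pos]⟩
      rw [Set.indicator_of_notMem fun h => this h.2.2, Set.indicator_of_notMem fun h => hθ h.2]
  · exact measurableSet_Ioi.prod measurableSet_Ioo
  · exact (continuous_polar.measurable hs).inter (measurableSet_Ioi.prod measurableSet_Ioo)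

/-! ### Homogeneous functions -/

lemma ae_radialMeasure : ae radialMeasure = ae (volume.restrict (Set.Ioi (0 : ℝ))) := by
  ext s
  change (∀ᵐ r ∂radialMeasure, r ∈ s) ↔ ∀ᵐ r ∂(volume.restrict (Set.Ioi (0 : ℝ))), r ∈ s
  rw [radialMeasure, ae_withDensity_iff (by fun_prop)]
  refine eventually_congr ?_
  filter_upwards [ae_restrict_mem measurableSet_Ioi] with r hr
  have : ENNReal.ofReal r ≠ 0 := by simpa using hr
  simp [this]

lemma ae_radialMeasure_pos : ∀ᵐ r ∂radialMeasure, 0 < r := by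
  rw [ae_radialMeasure]
  exact ae_restrict_mem measurableSet_Ioi

lemma ae_polarMeasure_mem : ∀ᵐ q ∂polarMeasure, 0 < q.1 ∧ q.2 ∈ angles := by
  have h1 : ∀ᵐ q ∂polarMeasure, 0 < q.1 :=
    Measure.quasiMeasurePreserving_fst.ae ae_radialMeasure_pos
  have h2 : ∀ᵐ q ∂polarMeasure, q.2 ∈ angles :=
    Measure.quasiMeasurePreserving_snd.ae (ae_restrict_mem measurableSet_Ioo)
  exact h1.and h2

lemma quasiMeasurePreserving_const_smul {E : Type*} [NormedAddCommGroup E] [NormedSpace ℝ E]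
    [FiniteDimensional ℝ E] [MeasurableSpace E] [BorelSpace E] (μ : Measure E)
    [μ.IsAddHaarMeasure] {S : Set E} {t : ℝ} (ht : t ≠ 0)
    (hS : ∀ x, t • x ∈ S ↔ x ∈ S) :
    Measure.QuasiMeasurePreserving (t • · : E → E) (μ.restrict S) (μ.restrict S) := by
  refine ⟨measurable_const_smul t, Measure.AbsolutelyContinuous.mk fun s hs h0 => ?_⟩
  rw [Measure.restrict_apply hs] at h0
  rw [Measure.map_apply (measurable_const_smul t) hs,
    Measure.restrict_apply (measurable_const_smul t hs)]
  have : (t • · : E → E) ⁻¹' s ∩ S = (t • · : E → E) ⁻¹' (s ∩ S) := by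
    ext x
    simp [hS]
  rw [this, Measure.addHaar_preimage_smul μ ht, h0, mul_zero]

/-- A function that is homogeneous of degree `b`, each time up to a null set, is almost everywhere
of the form `r ^ b * f θ`: by Fubini's theorem, its values on almost every half circle determine
it almost everywhere. -/
lemma exists_angular_part {b : ℝ} {u : Plane → ℝ}
    (hu : AEStronglyMeasurable u (volume.restrict halfPlane)) (hom : IsHomogeneous b u) :
    ∃ f : ℝ → ℝ, Measurable f ∧ ∀ᵐ q ∂polarMeasure, u (polar q) = q.1 ^ b * f q.2 := by
  set w := hu.mk u
  have hw : Measurable w := hu.measurable_mk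
  have hwp : Measurable fun q : ℝ × ℝ => w (polar q) := hw.comp continuous_polar.measurable
  have huw : ∀ᵐ x ∂(volume.restrict halfPlane), u x = w x := hu.ae_eq_mk
  have hqp := measurePreserving_polar.quasiMeasurePreserving
  have hscale : ∀ t : ℝ, 0 < t →
      ∀ᵐ q ∂polarMeasure, w (polar (t * q.1, q.2)) = t ^ b * w (polar q) := by
    intro t ht
    have h1 : ∀ᵐ x ∂(volume.restrict halfPlane), u (t • x) = w (t • x) :=
      (quasiMeasurePreserving_const_smul volume ht.ne' fun x => by
        change 0 < t * x 0 ↔ 0 < x 0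
        exact mul_pos_iff_of_pos_left ht).ae huw
    have h2 : ∀ᵐ x ∂(volume.restrict halfPlane), w (t • x) = t ^ b * w x := by
      filter_upwards [huw, h1, hom t ht] with x e1 e2 e3
      rw [← e1, ← e2, e3]
    filter_upwards [hqp.ae h2] with q hq
    rwa [smul_polar] at hq
  have hmeas : MeasurableSet {y : ℝ × (ℝ × ℝ) |
      w (polar (y.1 * y.2.1, y.2.2)) = y.1 ^ b * w (polar y.2)} := by
    refine measurableSet_eq_fun ?_ ?_
    · exact hwp.comp (by fun_prop)
    · exact (by fun_prop : Measurable fun y : ℝ × (ℝ × ℝ) => y.1 ^ b).mul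
        (hwp.comp measurable_snd)
  have hall : ∀ᵐ t ∂(volume.restrict (Set.Ioi (0 : ℝ))), ∀ᵐ q ∂polarMeasure,
      w (polar (t * q.1, q.2)) = t ^ b * w (polar q) := by
    filter_upwards [ae_restrict_mem measurableSet_Ioi] with t ht using hscale t ht
  rw [Measure.ae_ae_comm hmeas] at hall
  have hr := Measure.ae_ae_of_ae_prod hall
  have : (ae radialMeasure).NeBot := by
    rw [ae_radialMeasure, ae_neBot]
    simp
  obtain ⟨r₀, h₀, hr₀⟩ := (hr.and ae_radialMeasure_pos).exists
  refine ⟨fun θ => r₀⁻¹ ^ b * w (polar (r₀, θ)), ?_, ?_⟩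
  · exact measurable_const.mul (hwp.comp (by fun_prop))
  have hm2 : MeasurableSet {q : ℝ × ℝ |
      w (polar q) = q.1 ^ b * (r₀⁻¹ ^ b * w (polar (r₀, q.2)))} := by
    refine measurableSet_eq_fun hwp ?_
    exact (by fun_prop : Measurable fun y : ℝ × ℝ => y.1 ^ b).mul
        (measurable_const.mul (hwp.comp (by fun_prop)))
  have key : ∀ᵐ q ∂polarMeasure, w (polar q) = q.1 ^ b * (r₀⁻¹ ^ b * w (polar (r₀, q.2))) := by
    rw [Measure.ae_prod_iff_ae_ae hm2, Measure.ae_ae_comm (p := fun x y => w (polar (x, y)) =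
      x ^ b * (r₀⁻¹ ^ b * w (polar (r₀, y)))) hm2]
    filter_upwards [h₀] with θ hθ
    rw [ae_radialMeasure]
    have hq := (quasiMeasurePreserving_const_smul (volume : Measure ℝ) (S := Set.Ioi (0 : ℝ))
      (inv_pos.2 hr₀).ne' fun x => by
        change 0 < r₀⁻¹ * x ↔ 0 < x
        exact mul_pos_iff_of_pos_left (inv_pos.2 hr₀)).ae hθ
    filter_upwards [hq, ae_restrict_mem measurableSet_Ioi] with r h hr
    have e : r₀⁻¹ • r * r₀ = r := by
      rw [smul_eq_mul]
      field_simp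
    rw [e] at h
    rw [h, smul_eq_mul, Real.mul_rpow (inv_pos.2 hr₀).le (le_of_lt hr)]
    ring
  filter_upwards [key, hqp.ae huw] with q h1 h2
  rw [h2, h1]

/-! ### Gradients in polar coordinates -/

/-- The radial unit vector at angle `θ`. -/
noncomputable def radialDir (θ : ℝ) : Plane := !₂[Real.cos θ, Real.sin θ]

/-- The tangential unit vector at angle `θ`. -/
noncomputable def angularDir (θ : ℝ) : Plane := !₂[-Real.sin θ, Real.cos θ]

lemma hasDerivAt_polar_radius (r θ : ℝ) :
    HasDerivAt (fun s => polar (s, θ)) (radialDir θ) r := by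
  rw [hasDerivAt_iff_hasFDerivAt, ← hasFDerivWithinAt_univ, hasFDerivWithinAt_euclidean]
  intro i
  rw [hasFDerivWithinAt_univ, hasFDerivAt_iff_hasDerivAt]
  fin_cases i
  · simpa [radialDir] using (hasDerivAt_id r).mul_const (Real.cos θ)
  · simpa [radialDir] using (hasDerivAt_id r).mul_const (Real.sin θ)

lemma hasDerivAt_polar_angle (r θ : ℝ) :
    HasDerivAt (fun t => polar (r, t)) (r • angularDir θ) θ := by
  rw [hasDerivAt_iff_hasFDerivAt, ← hasFDerivWithinAt_univ, hasFDerivWithinAt_euclidean]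
  intro i
  rw [hasFDerivWithinAt_univ, hasFDerivAt_iff_hasDerivAt]
  fin_cases i
  · simpa [angularDir] using (Real.hasDerivAt_cos θ).const_mul r
  · simpa [angularDir] using (Real.hasDerivAt_sin θ).const_mul r

lemma norm_angularDir (θ : ℝ) : ‖angularDir θ‖ = 1 := by
  rw [EuclideanSpace.norm_eq, Fin.sum_univ_two]
  simp [angularDir]

lemma inner_eq_polar_components (v w : Plane) (θ : ℝ) :
    inner ℝ v w = inner ℝ v (radialDir θ) * inner ℝ w (radialDir θ)
      + inner ℝ v (angularDir θ) * inner ℝ w (angularDir θ) := by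
  simp only [PiLp.inner_apply, Fin.sum_univ_two, radialDir, angularDir]
  simp
  linear_combination (-(v 0 * w 0) - v 1 * w 1) * Real.sin_sq_add_cos_sq θ

lemma hasDerivAt_comp_polar_radius {a : Plane → ℝ} (ha : Differentiable ℝ a) (r θ : ℝ) :
    HasDerivAt (fun s => a (polar (s, θ)))
      (inner ℝ (gradient a (polar (r, θ))) (radialDir θ)) r := by
  have h := (ha (polar (r, θ))).hasGradientAt.hasFDerivAt.comp_hasDerivAt r
    (hasDerivAt_polar_radius r θ)
  simpa using! h

lemma hasDerivAt_comp_polar_angle {a : Plane → ℝ} (ha : Differentiable ℝ a) (r θ : ℝ) :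
    HasDerivAt (fun t => a (polar (r, t)))
      (r * inner ℝ (gradient a (polar (r, θ))) (angularDir θ)) θ := by
  have h := (ha (polar (r, θ))).hasGradientAt.hasFDerivAt.comp_hasDerivAt θ
    (hasDerivAt_polar_angle r θ)
  simpa [inner_smul_right] using! h

lemma continuous_gradient {a : Plane → ℝ} (ha : ContDiff ℝ ∞ a) : Continuous (gradient a) :=
  (InnerProductSpace.toDual ℝ Plane).symm.continuous.comp
    (ha.continuous_fderiv (by simp))

lemma gradient_sub {a b : Plane → ℝ} (ha : Differentiable ℝ a) (hb : Differentiable ℝ b)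
    (x : Plane) : gradient (fun y => a y - b y) x = gradient a x - gradient b x := by
  unfold gradient
  rw [fderiv_fun_sub (ha x) (hb x), map_sub]

lemma IsTest.sub {D : Set Plane} {a b : Plane → ℝ} (ha : IsTest D a) (hb : IsTest D b) :
    IsTest D fun x => a x - b x :=
  ⟨ha.1.sub hb.1, ha.2.1.sub hb.2.1,
    (tsupport_sub a b).trans (Set.union_subset ha.2.2 hb.2.2)⟩

lemma IsTest.differentiable {D : Set Plane} {a : Plane → ℝ} (ha : IsTest D a) :
    Differentiable ℝ a := ha.1.differentiable (by simp)

lemma IsTest.eq_zero {D : Set Plane} {a : Plane → ℝ} (ha : IsTest D a) {x : Plane} (hx : x ∉ D) :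
    a x = 0 := image_eq_zero_of_notMem_tsupport fun h => hx (ha.2.2 h)

/-! ### Radial means and continuity of the angular part -/

/-- The measure `dr dθ` on `{1 < r < 2}`. -/
noncomputable abbrev annulusMeasure : Measure (ℝ × ℝ) :=
  (volume.restrict (Set.Ioo 1 2)).prod (volume.restrict angles)

lemma measurePreserving_polar_halfBall (R : ℝ) :
    MeasurePreserving polar (polarMeasure.restrict (polar ⁻¹' ball 0 R))
      (volume.restrict (halfBall R)) := by
  have := measurePreserving_polar.restrict_preimage (measurableSet_ball (x := (0 : Plane)) (ε := R))
  rwa [Measure.restrict_restrict measurableSet_ball] at this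

lemma annulusMeasure_le :
    annulusMeasure ≤ polarMeasure.restrict (polar ⁻¹' ball 0 3) := by
  have h1 : volume.restrict (Set.Ioo (1 : ℝ) 2) ≤ radialMeasure.restrict (Set.Ioo 1 2) := by
    unfold radialMeasure
    rw [restrict_withDensity measurableSet_Ioo, Measure.restrict_restrict measurableSet_Ioo,
      Set.inter_eq_left.2 (Set.Ioo_subset_Ioi_self.trans (Set.Ioi_subset_Ioi zero_le_one))]
    conv_lhs => rw [← withDensity_one (μ := volume.restrict (Set.Ioo (1 : ℝ) 2))]
    refine withDensity_mono ?_
    filter_upwards [ae_restrict_mem measurableSet_Ioo] with r hr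
    simpa using hr.1.le
  refine (Measure.prod_mono h1 le_rfl).trans ?_
  have h2 := Measure.prod_restrict (μ := radialMeasure) (ν := volume.restrict angles)
    (Set.Ioo 1 2) Set.univ
  rw [Measure.restrict_univ] at h2
  rw [h2]
  refine Measure.restrict_mono_ae ?_
  filter_upwards [ae_polarMeasure_mem] with q hq hq'
  change polar q ∈ ball 0 3
  rw [mem_ball_zero_iff, norm_polar hq.1.le]
  linarith [hq'.1.2]

lemma lintegral_annulus_le {G : Plane → ℝ≥0∞} (hG : AEMeasurable G (volume.restrict (halfBall 3))) :
    ∫⁻ q, G (polar q) ∂annulusMeasure ≤ ∫⁻ x in halfBall 3, G x := by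
  refine (lintegral_mono' annulusMeasure_le le_rfl).trans ?_
  have h := measurePreserving_polar_halfBall 3
  rw [← h.map_eq] at hG ⊢
  rw [lintegral_map' hG h.measurable.aemeasurable]

/-- The integral of `a` over the radial segment `1 ≤ r ≤ 2` at angle `θ`. -/
noncomputable def radialMean (a : Plane → ℝ) (θ : ℝ) : ℝ := ∫ r in (1 : ℝ)..2, a (polar (r, θ))

lemma continuous_radialMean {a : Plane → ℝ} (ha : Continuous a) : Continuous (radialMean a) :=
  intervalIntegral.continuous_parametric_intervalIntegral_of_continuous'
    (f := fun θ r => a (polar (r, θ)))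
    (ha.comp (continuous_polar.comp continuous_swap)) 1 2

lemma radialMean_sub {a b : Plane → ℝ} (ha : Continuous a) (hb : Continuous b) (θ : ℝ) :
    radialMean (fun x => a x - b x) θ = radialMean a θ - radialMean b θ :=
  intervalIntegral.integral_sub
    ((ha.comp (continuous_polar.comp (by fun_prop))).intervalIntegrable _ _)
    ((hb.comp (continuous_polar.comp (by fun_prop))).intervalIntegrable _ _)

lemma radialMean_eq_zero {a : Plane → ℝ} (ha : IsTest halfPlane a) {θ : ℝ} (hθ : Real.cos θ = 0) :
    radialMean a θ = 0 := by
  have : ∀ r, a (polar (r, θ)) = 0 := fun r => ha.eq_zero fun h => by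
    have h' : 0 < r * Real.cos θ := h
    simp [hθ] at h'
  simp [radialMean, this]

/-- Along each half circle a test function of the half plane is the integral of its angular
derivative from the end point of the half circle. Averaging over the radius bounds its radial
means uniformly by the `L¹`-norm of its gradient. -/
lemma enorm_radialMean_le {a : Plane → ℝ} (ha : IsTest halfPlane a) {θ : ℝ}
    (hθ : θ ∈ Set.Icc (-(Real.pi / 2)) (Real.pi / 2)) :
    ‖radialMean a θ‖ₑ ≤ 2 * ∫⁻ x in halfBall 3, ‖gradient a x‖ₑ := by
  have hg := continuous_gradient ha.1
  have hgp : Continuous fun q : ℝ × ℝ => gradient a (polar q) := hg.comp continuous_polar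
  have h1 : ∀ r ∈ Set.Ioo (1 : ℝ) 2,
      ‖a (polar (r, θ))‖ₑ ≤ ∫⁻ s in angles, 2 * ‖gradient a (polar (r, s))‖ₑ := by
    intro r hr
    have hang : Continuous angularDir := by
      unfold angularDir
      fun_prop
    have hc : Continuous fun s => gradient a (polar (r, s)) := hgp.comp (by fun_prop)
    have hd := intervalIntegral.integral_eq_sub_of_hasDerivAt (a := -(Real.pi / 2)) (b := θ)
      (fun s _ => hasDerivAt_comp_polar_angle ha.differentiable r s)
      (Continuous.intervalIntegrable (by fun_prop) _ _)
    rw [ha.eq_zero (x := polar (r, -(Real.pi / 2))) (fun h => by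
      have h' : 0 < r * Real.cos (-(Real.pi / 2)) := h
      simp at h'), sub_zero] at hd
    rw [← hd, intervalIntegral.integral_of_le hθ.1]
    refine (enorm_integral_le_lintegral_enorm _).trans ?_
    rw [restrict_Ioo_eq_restrict_Ioc]
    refine (lintegral_mono_set (Set.Ioc_subset_Ioc_right hθ.2)).trans (lintegral_mono fun s => ?_)
    rw [enorm_mul]
    gcongr
    · rw [Real.enorm_eq_ofReal (by linarith [hr.1])]
      simpa using ENNReal.ofReal_le_ofReal hr.2.le
    · rw [← ofReal_norm, ← ofReal_norm]
      refine ENNReal.ofReal_le_ofReal ((norm_inner_le_norm _ _).trans ?_)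
      rw [norm_angularDir, mul_one]
  calc ‖radialMean a θ‖ₑ ≤ ∫⁻ r in Set.Ioo (1 : ℝ) 2, ‖a (polar (r, θ))‖ₑ := by
        rw [radialMean, intervalIntegral.integral_of_le one_le_two, ← restrict_Ioo_eq_restrict_Ioc]
        exact enorm_integral_le_lintegral_enorm _
    _ ≤ ∫⁻ r in Set.Ioo (1 : ℝ) 2, ∫⁻ s in angles, 2 * ‖gradient a (polar (r, s))‖ₑ :=
        setLIntegral_mono' measurableSet_Ioo h1
    _ = ∫⁻ q, 2 * ‖gradient a (polar q)‖ₑ ∂annulusMeasure :=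
        (lintegral_prod (fun q : ℝ × ℝ => 2 * ‖gradient a (polar q)‖ₑ)
          (hgp.enorm.measurable.const_mul 2).aemeasurable).symm
    _ = 2 * ∫⁻ q, ‖gradient a (polar q)‖ₑ ∂annulusMeasure :=
        lintegral_const_mul _ hgp.enorm.measurable
    _ ≤ _ := by
        gcongr
        exact lintegral_annulus_le (G := fun x => ‖gradient a x‖ₑ)
          hg.enorm.measurable.aemeasurable

/-- The radial mean of `r ^ b * f θ` is a multiple of `f`, so that approximation of `u` in the plane
gives approximation of `f` in `L¹`. -/
lemma lintegral_radialMean_sub_le {b : ℝ} {u a : Plane → ℝ} {f : ℝ → ℝ}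
    (hu : AEStronglyMeasurable u (volume.restrict (halfBall 3))) (hf : Measurable f)
    (huf : ∀ᵐ q ∂polarMeasure, u (polar q) = q.1 ^ b * f q.2) (ha : Continuous a) :
    ∫⁻ θ in angles, ‖radialMean a θ - (∫ r in (1 : ℝ)..2, r ^ b) * f θ‖ₑ ≤
      ∫⁻ x in halfBall 3, ‖u x - a x‖ₑ := by
  have hap : Continuous fun q : ℝ × ℝ => a (polar q) := ha.comp continuous_polar
  have hmeas : Measurable fun q : ℝ × ℝ => ‖q.1 ^ b * f q.2 - a (polar q)‖ₑ :=
    (((by fun_prop : Measurable fun q : ℝ × ℝ => q.1 ^ b).mul (hf.comp measurable_snd)).sub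
      hap.measurable).enorm
  have h1 : ∀ θ, ‖radialMean a θ - (∫ r in (1 : ℝ)..2, r ^ b) * f θ‖ₑ ≤
      ∫⁻ r in Set.Ioo (1 : ℝ) 2, ‖r ^ b * f θ - a (polar (r, θ))‖ₑ := by
    intro θ
    rw [radialMean, ← intervalIntegral.integral_mul_const, ← intervalIntegral.integral_sub,
      intervalIntegral.integral_of_le one_le_two, ← restrict_Ioo_eq_restrict_Ioc]
    · refine (enorm_integral_le_lintegral_enorm _).trans (lintegral_mono fun r => ?_)
      rw [enorm_sub_rev]
    · exact (hap.comp (by fun_prop : Continuous fun r : ℝ => (r, θ))).intervalIntegrable _ _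
    · refine (intervalIntegral.intervalIntegrable_rpow ?_).mul_const _
      right
      rw [Set.uIcc_of_le one_le_two]
      exact fun h => absurd h.1 (by norm_num)
  calc _ ≤ ∫⁻ θ in angles, ∫⁻ r in Set.Ioo (1 : ℝ) 2, ‖r ^ b * f θ - a (polar (r, θ))‖ₑ :=
        lintegral_mono h1
    _ = ∫⁻ q, ‖q.1 ^ b * f q.2 - a (polar q)‖ₑ ∂annulusMeasure :=
        (lintegral_prod_symm _ hmeas.aemeasurable).symm
    _ = ∫⁻ q, ‖u (polar q) - a (polar q)‖ₑ ∂annulusMeasure := by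
        refine lintegral_congr_ae ?_
        have := (Measure.absolutelyContinuous_of_le annulusMeasure_le).ae_le
          (ae_restrict_of_ae (s := polar ⁻¹' ball 0 3) huf)
        filter_upwards [this] with q hq
        rw [hq]
    _ ≤ _ := lintegral_annulus_le (G := fun x => ‖u x - a x‖ₑ)
        (hu.sub ha.aestronglyMeasurable).enorm

lemma volume_halfBall_lt_top (R : ℝ) : volume (halfBall R) < ⊤ :=
  (measure_mono Set.inter_subset_left).trans_lt measure_ball_lt_top

instance (R : ℝ) : IsFiniteMeasure (volume.restrict (halfBall R)) :=
  isFiniteMeasure_restrict.2 (volume_halfBall_lt_top R).ne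

lemma lintegral_enorm_le_eLpNorm_two {E : Type*} [NormedAddCommGroup E] {X : Type*}
    [MeasurableSpace X] {μ : Measure X} {w : X → E} (hw : AEStronglyMeasurable w μ) :
    ∫⁻ x, ‖w x‖ₑ ∂μ ≤ eLpNorm w 2 μ * μ Set.univ ^ (1 / 2 : ℝ) := by
  rw [← eLpNorm_one_eq_lintegral_enorm]
  refine (eLpNorm_le_eLpNorm_mul_rpow_measure_univ one_le_two hw).trans_eq ?_
  norm_num

lemma IsLimitOfTests.exists_seq {A D : Set Plane} {w : Plane → ℝ} {k : Plane → Plane}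
    (h : IsLimitOfTests A D w k) : ∃ φ : ℕ → Plane → ℝ, ∀ n, IsTest A (φ n) ∧
      eLpNorm (fun x => w x - φ n x) 2 (volume.restrict D) ≤ ENNReal.ofReal (1 / (n + 1)) ∧
      eLpNorm (fun x => k x - gradient (φ n) x) 2 (volume.restrict D) ≤
        ENNReal.ofReal (1 / (n + 1)) := by
  choose φ hφ using fun n : ℕ => h (ENNReal.ofReal (1 / (n + 1))) (by
    rw [ENNReal.ofReal_pos]
    positivity)
  exact ⟨φ, hφ⟩

/-- A function `r ^ b * f θ` in `W^{1,2}` with zero trace on the flat boundary has a continuous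
angular part that vanishes at `±π/2`: the radial means of smooth approximations converge
uniformly. -/
lemma exists_continuous_angular_part {b : ℝ} {u : Plane → ℝ} {g : Plane → Plane} {f₀ : ℝ → ℝ}
    (hW : IsW12 (halfBall 3) u g) (hT : IsLimitOfTests halfPlane (halfBall 3) u g)
    (hf₀ : Measurable f₀) (huf : ∀ᵐ q ∂polarMeasure, u (polar q) = q.1 ^ b * f₀ q.2) :
    ∃ f : ℝ → ℝ, Continuous f ∧ (∀ θ, θ ∉ angles → f θ = 0) ∧
      ∀ᵐ q ∂polarMeasure, u (polar q) = q.1 ^ b * f q.2 := by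
  obtain ⟨φ, hφ⟩ := hT.exists_seq
  set K : ℝ≥0∞ := (volume.restrict (halfBall 3)) Set.univ ^ (1 / 2 : ℝ) with hK
  have hKtop : K ≠ ⊤ := ENNReal.rpow_ne_top_of_nonneg (by norm_num) (measure_ne_top _ _)
  have hcpos : 0 < ∫ r in (1 : ℝ)..2, r ^ b :=
    intervalIntegral.intervalIntegral_pos_of_pos_on
      (intervalIntegral.intervalIntegrable_rpow (Or.inr (by
        rw [Set.uIcc_of_le one_le_two]
        exact fun h => absurd h.1 (by norm_num))))
      (fun r hr => Real.rpow_pos_of_pos (zero_lt_one.trans hr.1) b) one_lt_two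
  set c := ∫ r in (1 : ℝ)..2, r ^ b with hc
  set F : ℕ → ℝ → ℝ := fun n => radialMean (φ n) with hF
  set J : Set ℝ := Set.Icc (-(Real.pi / 2)) (Real.pi / 2) with hJ
  have hFc : ∀ n, Continuous (F n) := fun n => continuous_radialMean (hφ n).1.1.continuous
  have hgrad : ∀ n, AEStronglyMeasurable (fun x => g x - gradient (φ n) x)
      (volume.restrict (halfBall 3)) := fun n =>
    hW.memLp_grad.1.sub (continuous_gradient (hφ n).1.1).aestronglyMeasurable
  set C : ℝ := 2 * K.toReal with hC
  have hC0 : 0 ≤ C := by positivity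
  have hdiff : ∀ n m, ∀ θ ∈ J, |F n θ - F m θ| ≤ C * (1 / (n + 1) + 1 / (m + 1)) := by
    intro n m θ hθ
    have h1 := enorm_radialMean_le ((hφ n).1.sub (hφ m).1) hθ
    rw [radialMean_sub (hφ n).1.1.continuous (hφ m).1.1.continuous] at h1
    have h2 : ∫⁻ x in halfBall 3, ‖gradient (fun y => φ n y - φ m y) x‖ₑ ≤
        (ENNReal.ofReal (1 / (n + 1)) + ENNReal.ofReal (1 / (m + 1))) * K := by
      calc _ ≤ ∫⁻ x in halfBall 3, (‖g x - gradient (φ n) x‖ₑ + ‖g x - gradient (φ m) x‖ₑ) := by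
            refine lintegral_mono fun x => ?_
            rw [gradient_sub (hφ n).1.differentiable (hφ m).1.differentiable]
            calc ‖gradient (φ n) x - gradient (φ m) x‖ₑ
                = ‖(g x - gradient (φ m) x) - (g x - gradient (φ n) x)‖ₑ := by
                  congr 1
                  abel
              _ ≤ _ := (enorm_sub_le).trans_eq (add_comm _ _)
        _ = (∫⁻ x in halfBall 3, ‖g x - gradient (φ n) x‖ₑ) +
            ∫⁻ x in halfBall 3, ‖g x - gradient (φ m) x‖ₑ :=
              lintegral_add_left' (hgrad n).enorm _
        _ ≤ _ := by
            rw [add_mul]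
            exact add_le_add
              ((lintegral_enorm_le_eLpNorm_two (hgrad n)).trans (by gcongr; exact (hφ n).2.2))
              ((lintegral_enorm_le_eLpNorm_two (hgrad m)).trans (by gcongr; exact (hφ m).2.2))
    have h3 : ‖F n θ - F m θ‖ₑ ≤ ENNReal.ofReal (C * (1 / (n + 1) + 1 / (m + 1))) := by
      refine h1.trans ((mul_le_mul_right h2 2).trans_eq ?_)
      rw [← ENNReal.ofReal_add (by positivity) (by positivity), hC, mul_assoc,
        ENNReal.ofReal_mul zero_le_two, ENNReal.ofReal_mul ENNReal.toReal_nonneg,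
        ENNReal.ofReal_toReal hKtop, mul_comm K]
      simp
    rwa [← ofReal_norm, ENNReal.ofReal_le_ofReal_iff (by positivity)] at h3
  have htend : Tendsto (fun n : ℕ => (1 : ℝ) / (n + 1)) atTop (𝓝 0) :=
    tendsto_one_div_add_atTop_nhds_zero_nat
  have hlim : ∀ θ ∈ J, ∃ l, Tendsto (fun n => F n θ) atTop (𝓝 l) := by
    intro θ hθ
    refine cauchySeq_tendsto_of_complete (cauchySeq_of_le_tendsto_0
      (fun N : ℕ => C * (1 / (N + 1) + 1 / (N + 1))) (fun n m N hn hm => ?_) ?_)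
    · refine (hdiff n m θ hθ).trans ?_
      gcongr
    · simpa using (htend.add htend).const_mul C
  choose! G hG using hlim
  have hGF : ∀ n, ∀ θ ∈ J, |F n θ - G θ| ≤ C * (1 / (n + 1)) := by
    intro n θ hθ
    refine le_of_tendsto_of_tendsto ((tendsto_const_nhds.sub (hG θ hθ)).abs) ?_
      (Eventually.of_forall fun m => hdiff n m θ hθ)
    simpa using (tendsto_const_nhds.add htend).const_mul C
  have hunif : TendstoUniformlyOn F G atTop J := by
    rw [Metric.tendstoUniformlyOn_iff]
    intro ε hε
    have h0 : Tendsto (fun n : ℕ => C * ((1 : ℝ) / (n + 1))) atTop (𝓝 0) := by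
      simpa using htend.const_mul C
    filter_upwards [h0.eventually_lt_const hε] with n hn θ hθ
    rw [dist_comm]
    exact (hGF n θ hθ).trans_lt hn
  have hGc : ContinuousOn G J :=
    hunif.continuousOn (Frequently.of_forall fun n => (hFc n).continuousOn)
  have hle : -(Real.pi / 2) ≤ Real.pi / 2 := by linarith [Real.pi_pos]
  have hGend : ∀ θ ∈ J, Real.cos θ = 0 → G θ = 0 := by
    intro θ hθ hcos
    refine tendsto_nhds_unique (hG θ hθ) ?_
    simp only [hF, radialMean_eq_zero (hφ _).1 hcos]
    exact tendsto_const_nhds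
  have hGf : ∀ᵐ θ ∂(volume.restrict angles), G θ = c * f₀ θ := by
    have hGm : AEStronglyMeasurable G (volume.restrict angles) :=
      (hGc.mono Set.Ioo_subset_Icc_self).aestronglyMeasurable measurableSet_Ioo
    have hm : AEStronglyMeasurable (fun θ => G θ - c * f₀ θ) (volume.restrict angles) :=
      hGm.sub (hf₀.const_mul c).aestronglyMeasurable
    have hint : ∫⁻ θ in angles, ‖G θ - c * f₀ θ‖ₑ = 0 := by
      refine le_antisymm ?_ zero_le
      have hb : ∀ n : ℕ, ∫⁻ θ in angles, ‖G θ - c * f₀ θ‖ₑ ≤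
          ENNReal.ofReal (C * (1 / (n + 1))) * volume angles +
            ENNReal.ofReal (1 / (n + 1)) * K := by
        intro n
        calc _ ≤ ∫⁻ θ in angles, (‖F n θ - G θ‖ₑ + ‖F n θ - c * f₀ θ‖ₑ) := by
              refine lintegral_mono fun θ => ?_
              calc ‖G θ - c * f₀ θ‖ₑ = ‖(F n θ - c * f₀ θ) - (F n θ - G θ)‖ₑ := by
                    congr 1
                    abel
                _ ≤ _ := (enorm_sub_le).trans_eq (add_comm _ _)
          _ = (∫⁻ θ in angles, ‖F n θ - G θ‖ₑ) + ∫⁻ θ in angles, ‖F n θ - c * f₀ θ‖ₑ :=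
              lintegral_add_left' ((hFc n).aestronglyMeasurable.sub hGm).enorm _
          _ ≤ _ := by
              refine add_le_add ?_ ?_
              · refine (setLIntegral_mono' measurableSet_Ioo fun θ hθ => ?_).trans_eq
                  (setLIntegral_const _ _)
                rw [← ofReal_norm]
                exact ENNReal.ofReal_le_ofReal (hGF n θ (Set.Ioo_subset_Icc_self hθ))
              · have hum : AEStronglyMeasurable (fun x => u x - φ n x)
                  (volume.restrict (halfBall 3)) :=
                  hW.memLp.1.sub (hφ n).1.1.continuous.aestronglyMeasurable
                refine (lintegral_radialMean_sub_le hW.memLp.1 hf₀ huf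
                  (hφ n).1.1.continuous).trans ((lintegral_enorm_le_eLpNorm_two hum).trans ?_)
                gcongr
                exact (hφ n).2.1
      refine ge_of_tendsto' (x := atTop) (f := fun n : ℕ =>
        ENNReal.ofReal (C * (1 / (n + 1))) * volume angles +
          ENNReal.ofReal (1 / (n + 1)) * K) ?_ hb
      have t1 : Tendsto (fun n : ℕ => ENNReal.ofReal (C * (1 / (n + 1)))) atTop (𝓝 0) := by
        simpa using ENNReal.tendsto_ofReal (htend.const_mul C)
      have t2 : Tendsto (fun n : ℕ => ENNReal.ofReal (1 / (n + 1))) atTop (𝓝 0) := by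
        simpa using ENNReal.tendsto_ofReal htend
      have hv : volume angles ≠ ⊤ := by simp [angles]
      simpa using (ENNReal.Tendsto.mul_const t1 (Or.inr hv)).add
        (ENNReal.Tendsto.mul_const t2 (Or.inr hKtop))
    rw [lintegral_eq_zero_iff' hm.enorm] at hint
    filter_upwards [hint] with θ hθ
    simpa [sub_eq_zero] using hθ
  refine ⟨fun θ => c⁻¹ * G (Set.projIcc _ _ hle θ), ?_, ?_, ?_⟩
  · exact continuous_const.mul (hGc.comp_continuous (continuous_subtype_val.comp
      continuous_projIcc) fun θ => (Set.projIcc _ _ hle θ).2)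
  · intro θ hθ
    beta_reduce
    rcases not_and_or.1 hθ with h | h
    · rw [Set.projIcc_of_le_left hle (not_lt.1 h)]
      simp [hGend _ (Set.left_mem_Icc.2 hle)]
    · rw [Set.projIcc_of_right_le hle (not_lt.1 h)]
      simp [hGend _ (Set.right_mem_Icc.2 hle)]
  · have h2 : ∀ᵐ q ∂polarMeasure, G q.2 = c * f₀ q.2 :=
      Measure.quasiMeasurePreserving_snd.ae hGf
    filter_upwards [huf, h2, ae_polarMeasure_mem] with q h1 h2 h3
    rw [Set.projIcc_of_mem hle (Set.Ioo_subset_Icc_self h3.2), h1, h2]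
    field_simp

/-! ### Test functions in separated variables -/

/-- `ζ ∈ C_c^∞(U)` for a set `U` of real numbers. -/
structure IsLineTest (U : Set ℝ) (ζ : ℝ → ℝ) : Prop where
  contDiff : ContDiff ℝ ∞ ζ
  hasCompactSupport : HasCompactSupport ζ
  tsupport_subset : tsupport ζ ⊆ U

/-- A fixed smooth bump function of the radius, supported in `[5/4, 7/4]`. -/
noncomputable def radialBump : ContDiffBump (3 / 2 : ℝ) :=
  ⟨1 / 8, 1 / 4, by norm_num, by norm_num⟩

lemma IsLineTest.eq_zero {U : Set ℝ} {ζ : ℝ → ℝ} (h : IsLineTest U ζ) {x : ℝ} (hx : x ∉ U) :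
    ζ x = 0 := image_eq_zero_of_notMem_tsupport fun h' => hx (h.tsupport_subset h')

lemma IsLineTest.mono {U V : Set ℝ} {ζ : ℝ → ℝ} (h : IsLineTest U ζ) (hUV : U ⊆ V) :
    IsLineTest V ζ := ⟨h.1, h.2, h.3.trans hUV⟩

lemma IsLineTest.deriv {U : Set ℝ} {ζ : ℝ → ℝ} (h : IsLineTest U ζ) : IsLineTest U (deriv ζ) := by
  refine ⟨?_, h.2.deriv, (closure_minimal (support_deriv_subset) (isClosed_tsupport ζ)).trans h.3⟩
  exact ((contDiff_infty_iff_deriv (𝕜 := ℝ)).1 h.1).2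

lemma IsLineTest.differentiable {U : Set ℝ} {ζ : ℝ → ℝ} (h : IsLineTest U ζ) :
    Differentiable ℝ ζ := h.1.differentiable (by simp)

lemma IsLineTest.hasDerivAt {U : Set ℝ} {ζ : ℝ → ℝ} (h : IsLineTest U ζ) (x : ℝ) :
    HasDerivAt ζ (_root_.deriv ζ x) x := (h.differentiable x).hasDerivAt

lemma IsLineTest.continuous {U : Set ℝ} {ζ : ℝ → ℝ} (h : IsLineTest U ζ) :
    Continuous ζ := h.1.continuous

lemma isLineTest_radialBump : IsLineTest (Set.Ioo 1 2) radialBump := by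
  refine ⟨radialBump.contDiff, radialBump.hasCompactSupport, ?_⟩
  rw [radialBump.tsupport_eq, Real.closedBall_eq_Icc]
  intro x hx
  simp only [radialBump, Set.mem_Icc, Set.mem_Ioo] at *
  constructor <;> linarith [hx.1, hx.2]

/-- The polar angle of a point of the half plane; it means nothing elsewhere. -/
noncomputable def angle (x : Plane) : ℝ := Real.arctan (x 1 / x 0)

lemma angle_polar {q : ℝ × ℝ} (h1 : 0 < q.1) (h2 : q.2 ∈ angles) : angle (polar q) = q.2 := by
  rw [angle, polar_zero, polar_one, mul_div_mul_left _ _ h1.ne', ← Real.tan_eq_sin_div_cos,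
    Real.arctan_tan h2.1 h2.2]

lemma polar_norm_angle {x : Plane} (hx : x ∈ halfPlane) : polar (‖x‖, angle x) = x := by
  have h0 : 0 < x 0 := hx
  have hn : ‖x‖ = x 0 * √(1 + (x 1 / x 0) ^ 2) := by
    rw [EuclideanSpace.norm_eq, Fin.sum_univ_two, ← Real.sqrt_sq h0.le,
      ← Real.sqrt_mul (sq_nonneg _), Real.sqrt_sq h0.le]
    congr 1
    simp only [Real.norm_eq_abs, sq_abs]
    field_simp
  have hs : √(1 + (x 1 / x 0) ^ 2) ≠ 0 := (Real.sqrt_pos.2 (by positivity)).ne'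
  ext i
  fin_cases i
  · change ‖x‖ * Real.cos (angle x) = x 0
    rw [angle, Real.cos_arctan, hn]
    field_simp
  · change ‖x‖ * Real.sin (angle x) = x 1
    rw [angle, Real.sin_arctan, hn]
    field_simp

/-- The function `η(r) ζ(θ)` on the half plane, extended by zero, where `η` is the fixed radial
bump function. -/
noncomputable def sepTest (ζ : ℝ → ℝ) (x : Plane) : ℝ :=
  halfPlane.indicator (fun x => radialBump ‖x‖ * ζ (angle x)) x

lemma sepTest_polar (ζ : ℝ → ℝ) {q : ℝ × ℝ} (h1 : 0 < q.1) (h2 : q.2 ∈ angles) :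
    sepTest ζ (polar q) = radialBump q.1 * ζ q.2 := by
  rw [sepTest, Set.indicator_of_mem (polar_mem_halfPlane h1 h2), norm_polar h1.le,
    angle_polar h1 h2]

lemma isTest_sepTest {ζ : ℝ → ℝ} (hζ : IsLineTest angles ζ) : IsTest (halfBall 3) (sepTest ζ) := by
  set K : Set Plane := polar '' (tsupport radialBump ×ˢ tsupport ζ) with hK
  have hKc : IsCompact K :=
    (isLineTest_radialBump.2.isCompact.prod hζ.2.isCompact).image continuous_polar
  have hKD : K ⊆ halfBall 3 := by
    rintro _ ⟨q, hq, rfl⟩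
    have h1 := isLineTest_radialBump.3 hq.1
    have hpos : 0 < q.1 := by linarith [h1.1]
    refine ⟨?_, polar_mem_halfPlane hpos (hζ.3 hq.2)⟩
    rw [mem_ball_zero_iff, norm_polar hpos.le]
    linarith [h1.2]
  have hzero : ∀ x, x ∉ K → sepTest ζ x = 0 := by
    intro x hx
    by_contra h
    have hxH : x ∈ halfPlane := by
      by_contra h'
      exact h (Set.indicator_of_notMem h' _)
    rw [sepTest, Set.indicator_of_mem hxH] at h
    exact hx ⟨(‖x‖, angle x), ⟨subset_tsupport _ (left_ne_zero_of_mul h),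
      subset_tsupport _ (right_ne_zero_of_mul h)⟩, polar_norm_angle hxH⟩
  have hts : tsupport (sepTest ζ) ⊆ K := by
    refine closure_minimal (fun x hx => ?_) hKc.isClosed
    by_contra h
    exact hx (hzero x h)
  refine ⟨?_, hKc.of_isClosed_subset (isClosed_tsupport _) hts, hts.trans hKD⟩
  rw [contDiff_iff_contDiffAt]
  intro x
  by_cases hx : x ∈ K
  · have hxH : x ∈ halfPlane := (hKD hx).2
    have h0 : x 0 ≠ 0 := (show 0 < x 0 from hxH).ne'
    have hne : x ≠ 0 := fun h => h0 (by simp [h])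
    have hp : ∀ i : Fin 2, ContDiffAt ℝ ∞ (fun y : Plane => y i) x := fun i =>
      (EuclideanSpace.proj (𝕜 := ℝ) i).contDiff.contDiffAt
    have hc : ContDiffAt ℝ ∞ (fun y : Plane => radialBump ‖y‖ * ζ (angle y)) x := by
      refine ContDiffAt.mul ?_ ?_
      · exact isLineTest_radialBump.1.contDiffAt.comp x (contDiffAt_norm ℝ hne)
      · refine hζ.1.contDiffAt.comp x ?_
        exact Real.contDiff_arctan.contDiffAt.comp x ((hp 1).div (hp 0) h0)
    refine hc.congr_of_eventuallyEq ?_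
    filter_upwards [isOpen_halfPlane.mem_nhds hxH] with y hy
    exact Set.indicator_of_mem hy _
  · refine (contDiffAt_const (c := (0 : ℝ))).congr_of_eventuallyEq ?_
    filter_upwards [hKc.isClosed.isOpen_compl.mem_nhds hx] with y hy using hzero y hy

lemma inner_gradient_sepTest_radialDir {ζ : ℝ → ℝ} (hζ : IsLineTest angles ζ) {q : ℝ × ℝ}
    (h1 : 0 < q.1) (h2 : q.2 ∈ angles) :
    inner ℝ (gradient (sepTest ζ) (polar q)) (radialDir q.2) = deriv radialBump q.1 * ζ q.2 := by
  refine (hasDerivAt_comp_polar_radius (isTest_sepTest hζ).differentiable q.1 q.2).unique ?_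
  refine ((isLineTest_radialBump.hasDerivAt q.1).mul_const (ζ q.2)).congr_of_eventuallyEq ?_
  filter_upwards [Ioi_mem_nhds h1] with r hr using sepTest_polar ζ (q := (r, q.2)) hr h2

lemma inner_gradient_sepTest_angularDir {ζ : ℝ → ℝ} (hζ : IsLineTest angles ζ) {q : ℝ × ℝ}
    (h1 : 0 < q.1) (h2 : q.2 ∈ angles) :
    q.1 * inner ℝ (gradient (sepTest ζ) (polar q)) (angularDir q.2) =
      radialBump q.1 * deriv ζ q.2 := by
  refine (hasDerivAt_comp_polar_angle (isTest_sepTest hζ).differentiable q.1 q.2).unique ?_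
  refine ((hζ.hasDerivAt q.2).const_mul (radialBump q.1)).congr_of_eventuallyEq ?_
  filter_upwards [Ioo_mem_nhds h2.1 h2.2] with θ hθ using sepTest_polar ζ (q := (q.1, θ)) h1 hθ

/-! ### Integration over the annulus -/

lemma integrable_annulus {h : ℝ × ℝ → ℝ}
    (hc : ContinuousOn h (Set.Icc 1 2 ×ˢ Set.Icc (-(Real.pi / 2)) (Real.pi / 2))) :
    Integrable h annulusMeasure := by
  rw [annulusMeasure, Measure.prod_restrict]
  exact (hc.integrableOn_compact (isCompact_Icc.prod isCompact_Icc)).mono_set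
    (Set.prod_mono Set.Ioo_subset_Icc_self Set.Ioo_subset_Icc_self)

lemma ae_annulusMeasure_mem : ∀ᵐ q ∂annulusMeasure, q.1 ∈ Set.Ioo (1 : ℝ) 2 ∧ q.2 ∈ angles := by
  rw [annulusMeasure, Measure.prod_restrict]
  exact ae_restrict_mem (measurableSet_Ioo.prod measurableSet_Ioo)

lemma ae_annulusMeasure_of_ae_polarMeasure {P : ℝ × ℝ → Prop} (h : ∀ᵐ q ∂polarMeasure, P q) :
    ∀ᵐ q ∂annulusMeasure, P q :=
  (Measure.absolutelyContinuous_of_le annulusMeasure_le).ae_le (ae_restrict_of_ae h)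

lemma polarMeasure_restrict_annulus : polarMeasure.restrict (Set.Ioo 1 2 ×ˢ Set.univ) =
    annulusMeasure.withDensity fun q => ENNReal.ofReal q.1 := by
  have h2 := Measure.prod_restrict (μ := radialMeasure) (ν := volume.restrict angles)
    (Set.Ioo 1 2) Set.univ
  rw [Measure.restrict_univ] at h2
  rw [polarMeasure, ← h2, annulusMeasure, ← prod_withDensity_left (by fun_prop)]
  unfold radialMeasure
  rw [restrict_withDensity measurableSet_Ioo, Measure.restrict_restrict measurableSet_Ioo,
      Set.inter_eq_left.2 (Set.Ioo_subset_Ioi_self.trans (Set.Ioi_subset_Ioi zero_le_one))]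

/-- Integration in polar coordinates of a function supported in `{1 < |x| < 2}`. -/
lemma integral_halfBall_eq {ψ : Plane → ℝ}
    (hψ : AEStronglyMeasurable ψ (volume.restrict (halfBall 3)))
    (h0 : ∀ r θ, 0 < r → θ ∈ angles → r ∉ Set.Ioo (1 : ℝ) 2 → ψ (polar (r, θ)) = 0) :
    ∫ x in halfBall 3, ψ x = ∫ q, q.1 * ψ (polar q) ∂annulusMeasure := by
  have h := measurePreserving_polar_halfBall 3
  have hm : MeasurableSet (Set.Ioo (1 : ℝ) 2 ×ˢ (Set.univ : Set ℝ)) :=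
    measurableSet_Ioo.prod MeasurableSet.univ
  have hint : ∫ q, q.1 * ψ (polar q) ∂annulusMeasure =
      ∫ q in Set.Ioo 1 2 ×ˢ Set.univ, ψ (polar q) ∂polarMeasure := by
    rw [polarMeasure_restrict_annulus, integral_withDensity_eq_integral_toReal_smul (by fun_prop)
      (Eventually.of_forall fun _ => ENNReal.ofReal_lt_top)]
    refine integral_congr_ae ?_
    filter_upwards [ae_annulusMeasure_mem] with q hq
    rw [ENNReal.toReal_ofReal (zero_lt_one.trans hq.1.1).le, smul_eq_mul]
  rw [hint]
  rw [← h.map_eq] at hψ ⊢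
  rw [integral_map h.measurable.aemeasurable hψ, ← integral_indicator hm,
    ← integral_indicator (continuous_polar.measurable measurableSet_ball)]
  refine integral_congr_ae ?_
  filter_upwards [ae_polarMeasure_mem] with q hq
  by_cases hq1 : q.1 ∈ Set.Ioo (1 : ℝ) 2
  · have : q ∈ polar ⁻¹' ball 0 3 := by
      change polar q ∈ ball 0 3
      rw [mem_ball_zero_iff, norm_polar hq.1.le]
      linarith [hq1.2]
    have h' : q ∈ Set.Ioo (1 : ℝ) 2 ×ˢ (Set.univ : Set ℝ) := ⟨hq1, trivial⟩
    rw [Set.indicator_of_mem this, Set.indicator_of_mem h']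
  · have h' : q ∉ Set.Ioo (1 : ℝ) 2 ×ˢ (Set.univ : Set ℝ) := fun h => hq1 h.1
    rw [Set.indicator_of_notMem h']
    by_cases hb : q ∈ polar ⁻¹' ball 0 3
    · rw [Set.indicator_of_mem hb]
      exact h0 q.1 q.2 hq.1 hq.2 hq1
    · rw [Set.indicator_of_notMem hb]

/-! ### Smooth variations of a minimizer -/

/-- The potential `2 λ⁺ (s⁺)^p + 2 λ⁻ (s⁻)^p`. -/
noncomputable def potential (p lamP lamM s : ℝ) : ℝ :=
  2 * lamP * (max s 0) ^ p + 2 * lamM * (max (-s) 0) ^ p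

lemma continuous_potential {p : ℝ} (hp : 0 < p) (lamP lamM : ℝ) :
    Continuous (potential p lamP lamM) := by
  unfold potential
  exact (((continuous_id.max continuous_const).rpow_const fun _ => Or.inr hp.le).const_mul _).add
    (((continuous_neg.max continuous_const).rpow_const fun _ => Or.inr hp.le).const_mul _)

lemma rpow_le_one_add_sq {p s : ℝ} (hp0 : 0 < p) (hp1 : p < 1) :
    (max s 0) ^ p ≤ 1 + s ^ 2 := by
  have h0 : 0 ≤ max s 0 := le_max_right _ _
  have h1 : (max s 0) ^ 2 ≤ s ^ 2 := by
    rcases le_total s 0 with h | h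
    · rw [max_eq_right h]
      nlinarith [sq_nonneg s]
    · rw [max_eq_left h]
  rcases le_total (max s 0) 1 with h | h
  · nlinarith [Real.rpow_le_one h0 h hp0.le, sq_nonneg s]
  · have := Real.rpow_le_rpow_of_exponent_le h (hp1.le.trans one_le_two : p ≤ 2)
    rw [Real.rpow_two] at this
    linarith

lemma integrable_potential {X : Type*} [MeasurableSpace X] {μ : Measure X} [IsFiniteMeasure μ]
    {p lamP lamM : ℝ} (hp0 : 0 < p) (hp1 : p < 1) {u : X → ℝ} (hu : MemLp u 2 μ) :
    Integrable (fun x => potential p lamP lamM (u x)) μ := by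
  have hsq : Integrable (fun x => 1 + u x ^ 2) μ := (integrable_const 1).add hu.integrable_sq
  have key : ∀ σ : ℝ, σ ^ 2 = 1 → Integrable (fun x => (max (σ * u x) 0) ^ p) μ := by
    intro σ hσ
    refine hsq.mono' ?_ (Eventually.of_forall fun x => ?_)
    · have hc : Continuous fun s : ℝ => (max (σ * s) 0) ^ p :=
        ((continuous_const.mul continuous_id).max continuous_const).rpow_const
          fun _ => Or.inr hp0.le
      exact hc.comp_aestronglyMeasurable hu.1
    · rw [Real.norm_of_nonneg (Real.rpow_nonneg (le_max_right _ _) _)]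
      refine (rpow_le_one_add_sq hp0 hp1).trans_eq ?_
      rw [mul_pow, hσ, one_mul]
  have h1 := (key 1 (by norm_num)).const_mul (2 * lamP)
  have h2 := (key (-1) (by norm_num)).const_mul (2 * lamM)
  simp only [one_mul, neg_one_mul] at h1 h2
  exact h1.add h2

lemma IsTest.exists_gradient_bound {D : Set Plane} {φ : Plane → ℝ} (h : IsTest D φ) :
    ∃ C, ∀ x, ‖gradient φ x‖ ≤ C := by
  have hc : HasCompactSupport (gradient φ) :=
    (h.2.1.fderiv ℝ).comp_left (map_zero (InnerProductSpace.toDual ℝ Plane).symm)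
  exact hc.exists_bound_of_continuous (continuous_gradient h.1)

lemma IsTest.memLp_gradient {D : Set Plane} {φ : Plane → ℝ} (h : IsTest D φ) (R : ℝ) :
    MemLp (gradient φ) 2 (volume.restrict (halfBall R)) := by
  obtain ⟨C, hC⟩ := h.exists_gradient_bound
  exact MemLp.of_bound (continuous_gradient h.1).aestronglyMeasurable C (Eventually.of_forall hC)

lemma IsTest.memLp {D : Set Plane} {φ : Plane → ℝ} (h : IsTest D φ) (R : ℝ) :
    MemLp φ 2 (volume.restrict (halfBall R)) := by
  obtain ⟨C, hC⟩ := h.2.1.exists_bound_of_continuous h.1.continuous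
  exact MemLp.of_bound h.1.continuous.aestronglyMeasurable C (Eventually.of_forall hC)

lemma inner_gradient {φ : Plane → ℝ} (x v : Plane) :
    inner ℝ v (gradient φ x) = fderiv ℝ φ x v := by
  rw [real_inner_comm]
  exact InnerProductSpace.toDual_symm_apply

lemma IsTest.isWeakGradient {D : Set Plane} {φ : Plane → ℝ} (h : IsTest D φ) :
    IsWeakGradient D φ (gradient φ) := by
  intro ψ hψ
  have e1 : ∫ x in D, φ x • gradient ψ x = ∫ x, φ x • gradient ψ x :=
    setIntegral_eq_integral_of_forall_compl_eq_zero fun x hx => by rw [h.eq_zero hx, zero_smul]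
  have e2 : ∫ x in D, ψ x • gradient φ x = ∫ x, ψ x • gradient φ x :=
    setIntegral_eq_integral_of_forall_compl_eq_zero fun x hx => by rw [hψ.eq_zero hx, zero_smul]
  rw [e1, e2]
  have i1 : Integrable fun x => φ x • gradient ψ x :=
    (h.1.continuous.smul (continuous_gradient hψ.1)).integrable_of_hasCompactSupport
      h.2.1.smul_right
  have i2 : Integrable fun x => ψ x • gradient φ x :=
    (hψ.1.continuous.smul (continuous_gradient h.1)).integrable_of_hasCompactSupport
      hψ.2.1.smul_right
  refine ext_inner_left ℝ fun v => ?_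
  rw [inner_neg_right, ← integral_inner i1, ← integral_inner i2]
  simp only [inner_smul_right, inner_gradient]
  have j1 := (integrable_congr (Eventually.of_forall fun x => by
    rw [inner_smul_right, inner_gradient])).1 (i1.const_inner v)
  have j2 := (integrable_congr (Eventually.of_forall fun x => by
    rw [inner_smul_right, inner_gradient, mul_comm])).1 (i2.const_inner v)
  rw [integral_mul_fderiv_eq_neg_fderiv_mul_of_integrable j2 j1
    ((h.1.continuous.mul hψ.1.continuous).integrable_of_hasCompactSupport h.2.1.mul_right)
    (fun x _ => h.differentiable x) (fun x _ => hψ.differentiable x)]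
  simp only [mul_comm]

lemma IsW12.add_test {R : ℝ} {u φ : Plane → ℝ} {g : Plane → Plane} (h : IsW12 (halfBall R) u g)
    (hφ : IsTest (halfBall R) φ) :
    IsW12 (halfBall R) (fun x => u x + φ x) (fun x => g x + gradient φ x) := by
  refine ⟨h.1.add (hφ.memLp R), h.2.add (hφ.memLp_gradient R), fun ψ hψ => ?_⟩
  have hb : ∀ {w : Plane → ℝ}, MemLp w 2 (volume.restrict (halfBall R)) →
      Integrable (fun x => w x • gradient ψ x) (volume.restrict (halfBall R)) := by
    intro w hw
    obtain ⟨C, hC⟩ := hψ.exists_gradient_bound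
    exact (hw.integrable one_le_two).smul_bdd C (continuous_gradient hψ.1).aestronglyMeasurable
      (Eventually.of_forall hC)
  have hb' : ∀ {k : Plane → Plane}, MemLp k 2 (volume.restrict (halfBall R)) →
      Integrable (fun x => ψ x • k x) (volume.restrict (halfBall R)) := by
    intro k hk
    obtain ⟨C, hC⟩ := hψ.2.1.exists_bound_of_continuous hψ.1.continuous
    exact (hk.integrable one_le_two).bdd_smul C hψ.1.continuous.aestronglyMeasurable
      (Eventually.of_forall hC)
  simp only [add_smul, smul_add]
  rw [integral_add (hb h.1) (hb (hφ.memLp R)), integral_add (hb' h.2) (hb' (hφ.memLp_gradient R)),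
    h.3 ψ hψ, hφ.isWeakGradient ψ hψ, neg_add]

lemma integrable_inner_gradient {R : ℝ} {φ : Plane → ℝ} {k : Plane → Plane}
    (hk : MemLp k 2 (volume.restrict (halfBall R))) (hφ : IsTest (halfBall R) φ) :
    Integrable (fun x => inner ℝ (k x) (gradient φ x)) (volume.restrict (halfBall R)) := by
  obtain ⟨C, hC⟩ := hφ.exists_gradient_bound
  refine ((hk.integrable one_le_two).norm.mul_const C).mono'
    (hk.1.inner (continuous_gradient hφ.1).aestronglyMeasurable) (Eventually.of_forall fun x => ?_)
  exact (norm_inner_le_norm _ _).trans (mul_le_mul_of_nonneg_left (hC x) (norm_nonneg _))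

/-- Comparison of the energies of a minimizer `u` and of `u + φ`. -/
lemma variation_nonneg {p lamP lamM R : ℝ} (hp0 : 0 < p) (hp1 : p < 1) {u φ : Plane → ℝ}
    {g : Plane → Plane} (hW : IsW12 (halfBall R) u g)
    (hmin : ∀ v h, IsW12 (halfBall R) v h →
      IsLimitOfTests (halfBall R) (halfBall R) (fun x => v x - u x) (fun x => h x - g x) →
      energy p lamP lamM (halfBall R) u g ≤ energy p lamP lamM (halfBall R) v h)
    (hφ : IsTest (halfBall R) φ) :
    0 ≤ 2 * (∫ x in halfBall R, inner ℝ (g x) (gradient φ x)) +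
      (∫ x in halfBall R, ‖gradient φ x‖ ^ 2) +
      ∫ x in halfBall R, (potential p lamP lamM (u x + φ x) - potential p lamP lamM (u x)) := by
  have hv := hW.add_test hφ
  have hle := hmin _ _ hv (fun ε _ => ⟨φ, hφ, by simp, by simp⟩)
  have hi := integrable_inner_gradient hW.2 hφ
  have hG := (hφ.memLp_gradient R).integrable_norm_pow (by norm_num)
  have hg := hW.2.integrable_norm_pow (by norm_num)
  have hg' := hv.2.integrable_norm_pow (by norm_num)
  have hP := integrable_potential (lamP := lamP) (lamM := lamM) hp0 hp1 hW.1
  have hP' := integrable_potential (lamP := lamP) (lamM := lamM) hp0 hp1 hv.1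
  have e : ∀ (w : Plane → ℝ) (k : Plane → Plane), energy p lamP lamM (halfBall R) w k =
      ∫ x in halfBall R, (‖k x‖ ^ 2 + potential p lamP lamM (w x)) := by
    intro w k
    simp only [energy, potential, add_assoc]
  rw [e, e, ← sub_nonneg, ← integral_sub] at hle
  · refine hle.trans_eq ?_
    rw [← integral_const_mul, ← integral_add, ← integral_add]
    · refine integral_congr_ae (Eventually.of_forall fun x => ?_)
      beta_reduce
      rw [norm_add_sq_real]
      ring
    · exact (hi.const_mul 2).add (by simpa using hG)
    · exact hP'.sub hP
    · exact hi.const_mul 2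
    · simpa using hG
  · exact (by simpa using hg' : Integrable (fun x => ‖g x + gradient φ x‖ ^ 2) _).add hP'
  · exact (by simpa using hg : Integrable (fun x => ‖g x‖ ^ 2) _).add hP

/-! ### Separation of variables -/

lemma continuous_radialDir : Continuous radialDir := by
  unfold radialDir
  fun_prop

lemma continuous_angularDir : Continuous angularDir := by
  unfold angularDir
  fun_prop

/-- Integration by parts against a test function on an interval. -/
lemma integral_deriv_mul_lineTest {a b : ℝ} (hab : a ≤ b) {F F' χ : ℝ → ℝ}
    (hF : ∀ x ∈ Set.Icc a b, HasDerivAt F (F' x) x) (hF' : ContinuousOn F' (Set.Icc a b))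
    (hχ : IsLineTest (Set.Ioo a b) χ) :
    ∫ x in Set.Ioo a b, F' x * χ x = -∫ x in Set.Ioo a b, F x * deriv χ x := by
  rw [← integral_Ioc_eq_integral_Ioo, ← integral_Ioc_eq_integral_Ioo,
    ← intervalIntegral.integral_of_le hab, ← intervalIntegral.integral_of_le hab]
  have h := intervalIntegral.integral_mul_deriv_eq_deriv_mul (a := a) (b := b) (u := F) (v := χ)
    (u' := F') (v' := deriv χ) (fun x hx => hF x (by rwa [Set.uIcc_of_le hab] at hx))
    (fun x _ => hχ.hasDerivAt x)
    (ContinuousOn.intervalIntegrable (by rwa [Set.uIcc_of_le hab]))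
    (hχ.deriv.continuous.intervalIntegrable _ _)
  rw [h, hχ.eq_zero (x := a) (by simp), hχ.eq_zero (x := b) (by simp)]
  simp

lemma half_pi_le : -(Real.pi / 2) ≤ Real.pi / 2 := by linarith [Real.pi_pos]

lemma integral_radial_deriv_mul {A A' : ℝ × ℝ → ℝ} (hA : Continuous A) (hA' : Continuous A')
    (hd : ∀ r θ, HasDerivAt (fun s => A (s, θ)) (A' (r, θ)) r) {χ ζ : ℝ → ℝ}
    (hχ : IsLineTest (Set.Ioo 1 2) χ) (hζ : Continuous ζ) :
    ∫ q, A' q * (χ q.1 * ζ q.2) ∂annulusMeasure =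
      -∫ q, A q * (deriv χ q.1 * ζ q.2) ∂annulusMeasure := by
  have hχc := hχ.continuous
  have hχc' := hχ.deriv.continuous
  rw [integral_prod_symm _ (integrable_annulus (by fun_prop)),
    integral_prod_symm _ (integrable_annulus (by fun_prop)), ← integral_neg]
  refine integral_congr_ae (Eventually.of_forall fun θ => ?_)
  beta_reduce
  simp only [← mul_assoc]
  rw [integral_mul_const, integral_mul_const, ← neg_mul]
  congr 1
  exact integral_deriv_mul_lineTest one_le_two (fun r _ => hd r θ)
    (by fun_prop) hχ

lemma integral_angular_deriv_mul {A A' : ℝ × ℝ → ℝ} (hA : Continuous A) (hA' : Continuous A')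
    (hd : ∀ r θ, HasDerivAt (fun t => A (r, t)) (A' (r, θ)) θ) {χ ζ : ℝ → ℝ}
    (hχ : ContinuousOn χ (Set.Icc 1 2)) (hζ : IsLineTest angles ζ) :
    ∫ q, A' q * (χ q.1 * ζ q.2) ∂annulusMeasure =
      -∫ q, A q * (χ q.1 * deriv ζ q.2) ∂annulusMeasure := by
  have hζc := hζ.continuous
  have hζc' := hζ.deriv.continuous
  have hχ2 : ContinuousOn (fun q : ℝ × ℝ => χ q.1)
      (Set.Icc 1 2 ×ˢ Set.Icc (-(Real.pi / 2)) (Real.pi / 2)) :=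
    hχ.comp continuous_fst.continuousOn fun q hq => hq.1
  have hc : ContinuousOn (fun q => A' q * (χ q.1 * ζ q.2))
      (Set.Icc 1 2 ×ˢ Set.Icc (-(Real.pi / 2)) (Real.pi / 2)) :=
    hA'.continuousOn.mul (hχ2.mul (by fun_prop))
  have hc' : ContinuousOn (fun q => A q * (χ q.1 * deriv ζ q.2))
      (Set.Icc 1 2 ×ˢ Set.Icc (-(Real.pi / 2)) (Real.pi / 2)) :=
    hA.continuousOn.mul (hχ2.mul (by fun_prop))
  rw [integral_prod _ (integrable_annulus hc), integral_prod _ (integrable_annulus hc'),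
    ← integral_neg]
  refine integral_congr_ae (Eventually.of_forall fun r => ?_)
  beta_reduce
  simp only [mul_left_comm _ (χ r)]
  rw [integral_const_mul, integral_const_mul, ← mul_neg]
  congr 1
  exact integral_deriv_mul_lineTest half_pi_le (fun θ _ => hd r θ) (by fun_prop) hζ

lemma isLineTest_id_mul_deriv_bump :
    IsLineTest (Set.Ioo 1 2) fun r => r * deriv radialBump r :=
  ⟨contDiff_id.mul isLineTest_radialBump.deriv.1, isLineTest_radialBump.deriv.2.mul_left,
    (tsupport_mul_subset_right).trans isLineTest_radialBump.deriv.3⟩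

/-- `r` times the Laplacian of `η(r) ζ(θ)`, written in polar coordinates. -/
noncomputable def sepLaplacian (ζ : ℝ → ℝ) (q : ℝ × ℝ) : ℝ :=
  deriv (fun r => r * deriv radialBump r) q.1 * ζ q.2 +
    radialBump q.1 / q.1 * deriv (deriv ζ) q.2

lemma continuousOn_bump_div : ContinuousOn (fun r => radialBump r / r) (Set.Icc 1 2) :=
  isLineTest_radialBump.continuous.continuousOn.div continuousOn_id
    fun _ hr => (zero_lt_one.trans_le hr.1).ne'

lemma continuousOn_fst {χ : ℝ → ℝ} (hχ : ContinuousOn χ (Set.Icc 1 2)) :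
    ContinuousOn (fun q : ℝ × ℝ => χ q.1)
      (Set.Icc 1 2 ×ˢ Set.Icc (-(Real.pi / 2)) (Real.pi / 2)) :=
  hχ.comp continuous_fst.continuousOn fun _ hq => hq.1

lemma continuousOn_sepLaplacian {ζ : ℝ → ℝ} (hζ : IsLineTest angles ζ) :
    ContinuousOn (sepLaplacian ζ) (Set.Icc 1 2 ×ˢ Set.Icc (-(Real.pi / 2)) (Real.pi / 2)) := by
  have h1 := hζ.continuous
  have h2 := hζ.deriv.deriv.continuous
  have h3 := isLineTest_id_mul_deriv_bump.deriv.continuous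
  have h4 := continuousOn_fst continuousOn_bump_div
  exact ContinuousOn.add (by fun_prop) (h4.mul (by fun_prop))

lemma bump_eq_zero {r : ℝ} (hr : r ∉ Set.Ioo (1 : ℝ) 2) : radialBump r = 0 :=
  isLineTest_radialBump.eq_zero hr

lemma gradient_sepTest_eq_zero {ζ : ℝ → ℝ} (hζ : IsLineTest angles ζ) {r θ : ℝ} (hr : 0 < r)
    (hθ : θ ∈ angles) (h : r ∉ Set.Ioo (1 : ℝ) 2) :
    gradient (sepTest ζ) (polar (r, θ)) = 0 := by
  have h1 := inner_gradient_sepTest_radialDir hζ (q := (r, θ)) hr hθ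
  have h2 := inner_gradient_sepTest_angularDir hζ (q := (r, θ)) hr hθ
  rw [isLineTest_radialBump.deriv.eq_zero h, zero_mul] at h1
  rw [bump_eq_zero h, zero_mul, mul_eq_zero, or_iff_right hr.ne'] at h2
  rw [← inner_self_eq_zero (𝕜 := ℝ), inner_eq_polar_components _ _ θ, h1, h2]
  simp

lemma integral_inner_gradient_sepTest {a : Plane → ℝ} (ha : ContDiff ℝ ∞ a) {ζ : ℝ → ℝ}
    (hζ : IsLineTest angles ζ) :
    ∫ x in halfBall 3, inner ℝ (gradient a x) (gradient (sepTest ζ) x) =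
      -∫ q, a (polar q) * sepLaplacian ζ q ∂annulusMeasure := by
  have hda : Differentiable ℝ a := ha.differentiable (by simp)
  have hg : Continuous fun q : ℝ × ℝ => gradient a (polar q) :=
    (continuous_gradient ha).comp continuous_polar
  have hap : Continuous fun q : ℝ × ℝ => a (polar q) := ha.continuous.comp continuous_polar
  have hr := continuous_radialDir
  have hθ := continuous_angularDir
  have hη := isLineTest_radialBump.continuous
  have hη' := isLineTest_radialBump.deriv.continuous
  have hz := hζ.continuous
  have hz' := hζ.deriv.continuous
  have hz2 := hζ.deriv.deriv.continuous
  have hdiv := continuousOn_fst continuousOn_bump_div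
  have hL := isLineTest_id_mul_deriv_bump.deriv.continuous
  rw [integral_halfBall_eq ((continuous_gradient ha).inner
    (continuous_gradient (isTest_sepTest hζ).1)).aestronglyMeasurable fun r θ h1 h2 h3 => by
      rw [gradient_sepTest_eq_zero hζ h1 h2 h3, inner_zero_right]]
  have e : ∫ q, q.1 * inner ℝ (gradient a (polar q)) (gradient (sepTest ζ) (polar q))
        ∂annulusMeasure =
      ∫ q, (inner ℝ (gradient a (polar q)) (radialDir q.2) *
          ((fun r => r * deriv radialBump r) q.1 * ζ q.2) +
        q.1 * inner ℝ (gradient a (polar q)) (angularDir q.2) *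
          ((fun r => radialBump r / r) q.1 * deriv ζ q.2)) ∂annulusMeasure := by
    refine integral_congr_ae ?_
    filter_upwards [ae_annulusMeasure_mem] with q hq
    have hq0 : 0 < q.1 := zero_lt_one.trans hq.1.1
    have h1 := inner_gradient_sepTest_radialDir hζ hq0 hq.2
    have h2 := inner_gradient_sepTest_angularDir hζ hq0 hq.2
    rw [inner_eq_polar_components _ _ q.2, h1]
    have h3 : inner ℝ (gradient (sepTest ζ) (polar q)) (angularDir q.2) =
        radialBump q.1 * deriv ζ q.2 / q.1 := by
      rw [← h2]
      field_simp
    rw [h3]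
    field_simp
  rw [e, integral_add, integral_radial_deriv_mul (A := fun q => a (polar q))
    (A' := fun q => inner ℝ (gradient a (polar q)) (radialDir q.2)) hap (by fun_prop)
    (fun r θ => hasDerivAt_comp_polar_radius hda r θ) isLineTest_id_mul_deriv_bump hz,
    integral_angular_deriv_mul (A := fun q => a (polar q))
    (A' := fun q => q.1 * inner ℝ (gradient a (polar q)) (angularDir q.2)) hap (by fun_prop)
    (fun r θ => hasDerivAt_comp_polar_angle hda r θ) continuousOn_bump_div hζ.deriv, ← neg_add,
    ← integral_add]
  · simp only [sepLaplacian, mul_add]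
  · exact integrable_annulus (hap.continuousOn.mul (by fun_prop))
  · exact integrable_annulus (hap.continuousOn.mul (hdiv.mul (by fun_prop)))
  · exact integrable_annulus (by fun_prop)
  · exact integrable_annulus (by fun_prop)

/-- The weak form of the polar Laplacian, for `u = r ^ b * f θ` in `W^{1,2}` with zero trace. -/
lemma integral_inner_gradient_sepTest_of_limit {b : ℝ} {u : Plane → ℝ} {g : Plane → Plane}
    {f : ℝ → ℝ} (hW : IsW12 (halfBall 3) u g) (hT : IsLimitOfTests halfPlane (halfBall 3) u g)
    (huf : ∀ᵐ q ∂polarMeasure, u (polar q) = q.1 ^ b * f q.2) {ζ : ℝ → ℝ}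
    (hζ : IsLineTest angles ζ) :
    ∫ x in halfBall 3, inner ℝ (g x) (gradient (sepTest ζ) x) =
      -∫ q, q.1 ^ b * f q.2 * sepLaplacian ζ q ∂annulusMeasure := by
  obtain ⟨φ, hφ⟩ := hT.exists_seq
  have ht := isTest_sepTest hζ
  obtain ⟨C, hC⟩ := ht.exists_gradient_bound
  set K : ℝ≥0∞ := (volume.restrict (halfBall 3)) Set.univ ^ (1 / 2 : ℝ) with hK
  have hKtop : K ≠ ⊤ := ENNReal.rpow_ne_top_of_nonneg (by norm_num) (measure_ne_top _ _)
  have htend : Tendsto (fun n : ℕ => ENNReal.ofReal (1 / (n + 1)) * K) atTop (𝓝 0) := by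
    have t2 : Tendsto (fun n : ℕ => ENNReal.ofReal (1 / (n + 1))) atTop (𝓝 0) := by
      simpa using ENNReal.tendsto_ofReal tendsto_one_div_add_atTop_nhds_zero_nat
    simpa using ENNReal.Tendsto.mul_const t2 (Or.inr hKtop)
  have hg1 : ∀ n, ∫⁻ x in halfBall 3, ‖g x - gradient (φ n) x‖ₑ ≤
      ENNReal.ofReal (1 / (n + 1)) * K := fun n =>
    (lintegral_enorm_le_eLpNorm_two (hW.memLp_grad.1.sub
      (continuous_gradient (hφ n).1.1).aestronglyMeasurable)).trans (by gcongr; exact (hφ n).2.2)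
  have hu1 : ∀ n, ∫⁻ x in halfBall 3, ‖u x - φ n x‖ₑ ≤ ENNReal.ofReal (1 / (n + 1)) * K := fun n =>
    (lintegral_enorm_le_eLpNorm_two (hW.memLp.1.sub
      (hφ n).1.1.continuous.aestronglyMeasurable)).trans (by gcongr; exact (hφ n).2.1)
  have lim1 : Tendsto (fun n => ∫ x in halfBall 3, inner ℝ (gradient (φ n) x)
      (gradient (sepTest ζ) x)) atTop
      (𝓝 (∫ x in halfBall 3, inner ℝ (g x) (gradient (sepTest ζ) x))) := by
    refine tendsto_integral_of_L1 _ (integrable_inner_gradient hW.2 ht).1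
      (Eventually.of_forall fun n => integrable_inner_gradient ((hφ n).1.memLp_gradient 3) ht) ?_
    have t3 := ENNReal.Tendsto.const_mul (a := ENNReal.ofReal C) htend (Or.inr (by simp))
    rw [mul_zero] at t3
    refine tendsto_of_tendsto_of_tendsto_of_le_of_le tendsto_const_nhds t3 (fun _ => zero_le)
      fun n => ?_
    refine le_trans ?_ (mul_le_mul_right (hg1 n) (ENNReal.ofReal C))
    rw [← lintegral_const_mul' _ _ (by simp)]
    refine lintegral_mono fun x => ?_
    rw [← inner_sub_left, enorm_sub_rev (g x), ← ofReal_norm, ← ofReal_norm,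
      ← ENNReal.ofReal_mul ((norm_nonneg _).trans (hC x)), mul_comm]
    exact ENNReal.ofReal_le_ofReal ((norm_inner_le_norm _ _).trans
      (mul_le_mul_of_nonneg_left (hC x) (norm_nonneg _)))
  have hLc := continuousOn_sepLaplacian hζ
  obtain ⟨B, hB⟩ := (isCompact_Icc.prod isCompact_Icc).exists_bound_of_continuousOn hLc
  have hB0 : ∀ᵐ q ∂annulusMeasure, ‖sepLaplacian ζ q‖ ≤ B := by
    filter_upwards [ae_annulusMeasure_mem] with q hq
    exact hB q ⟨Set.Ioo_subset_Icc_self hq.1, Set.Ioo_subset_Icc_self hq.2⟩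
  have hLm : AEStronglyMeasurable (sepLaplacian ζ) annulusMeasure := (integrable_annulus hLc).1
  have hum : AEStronglyMeasurable (fun q => u (polar q)) annulusMeasure := by
    have h := measurePreserving_polar_halfBall 3
    exact (hW.memLp.1.comp_quasiMeasurePreserving h.quasiMeasurePreserving).mono_measure
      annulusMeasure_le
  have lim2 : Tendsto (fun n => ∫ q, φ n (polar q) * sepLaplacian ζ q ∂annulusMeasure) atTop
      (𝓝 (∫ q, u (polar q) * sepLaplacian ζ q ∂annulusMeasure)) := by
    refine tendsto_integral_of_L1 _ (hum.mul hLm)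
      (Eventually.of_forall fun n => integrable_annulus ?_) ?_
    · exact ((hφ n).1.1.continuous.comp continuous_polar).continuousOn.mul hLc
    have t3 := ENNReal.Tendsto.const_mul (a := ENNReal.ofReal B) htend (Or.inr (by simp))
    rw [mul_zero] at t3
    refine tendsto_of_tendsto_of_tendsto_of_le_of_le tendsto_const_nhds t3 (fun _ => zero_le)
      fun n => ?_
    refine le_trans ?_ (mul_le_mul_right ((lintegral_annulus_le (G := fun x => ‖u x - φ n x‖ₑ)
      (hW.memLp.1.sub (hφ n).1.1.continuous.aestronglyMeasurable).enorm).trans (hu1 n))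
      (ENNReal.ofReal B))
    rw [← lintegral_const_mul' _ _ (by simp)]
    refine lintegral_mono_ae ?_
    filter_upwards [hB0] with q hq
    rw [Pi.mul_apply, ← sub_mul, enorm_mul, enorm_sub_rev, mul_comm]
    gcongr
    rw [← ofReal_norm]
    exact ENNReal.ofReal_le_ofReal hq
  simp only [integral_inner_gradient_sepTest (hφ _).1.1 hζ] at lim1
  rw [tendsto_nhds_unique lim1 lim2.neg]
  congr 1
  refine integral_congr_ae ?_
  filter_upwards [ae_annulusMeasure_of_ae_polarMeasure huf] with q hq
  rw [hq]

/-- The integral `∫ r ^ (b - 1) η(r) dr` over the radial bump function `η`, which appears as a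
factor in front of every first-order angular term. -/
noncomputable def bumpWeight (b : ℝ) : ℝ := ∫ r in Set.Ioo (1 : ℝ) 2, r ^ (b - 1) * radialBump r

lemma bumpWeight_pos (b : ℝ) : 0 < bumpWeight b := by
  have hc : ContinuousOn (fun r : ℝ => r ^ (b - 1) * radialBump r) (Set.Icc 1 2) := by
    refine ContinuousOn.mul ?_ isLineTest_radialBump.continuous.continuousOn
    exact continuousOn_id.rpow_const fun r hr => Or.inl (zero_lt_one.trans_le hr.1).ne'
  rw [bumpWeight, ← integral_Ioc_eq_integral_Ioo, ← intervalIntegral.integral_of_le one_le_two]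
  refine intervalIntegral.integral_pos one_lt_two hc
    (fun r hr => mul_nonneg (Real.rpow_nonneg (zero_lt_one.trans hr.1).le _) radialBump.nonneg)
    ⟨3 / 2, ⟨by norm_num, by norm_num⟩, ?_⟩
  exact mul_pos (Real.rpow_pos_of_pos (by norm_num) _)
    (radialBump.pos_of_mem_ball (mem_ball_self radialBump.rOut_pos))

/-- The radial part of the Laplacian of `r ^ b` is `b ^ 2 r ^ (b - 2)`, in weak form. -/
lemma integral_rpow_mul_deriv (b : ℝ) :
    ∫ r in Set.Ioo (1 : ℝ) 2, r ^ b * deriv (fun r => r * deriv radialBump r) r =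
      b ^ 2 * bumpWeight b := by
  have hne : ∀ r ∈ Set.Icc (1 : ℝ) 2, r ≠ 0 := fun r hr => (zero_lt_one.trans_le hr.1).ne'
  have hd : ∀ r ∈ Set.Icc (1 : ℝ) 2, HasDerivAt (fun s : ℝ => s ^ b) (b * r ^ (b - 1)) r :=
    fun r hr => Real.hasDerivAt_rpow_const (Or.inl (hne r hr))
  have hc : ContinuousOn (fun r : ℝ => b * r ^ (b - 1)) (Set.Icc 1 2) :=
    continuousOn_const.mul (continuousOn_id.rpow_const fun r hr => Or.inl (hne r hr))
  have h1 := integral_deriv_mul_lineTest one_le_two hd hc isLineTest_id_mul_deriv_bump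
  have h2 := integral_deriv_mul_lineTest one_le_two hd hc isLineTest_radialBump
  have e1 : ∫ r in Set.Ioo (1 : ℝ) 2, b * r ^ (b - 1) * (r * deriv radialBump r) =
      b * ∫ r in Set.Ioo (1 : ℝ) 2, r ^ b * deriv radialBump r := by
    rw [← integral_const_mul]
    refine setIntegral_congr_fun measurableSet_Ioo fun r hr => ?_
    have hr0 : 0 < r := zero_lt_one.trans hr.1
    have : r ^ b = r ^ (b - 1) * r := by
      rw [← Real.rpow_add_one hr0.ne']
      congr 1
      ring
    simp only [this]
    ring
  have e2 : ∫ r in Set.Ioo (1 : ℝ) 2, b * r ^ (b - 1) * radialBump r = b * bumpWeight b := by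
    rw [bumpWeight, ← integral_const_mul]
    simp only [mul_assoc]
  rw [e1] at h1
  rw [e2] at h2
  linear_combination h1 - b * h2

lemma integral_mul_sepLaplacian {b : ℝ} {f : ℝ → ℝ} (hf : Continuous f) {ζ : ℝ → ℝ}
    (hζ : IsLineTest angles ζ) :
    ∫ q, q.1 ^ b * f q.2 * sepLaplacian ζ q ∂annulusMeasure =
      bumpWeight b * ∫ θ in angles, f θ * (deriv (deriv ζ) θ + b ^ 2 * ζ θ) := by
  have hz := hζ.continuous
  have hz2 := hζ.deriv.deriv.continuous
  have hL := isLineTest_id_mul_deriv_bump.deriv.continuous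
  have hη := isLineTest_radialBump.continuous
  have hpow : ∀ c : ℝ, ContinuousOn (fun r : ℝ => r ^ c) (Set.Icc 1 2) := fun c =>
    continuousOn_id.rpow_const fun r hr => Or.inl (zero_lt_one.trans_le hr.1).ne'
  have hint : ∀ {w : ℝ → ℝ}, Continuous w → Integrable w (volume.restrict angles) := fun hw =>
    hw.integrableOn_Icc.mono_set Set.Ioo_subset_Icc_self
  calc _ = ∫ q : ℝ × ℝ, ((q.1 ^ b * deriv (fun r => r * deriv radialBump r) q.1) * (f q.2 * ζ q.2) +
        (q.1 ^ (b - 1) * radialBump q.1) * (f q.2 * deriv (deriv ζ) q.2)) ∂annulusMeasure := by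
        refine integral_congr_ae ?_
        filter_upwards [ae_annulusMeasure_mem] with q hq
        have hr0 : 0 < q.1 := zero_lt_one.trans hq.1.1
        have : q.1 ^ b = q.1 ^ (b - 1) * q.1 := by
          rw [← Real.rpow_add_one hr0.ne']
          congr 1
          ring
        simp only [this, sepLaplacian]
        field_simp
    _ = b ^ 2 * bumpWeight b * (∫ θ in angles, f θ * ζ θ) +
        bumpWeight b * ∫ θ in angles, f θ * deriv (deriv ζ) θ := by
        rw [integral_add, integral_prod_mul
          (fun r : ℝ => r ^ b * deriv (fun r => r * deriv radialBump r) r) fun θ => f θ * ζ θ,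
          integral_prod_mul (fun r : ℝ => r ^ (b - 1) * radialBump r)
            fun θ => f θ * deriv (deriv ζ) θ, integral_rpow_mul_deriv]
        · rfl
        · exact integrable_annulus
            (((continuousOn_fst (hpow b)).mul (by fun_prop)).mul (by fun_prop))
        · exact integrable_annulus
            (((continuousOn_fst (hpow (b - 1))).mul (by fun_prop)).mul (by fun_prop))
    _ = _ := by
        simp only [mul_add, mul_left_comm _ (b ^ 2)]
        rw [integral_add (hint (by fun_prop)) (hint (by fun_prop)), integral_const_mul]
        ring

/-! ### The angular variational inequality -/

/-- The angular part `f` of a minimizer `r ^ β * f θ`: it is continuous, it vanishes outside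
`(-π/2, π/2)`, and it satisfies the inequality that results from comparing the energies of
`r ^ β * f θ` and `r ^ β * f θ + η(r) ζ(θ)`, where `η` is the fixed radial bump function. -/
structure IsProfile (p lamP lamM : ℝ) (f : ℝ → ℝ) : Prop where
  continuous : Continuous f
  eq_zero : ∀ θ, θ ∉ angles → f θ = 0
  variation : ∀ ζ, IsLineTest angles ζ →
    0 ≤ -(2 * bumpWeight (beta p)) *
        (∫ θ in angles, f θ * (deriv (deriv ζ) θ + beta p ^ 2 * ζ θ)) +
      (∫ q, q.1 * ((deriv radialBump q.1 * ζ q.2) ^ 2 +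
        (radialBump q.1 * deriv ζ q.2 / q.1) ^ 2) ∂annulusMeasure) +
      ∫ q, q.1 * (potential p lamP lamM (q.1 ^ beta p * f q.2 + radialBump q.1 * ζ q.2) -
        potential p lamP lamM (q.1 ^ beta p * f q.2)) ∂annulusMeasure

lemma one_lt_beta {p : ℝ} (hp0 : 0 < p) (hp1 : p < 1) : 1 < beta p := by
  rw [beta, lt_div_iff₀ (by linarith)]
  linarith

lemma beta_lt_two {p : ℝ} (hp1 : p < 1) : beta p < 2 := by
  rw [beta, div_lt_iff₀ (by linarith)]
  linarith

lemma beta_mul {p : ℝ} (hp1 : p < 1) : beta p * (2 - p) = 2 :=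
  div_mul_cancel₀ _ (by linarith)

lemma IsGlobalMinimizer.aestronglyMeasurable {p lamP lamM : ℝ} {u : Plane → ℝ}
    (hmin : IsGlobalMinimizer p lamP lamM u) :
    AEStronglyMeasurable u (volume.restrict halfPlane) := by
  have hU : halfPlane = ⋃ n : ℕ, halfBall (n + 1) := by
    ext x
    simp only [halfBall, Set.mem_iUnion, Set.mem_inter_iff, mem_ball_zero_iff]
    refine ⟨fun hx => ?_, fun ⟨_, h⟩ => h.2⟩
    obtain ⟨n, hn⟩ := exists_nat_gt ‖x‖
    exact ⟨n, by linarith, hx⟩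
  rw [hU, aestronglyMeasurable_iUnion_iff]
  intro n
  obtain ⟨g, hg, -⟩ := hmin (n + 1) (by positivity)
  exact hg.1.1

lemma exists_isProfile {p lamP lamM : ℝ} (hp0 : 0 < p) (hp1 : p < 1) {u : Plane → ℝ}
    (hmin : IsGlobalMinimizer p lamP lamM u) (hom : IsHomogeneous (beta p) u) :
    ∃ f, IsProfile p lamP lamM f ∧ ∀ᵐ q ∂polarMeasure, u (polar q) = q.1 ^ beta p * f q.2 := by
  obtain ⟨f₀, hf₀, huf₀⟩ := exists_angular_part hmin.aestronglyMeasurable hom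
  obtain ⟨g, hW, hT, hle⟩ := hmin 3 (by norm_num)
  obtain ⟨f, hf, hf0, huf⟩ := exists_continuous_angular_part hW hT hf₀ huf₀
  refine ⟨f, ⟨hf, hf0, fun ζ hζ => ?_⟩, huf⟩
  have ht := isTest_sepTest hζ
  have h := variation_nonneg hp0 hp1 hW hle ht
  have hpc := continuous_potential hp0 lamP lamM
  have e2 : ∫ x in halfBall 3, ‖gradient (sepTest ζ) x‖ ^ 2 =
      ∫ q, q.1 * ((deriv radialBump q.1 * ζ q.2) ^ 2 +
        (radialBump q.1 * deriv ζ q.2 / q.1) ^ 2) ∂annulusMeasure := by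
    rw [integral_halfBall_eq]
    · refine integral_congr_ae ?_
      filter_upwards [ae_annulusMeasure_mem] with q hq
      have hq0 : 0 < q.1 := zero_lt_one.trans hq.1.1
      rw [← real_inner_self_eq_norm_sq, inner_eq_polar_components _ _ q.2,
        inner_gradient_sepTest_radialDir hζ hq0 hq.2,
        ← inner_gradient_sepTest_angularDir hζ hq0 hq.2]
      field_simp
    · exact ((continuous_gradient ht.1).norm.pow 2).aestronglyMeasurable
    · intro r θ h1 h2 h3
      rw [gradient_sepTest_eq_zero hζ h1 h2 h3]
      simp
  have e3 : ∫ x in halfBall 3,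
      (potential p lamP lamM (u x + sepTest ζ x) - potential p lamP lamM (u x)) =
      ∫ q, q.1 * (potential p lamP lamM (q.1 ^ beta p * f q.2 + radialBump q.1 * ζ q.2) -
        potential p lamP lamM (q.1 ^ beta p * f q.2)) ∂annulusMeasure := by
    rw [integral_halfBall_eq]
    · refine integral_congr_ae ?_
      filter_upwards [ae_annulusMeasure_mem, ae_annulusMeasure_of_ae_polarMeasure huf]
        with q hq hq'
      rw [hq', sepTest_polar ζ (zero_lt_one.trans hq.1.1) hq.2]
    · exact (hpc.comp_aestronglyMeasurable
        (hW.memLp.1.add ht.1.continuous.aestronglyMeasurable)).sub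
        (hpc.comp_aestronglyMeasurable hW.memLp.1)
    · intro r θ h1 h2 h3
      rw [sepTest_polar ζ (q := (r, θ)) h1 h2, bump_eq_zero h3]
      simp
  rw [integral_inner_gradient_sepTest_of_limit hW hT huf hζ, integral_mul_sepLaplacian hf hζ,
    e2, e3] at h
  refine h.trans_eq ?_
  ring

lemma potential_neg (p lamP lamM s : ℝ) : potential p lamP lamM (-s) = potential p lamM lamP s := by
  simp only [potential, neg_neg]
  ring

lemma IsLineTest.const_mul {U : Set ℝ} {ζ : ℝ → ℝ} (h : IsLineTest U ζ) (c : ℝ) :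
    IsLineTest U fun x => c * ζ x :=
  ⟨contDiff_const.mul h.1, h.2.mul_left, (tsupport_mul_subset_right).trans h.3⟩

lemma deriv_deriv_const_mul (c : ℝ) (ζ : ℝ → ℝ) (x : ℝ) :
    deriv (deriv fun y => c * ζ y) x = c * deriv (deriv ζ) x := by
  rw [deriv_const_mul_field', deriv_const_mul_field]

lemma IsProfile.neg {p lamP lamM : ℝ} {f : ℝ → ℝ} (h : IsProfile p lamP lamM f) :
    IsProfile p lamM lamP fun θ => -f θ := by
  refine ⟨h.1.neg, fun θ hθ => by rw [h.2 θ hθ, neg_zero], fun ζ hζ => ?_⟩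
  refine (h.3 _ (hζ.const_mul (-1))).trans_eq ?_
  congr 1
  · congr 1
    · congr 1
      refine integral_congr_ae (Eventually.of_forall fun θ => ?_)
      simp only [deriv_deriv_const_mul]
      ring
    · simp only [deriv_const_mul_field']
      refine integral_congr_ae (Eventually.of_forall fun q => ?_)
      beta_reduce
      ring
  · refine integral_congr_ae (Eventually.of_forall fun q => ?_)
    beta_reduce
    rw [← potential_neg p lamM lamP, ← potential_neg p lamM lamP]
    congr 4 <;> ring

lemma max_add_rpow_le {p : ℝ} (hp0 : 0 < p) (hp1 : p < 1) (a b : ℝ) :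
    (max (a + b) 0) ^ p ≤ (max a 0) ^ p + |b| ^ p := by
  have h1 : max (a + b) 0 ≤ max a 0 + |b| := by
    refine max_le ?_ (by positivity)
    linarith [le_max_left a 0, le_abs_self b]
  refine (Real.rpow_le_rpow (le_max_right _ _) h1 hp0.le).trans ?_
  exact Real.rpow_add_le_add_rpow (le_max_right _ _) (abs_nonneg b) hp0.le hp1.le

lemma potential_add_le {p lamP lamM : ℝ} (hp0 : 0 < p) (hp1 : p < 1) (hP : 0 < lamP)
    (hM : 0 < lamM) (a b : ℝ) :
    potential p lamP lamM (a + b) - potential p lamP lamM a ≤ 2 * (lamP + lamM) * |b| ^ p := by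
  have h1 := max_add_rpow_le hp0 hp1 a b
  have h2 := max_add_rpow_le hp0 hp1 (-a) (-b)
  rw [← neg_add, abs_neg] at h2
  unfold potential
  nlinarith

/-- On a phase, the potential lies below its tangents, because `s ↦ s ^ p` is concave. -/
lemma potential_add_le_tangent {p lamP lamM : ℝ} (hp0 : 0 < p) (hp1 : p < 1) (hP : 0 < lamP)
    {a b : ℝ} (ha : 0 < a) (hab : 0 ≤ a + b) :
    potential p lamP lamM (a + b) - potential p lamP lamM a ≤
      2 * lamP * p * (a ^ (p - 1) * b) := by
  have h1 : (a + b) ^ p ≤ a ^ p + p * (a ^ (p - 1) * b) := by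
    have hs : -1 ≤ b / a := by
      rw [le_div_iff₀ ha]
      linarith
    have h := rpow_one_add_le_one_add_mul_self hs hp0.le hp1.le
    have e : a + b = a * (1 + b / a) := by field_simp
    rw [e, Real.mul_rpow ha.le (by linarith), Real.rpow_sub_one ha.ne']
    refine (mul_le_mul_of_nonneg_left h (Real.rpow_nonneg ha.le p)).trans_eq ?_
    field_simp
  unfold potential
  rw [max_eq_left hab, max_eq_left ha.le, max_eq_right (by linarith), max_eq_right (by linarith)]
  nlinarith

lemma continuousOn_rpow_Icc (c : ℝ) : ContinuousOn (fun r : ℝ => r ^ c) (Set.Icc 1 2) :=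
  continuousOn_id.rpow_const fun _ hr => Or.inl (zero_lt_one.trans_le hr.1).ne'

lemma exists_dirichlet_bound : ∃ A : ℝ, 0 ≤ A ∧ ∀ ζ, IsLineTest angles ζ →
    ∫ q, q.1 * ((deriv radialBump q.1 * ζ q.2) ^ 2 +
        (radialBump q.1 * deriv ζ q.2 / q.1) ^ 2) ∂annulusMeasure ≤
      A * ((∫ θ in angles, deriv ζ θ ^ 2) + ∫ θ in angles, ζ θ ^ 2) := by
  have hη := isLineTest_radialBump.continuous
  have hη' := isLineTest_radialBump.deriv.continuous
  set A₁ := ∫ r in Set.Ioo (1 : ℝ) 2, r * deriv radialBump r ^ 2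
  set A₂ := ∫ r in Set.Ioo (1 : ℝ) 2, radialBump r ^ 2 / r
  have h1 : 0 ≤ A₁ := setIntegral_nonneg measurableSet_Ioo fun r hr =>
    mul_nonneg (zero_lt_one.trans hr.1).le (sq_nonneg _)
  have h2 : 0 ≤ A₂ := setIntegral_nonneg measurableSet_Ioo fun r hr =>
    div_nonneg (sq_nonneg _) (zero_lt_one.trans hr.1).le
  refine ⟨A₁ + A₂, by positivity, fun ζ hζ => ?_⟩
  have hz := hζ.continuous
  have hz' := hζ.deriv.continuous
  have e : ∫ q, q.1 * ((deriv radialBump q.1 * ζ q.2) ^ 2 +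
        (radialBump q.1 * deriv ζ q.2 / q.1) ^ 2) ∂annulusMeasure =
      A₁ * (∫ θ in angles, ζ θ ^ 2) + A₂ * ∫ θ in angles, deriv ζ θ ^ 2 := by
    rw [← integral_prod_mul (fun r : ℝ => r * deriv radialBump r ^ 2) fun θ => ζ θ ^ 2,
      ← integral_prod_mul (fun r : ℝ => radialBump r ^ 2 / r) fun θ => deriv ζ θ ^ 2,
      ← integral_add]
    · refine integral_congr_ae ?_
      filter_upwards [ae_annulusMeasure_mem] with q hq
      have hq0 : 0 < q.1 := zero_lt_one.trans hq.1.1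
      field_simp
    · exact integrable_annulus (by fun_prop)
    · have hd : ContinuousOn (fun q : ℝ × ℝ => radialBump q.1 ^ 2 / q.1)
          (Set.Icc 1 2 ×ˢ Set.Icc (-(Real.pi / 2)) (Real.pi / 2)) :=
        continuousOn_fst ((hη.pow 2).continuousOn.div continuousOn_id
          fun _ hr => (zero_lt_one.trans_le hr.1).ne')
      exact integrable_annulus (hd.mul (by fun_prop))
  rw [e]
  have h3 : 0 ≤ ∫ θ in angles, ζ θ ^ 2 := integral_nonneg fun _ => sq_nonneg _
  have h4 : 0 ≤ ∫ θ in angles, deriv ζ θ ^ 2 := integral_nonneg fun _ => sq_nonneg _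
  nlinarith [mul_nonneg h1 h4, mul_nonneg h2 h3]

lemma continuousOn_potential_diff {p lamP lamM : ℝ} (hp0 : 0 < p) {f ζ : ℝ → ℝ}
    (hf : Continuous f) (hζ : Continuous ζ) :
    ContinuousOn (fun q : ℝ × ℝ => q.1 * (potential p lamP lamM
        (q.1 ^ beta p * f q.2 + radialBump q.1 * ζ q.2) -
        potential p lamP lamM (q.1 ^ beta p * f q.2)))
      (Set.Icc 1 2 ×ˢ Set.Icc (-(Real.pi / 2)) (Real.pi / 2)) := by
  have hη := isLineTest_radialBump.continuous
  have hpc := continuous_potential hp0 lamP lamM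
  have h1 := continuousOn_fst (continuousOn_rpow_Icc (beta p))
  have h2 : ContinuousOn (fun q : ℝ × ℝ => q.1 ^ beta p * f q.2)
      (Set.Icc 1 2 ×ˢ Set.Icc (-(Real.pi / 2)) (Real.pi / 2)) := h1.mul (by fun_prop)
  have h3 : ContinuousOn (fun q : ℝ × ℝ => q.1 ^ beta p * f q.2 + radialBump q.1 * ζ q.2)
      (Set.Icc 1 2 ×ˢ Set.Icc (-(Real.pi / 2)) (Real.pi / 2)) := h2.add (by fun_prop)
  exact continuous_fst.continuousOn.mul ((hpc.comp_continuousOn h3).sub (hpc.comp_continuousOn h2))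

/-- The weak form of the statement that `f'' + β² f` is bounded above up to lower-order terms: the
last integral is small compared to the first one for test functions concentrated on a short
interval. -/
def HasKinkBound (p : ℝ) (f : ℝ → ℝ) : Prop :=
  ∃ K : ℝ, 0 < K ∧ ∀ ζ, IsLineTest angles ζ →
    ∫ θ in angles, f θ * (deriv (deriv ζ) θ + beta p ^ 2 * ζ θ) ≤
      K * ((∫ θ in angles, deriv ζ θ ^ 2) + (∫ θ in angles, ζ θ ^ 2) +
        ∫ θ in angles, |ζ θ| ^ p)

/-- Of the potential, only its Hölder continuity is used here. -/
lemma IsProfile.hasKinkBound {p lamP lamM : ℝ} {f : ℝ → ℝ} (hp0 : 0 < p) (hp1 : p < 1)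
    (hP : 0 < lamP) (hM : 0 < lamM) (h : IsProfile p lamP lamM f) : HasKinkBound p f := by
  obtain ⟨A, hA0, hA⟩ := exists_dirichlet_bound
  have hη := isLineTest_radialBump.continuous
  set B := ∫ r in Set.Ioo (1 : ℝ) 2, r * (2 * (lamP + lamM)) * |radialBump r| ^ p
  have hB : 0 ≤ B := setIntegral_nonneg measurableSet_Ioo fun r hr => by
    have := zero_lt_one.trans hr.1
    positivity
  have hw := bumpWeight_pos (beta p)
  refine ⟨(A + B + 1) / (2 * bumpWeight (beta p)), by positivity, fun ζ hζ => ?_⟩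
  have hz := hζ.continuous
  have h1 := h.3 ζ hζ
  have h2 := hA ζ hζ
  have hap : ∀ {w : ℝ × ℝ → ℝ}, Continuous w → Continuous fun q => |w q| ^ p := fun hw =>
    hw.abs.rpow_const fun _ => Or.inr hp0.le
  have h3 : ∫ q, q.1 * (potential p lamP lamM (q.1 ^ beta p * f q.2 + radialBump q.1 * ζ q.2) -
        potential p lamP lamM (q.1 ^ beta p * f q.2)) ∂annulusMeasure ≤
      B * ∫ θ in angles, |ζ θ| ^ p := by
    rw [← integral_prod_mul (fun r : ℝ => r * (2 * (lamP + lamM)) * |radialBump r| ^ p)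
      fun θ => |ζ θ| ^ p]
    refine integral_mono_ae (integrable_annulus (continuousOn_potential_diff hp0 h.1 hz))
      (integrable_annulus ?_) ?_
    · have c1 := hap (w := fun q => radialBump q.1) (by fun_prop)
      have c2 := hap (w := fun q => ζ q.2) (by fun_prop)
      fun_prop
    · filter_upwards [ae_annulusMeasure_mem] with q hq
      have hq0 : 0 < q.1 := zero_lt_one.trans hq.1.1
      have := potential_add_le hp0 hp1 hP hM (q.1 ^ beta p * f q.2) (radialBump q.1 * ζ q.2)
      rw [abs_mul, Real.mul_rpow (abs_nonneg _) (abs_nonneg _)] at this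
      refine (mul_le_mul_of_nonneg_left this hq0.le).trans_eq ?_
      ring
  have i1 : 0 ≤ ∫ θ in angles, ζ θ ^ 2 := integral_nonneg fun _ => sq_nonneg _
  have i2 : 0 ≤ ∫ θ in angles, deriv ζ θ ^ 2 := integral_nonneg fun _ => sq_nonneg _
  have i3 : 0 ≤ ∫ θ in angles, |ζ θ| ^ p :=
    integral_nonneg fun _ => Real.rpow_nonneg (abs_nonneg _) _
  rw [div_mul_eq_mul_div, le_div_iff₀ (by positivity)]
  nlinarith [mul_nonneg hA0 i3, mul_nonneg hB i1, mul_nonneg hB i2]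

lemma continuous_max_rpow {f : ℝ → ℝ} (hf : Continuous f) {δ : ℝ} (hδ : 0 < δ) (c : ℝ) :
    Continuous fun θ => (max (f θ) δ) ^ c :=
  (hf.max continuous_const).rpow_const fun _ => Or.inl (hδ.trans_le (le_max_right _ _)).ne'

/-- The powers of `r` in the linearized potential combine to `r ^ (β - 1)`, because
`β (p - 1) + 1 = β - 1`. -/
lemma integral_potential_diff_le {p lamP lamM : ℝ} {f : ℝ → ℝ} (hp0 : 0 < p) (hp1 : p < 1)
    (hP : 0 < lamP) (hf : Continuous f) {δ : ℝ} (hδ : 0 < δ) {ζ : ℝ → ℝ} (hz : Continuous ζ)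
    (hζδ : ∀ θ, ζ θ ≠ 0 → δ ≤ f θ) (hsmall : ∀ θ, |ζ θ| ≤ δ) :
    ∫ q, q.1 * (potential p lamP lamM (q.1 ^ beta p * f q.2 + radialBump q.1 * ζ q.2) -
        potential p lamP lamM (q.1 ^ beta p * f q.2)) ∂annulusMeasure ≤
      bumpWeight (beta p) * ∫ θ in angles, 2 * (p * lamP * (max (f θ) δ) ^ (p - 1) * ζ θ) := by
  have hη := isLineTest_radialBump.continuous
  have hβ := beta_mul hp1
  have hβ1 := one_lt_beta hp0 hp1
  have hcont := continuous_max_rpow hf hδ (p - 1)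
  have e := integral_prod_mul (μ := volume.restrict (Set.Ioo (1 : ℝ) 2))
    (ν := volume.restrict angles) (fun r : ℝ => r ^ (beta p - 1) * radialBump r)
    fun θ => 2 * (p * lamP * (max (f θ) δ) ^ (p - 1) * ζ θ)
  refine le_of_le_of_eq ?_ e
  refine integral_mono_ae (integrable_annulus (continuousOn_potential_diff hp0 hf hz))
    (integrable_annulus ?_) ?_
  · have hc2 : Continuous fun θ => 2 * (p * lamP * (max (f θ) δ) ^ (p - 1) * ζ θ) :=
      ((hcont.const_mul (p * lamP)).mul hz).const_mul 2
    exact ((continuousOn_fst (continuousOn_rpow_Icc _)).mul (by fun_prop)).mul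
      (hc2.comp continuous_snd).continuousOn
  · filter_upwards [ae_annulusMeasure_mem] with q hq
    have hq0 : 0 < q.1 := zero_lt_one.trans hq.1.1
    by_cases hq2 : ζ q.2 = 0
    · simp [hq2]
    have hfδ := hζδ _ hq2
    have hf0 : 0 < f q.2 := hδ.trans_le hfδ
    have hpow : 1 ≤ q.1 ^ beta p := Real.one_le_rpow hq.1.1.le (by linarith)
    have hb : |radialBump q.1 * ζ q.2| ≤ q.1 ^ beta p * f q.2 := by
      rw [abs_mul, abs_of_nonneg radialBump.nonneg]
      calc radialBump q.1 * |ζ q.2| ≤ 1 * δ :=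
            mul_le_mul radialBump.le_one (hsmall _) (abs_nonneg _) zero_le_one
        _ ≤ q.1 ^ beta p * f q.2 := mul_le_mul hpow hfδ hδ.le (zero_le_one.trans hpow)
    have := potential_add_le_tangent (lamM := lamM) hp0 hp1 hP
      (a := q.1 ^ beta p * f q.2) (b := radialBump q.1 * ζ q.2)
      (mul_pos (by linarith) hf0) (by linarith [neg_abs_le (radialBump q.1 * ζ q.2)])
    refine (mul_le_mul_of_nonneg_left this hq0.le).trans_eq ?_
    rw [max_eq_left hfδ, Real.mul_rpow (by linarith) hf0.le, ← Real.rpow_mul hq0.le]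
    have hexp : q.1 ^ (beta p - 1) = q.1 * q.1 ^ (beta p * (p - 1)) := by
      rw [mul_comm, ← Real.rpow_add_one hq0.ne']
      congr 1
      linarith
    rw [hexp]
    ring

lemma nonneg_of_forall_small {A D t₀ : ℝ} (ht₀ : 0 < t₀)
    (h : ∀ t, 0 < t → t ≤ t₀ → 0 ≤ t * A + t ^ 2 * D) : 0 ≤ A := by
  have h1 : Tendsto (fun t : ℝ => A + t * D) (𝓝[>] 0) (𝓝 (A + 0 * D)) :=
    ((continuous_const.add (continuous_id.mul continuous_const)).tendsto 0).mono_left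
      nhdsWithin_le_nhds
  rw [zero_mul, add_zero] at h1
  refine ge_of_tendsto h1 ?_
  filter_upwards [Ioc_mem_nhdsGT ht₀] with t ht
  have h2 := h t ht.1 ht.2
  have h3 : t * A + t ^ 2 * D = t * (A + t * D) := by ring
  rw [h3] at h2
  exact nonneg_of_mul_nonneg_right h2 ht.1

/-- The first variation in the direction `ζ`. Since `s ↦ s ^ p` is singular at zero, the test
function has to live where `f ≥ δ`; the truncation `max (f θ) δ` keeps the integrand continuous. -/
lemma IsProfile.weak_inequality {p lamP lamM : ℝ} {f : ℝ → ℝ} (hp0 : 0 < p) (hp1 : p < 1)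
    (hP : 0 < lamP) (h : IsProfile p lamP lamM f) {δ : ℝ} (hδ : 0 < δ) {ζ : ℝ → ℝ}
    (hζ : IsLineTest angles ζ) (hζδ : ∀ θ, ζ θ ≠ 0 → δ ≤ f θ) :
    ∫ θ in angles, f θ * (deriv (deriv ζ) θ + beta p ^ 2 * ζ θ) ≤
      ∫ θ in angles, p * lamP * (max (f θ) δ) ^ (p - 1) * ζ θ := by
  obtain ⟨Z, hZ⟩ := hζ.2.exists_bound_of_continuous hζ.continuous
  have hZ0 : 0 ≤ Z := (norm_nonneg _).trans (hZ 0)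
  set X := ∫ θ in angles, f θ * (deriv (deriv ζ) θ + beta p ^ 2 * ζ θ) with hX
  set Y := ∫ θ in angles, p * lamP * (max (f θ) δ) ^ (p - 1) * ζ θ with hY
  set D := ∫ q, q.1 * ((deriv radialBump q.1 * ζ q.2) ^ 2 +
      (radialBump q.1 * deriv ζ q.2 / q.1) ^ 2) ∂annulusMeasure with hD
  have step : ∀ t : ℝ, 0 < t → t ≤ δ / (Z + 1) →
      0 ≤ t * (2 * bumpWeight (beta p) * (Y - X)) + t ^ 2 * D := by
    intro t ht htZ
    rw [le_div_iff₀ (by positivity)] at htZ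
    have h1 := h.3 _ (hζ.const_mul t)
    have e1 : ∫ θ in angles, f θ * (deriv (deriv fun y => t * ζ y) θ +
        beta p ^ 2 * (t * ζ θ)) = t * X := by
      rw [hX, ← integral_const_mul]
      refine integral_congr_ae (Eventually.of_forall fun θ => ?_)
      simp only [deriv_deriv_const_mul]
      ring
    have e2 : ∫ q, q.1 * ((deriv radialBump q.1 * (t * ζ q.2)) ^ 2 +
        (radialBump q.1 * deriv (fun y => t * ζ y) q.2 / q.1) ^ 2) ∂annulusMeasure =
        t ^ 2 * D := by
      rw [hD, ← integral_const_mul]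
      refine integral_congr_ae (Eventually.of_forall fun q => ?_)
      simp only [deriv_const_mul_field']
      ring
    have e3 := integral_potential_diff_le (lamM := lamM) hp0 hp1 hP h.1 hδ
      (hζ.continuous.const_mul t) (fun θ hθ => hζδ θ (right_ne_zero_of_mul hθ)) fun θ => by
        rw [abs_mul, abs_of_pos ht]
        have : t * |ζ θ| ≤ t * Z := mul_le_mul_of_nonneg_left (hZ θ) ht.le
        linarith
    have e4 : ∫ θ in angles, 2 * (p * lamP * (max (f θ) δ) ^ (p - 1) * (t * ζ θ)) =
        2 * t * Y := by
      rw [hY, ← integral_const_mul]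
      refine integral_congr_ae (Eventually.of_forall fun θ => ?_)
      beta_reduce
      ring
    rw [e1, e2] at h1
    rw [e4] at e3
    linarith
  have h2 := nonneg_of_forall_small (by positivity) step
  have h3 : 0 < 2 * bumpWeight (beta p) := by
    have := bumpWeight_pos (beta p)
    positivity
  exact sub_nonneg.1 (nonneg_of_mul_nonneg_right h2 h3)

/-- The weak form of `f'' + β² f = p λ⁺ f ^ (p - 1)`, for test functions supported in a set on
which `f ≥ δ > 0`. -/
lemma IsProfile.weak_equation {p lamP lamM : ℝ} {f : ℝ → ℝ} (hp0 : 0 < p) (hp1 : p < 1)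
    (hP : 0 < lamP) (h : IsProfile p lamP lamM f) {δ : ℝ} (hδ : 0 < δ) {ζ : ℝ → ℝ}
    (hζ : IsLineTest angles ζ) (hζδ : ∀ θ, ζ θ ≠ 0 → δ ≤ f θ) :
    ∫ θ in angles, f θ * (deriv (deriv ζ) θ + beta p ^ 2 * ζ θ) =
      ∫ θ in angles, p * lamP * (max (f θ) δ) ^ (p - 1) * ζ θ := by
  refine le_antisymm (h.weak_inequality hp0 hp1 hP hδ hζ hζδ) ?_
  have h2 := h.weak_inequality hp0 hp1 hP hδ (hζ.const_mul (-1))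
    fun θ hθ => hζδ θ (right_ne_zero_of_mul hθ)
  have e1 : ∫ θ in angles, f θ * (deriv (deriv fun y => -1 * ζ y) θ + beta p ^ 2 * (-1 * ζ θ)) =
      -∫ θ in angles, f θ * (deriv (deriv ζ) θ + beta p ^ 2 * ζ θ) := by
    rw [← integral_neg]
    refine integral_congr_ae (Eventually.of_forall fun θ => ?_)
    simp only [deriv_deriv_const_mul]
    ring
  have e2 : ∫ θ in angles, p * lamP * (max (f θ) δ) ^ (p - 1) * (-1 * ζ θ) =
      -∫ θ in angles, p * lamP * (max (f θ) δ) ^ (p - 1) * ζ θ := by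
    rw [← integral_neg]
    refine integral_congr_ae (Eventually.of_forall fun θ => ?_)
    beta_reduce
    ring
  rw [e1, e2] at h2
  linarith

/-! ### The lemma of du Bois-Reymond and the angular equation -/

/-- A test function on an interval with integral zero is the derivative of a test function. -/
lemma exists_lineTest_deriv_eq {a b : ℝ} (hab : a < b) {χ : ℝ → ℝ}
    (hχ : IsLineTest (Set.Ioo a b) χ) (h0 : ∫ x in Set.Ioo a b, χ x = 0) :
    ∃ ζ, IsLineTest (Set.Ioo a b) ζ ∧ deriv ζ = χ := by
  obtain ⟨a₁, b₁, ha, hb, hsub⟩ : ∃ a₁ b₁, a < a₁ ∧ b₁ < b ∧ tsupport χ ⊆ Set.Icc a₁ b₁ := by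
    have hK : IsCompact (insert ((a + b) / 2) (tsupport χ)) := hχ.2.isCompact.insert _
    have hne : (insert ((a + b) / 2) (tsupport χ)).Nonempty := Set.insert_nonempty _ _
    have hsub : insert ((a + b) / 2) (tsupport χ) ⊆ Set.Ioo a b :=
      Set.insert_subset ⟨by linarith, by linarith⟩ hχ.3
    refine ⟨_, _, (hsub (hK.sInf_mem hne)).1, (hsub (hK.sSup_mem hne)).2, fun x hx => ?_⟩
    exact ⟨csInf_le hK.bddBelow (Set.mem_insert_of_mem _ hx),
      le_csSup hK.bddAbove (Set.mem_insert_of_mem _ hx)⟩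
  have hd : ∀ x, HasDerivAt (fun y => ∫ t in a..y, χ t) (χ x) x := fun x =>
    (hχ.continuous.integral_hasStrictDerivAt a x).hasDerivAt
  have hderiv : deriv (fun y => ∫ t in a..y, χ t) = χ := funext fun x => (hd x).deriv
  have hz : ∀ x, x ∉ Set.Icc a₁ b₁ → χ x = 0 := fun x hx =>
    image_eq_zero_of_notMem_tsupport fun h => hx (hsub h)
  have hts : tsupport (fun y => ∫ t in a..y, χ t) ⊆ Set.Icc a₁ b₁ := by
    refine closure_minimal (fun x hx => ?_) isClosed_Icc
    by_contra hx'
    refine hx ?_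
    rcases not_and_or.1 hx' with h | h
    · have : ∀ t ∈ Set.uIcc a x, χ t = 0 := fun t ht => hz t fun h' => by
        have := ht.2.trans_lt (max_lt ha (not_le.1 h))
        linarith [h'.1]
      change ∫ t in a..x, χ t = 0
      rw [intervalIntegral.integral_congr (g := fun _ => 0) this]
      simp
    · change ∫ t in a..x, χ t = 0
      rw [intervalIntegral.integral_eq_integral_of_support_subset, ← h0]
      · exact (setIntegral_eq_integral_of_forall_compl_eq_zero fun t ht => hχ.eq_zero ht).symm
      · intro t ht
        have := hsub (subset_tsupport _ ht)
        exact ⟨ha.trans_le this.1, this.2.trans (not_le.1 h).le⟩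
  refine ⟨fun y => ∫ t in a..y, χ t, ⟨?_, ?_, hts.trans fun x hx => ?_⟩, hderiv⟩
  · rw [contDiff_infty_iff_deriv, hderiv]
    exact ⟨fun x => (hd x).differentiableAt, hχ.1⟩
  · exact isCompact_Icc.of_isClosed_subset (isClosed_tsupport _) hts
  · exact ⟨ha.trans_le hx.1, hx.2.trans_lt hb⟩

lemma exists_lineTest_integral_eq_one {a b : ℝ} (hab : a < b) :
    ∃ ρ, IsLineTest (Set.Ioo a b) ρ ∧ ∫ x in Set.Ioo a b, ρ x = 1 := by
  let B : ContDiffBump ((a + b) / 2) := ⟨(b - a) / 8, (b - a) / 4, by linarith, by linarith⟩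
  have hB : IsLineTest (Set.Ioo a b) (B.normed volume) := by
    refine ⟨B.contDiff_normed, B.hasCompactSupport_normed, ?_⟩
    rw [B.tsupport_normed_eq, Real.closedBall_eq_Icc]
    rintro x ⟨h1, h2⟩
    simp only [B] at h1 h2
    exact ⟨by linarith, by linarith⟩
  refine ⟨B.normed volume, hB, ?_⟩
  rw [setIntegral_eq_integral_of_forall_compl_eq_zero fun t ht => hB.eq_zero ht]
  exact B.integral_normed

lemma IsLineTest.sub {U : Set ℝ} {ζ ξ : ℝ → ℝ} (h : IsLineTest U ζ) (h' : IsLineTest U ξ) :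
    IsLineTest U fun x => ζ x - ξ x :=
  ⟨h.1.sub h'.1, h.2.sub h'.2, (tsupport_sub ζ ξ).trans (Set.union_subset h.3 h'.3)⟩

lemma integrable_Ioo {a b : ℝ} {w : ℝ → ℝ} (hw : Continuous w) :
    Integrable w (volume.restrict (Set.Ioo a b)) :=
  hw.integrableOn_Icc.mono_set Set.Ioo_subset_Icc_self

/-- The lemma of du Bois-Reymond. -/
lemma exists_eq_const_of_integral_mul_deriv {a b : ℝ} (hab : a < b) {w : ℝ → ℝ}
    (hw : Continuous w)
    (h : ∀ ζ, IsLineTest (Set.Ioo a b) ζ → ∫ x in Set.Ioo a b, w x * deriv ζ x = 0) :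
    ∃ c, ∀ x ∈ Set.Ioo a b, w x = c := by
  obtain ⟨ρ, hρ, hρ1⟩ := exists_lineTest_integral_eq_one hab
  have hρc := hρ.continuous
  refine ⟨∫ x in Set.Ioo a b, w x * ρ x, ?_⟩
  set c := ∫ x in Set.Ioo a b, w x * ρ x with hc
  have key : ∀ ψ, IsLineTest (Set.Ioo a b) ψ → ∫ x in Set.Ioo a b, (w x - c) * ψ x = 0 := by
    intro ψ hψ
    have hψc := hψ.continuous
    set m := ∫ x in Set.Ioo a b, ψ x with hm
    obtain ⟨ζ, hζ, hζd⟩ := exists_lineTest_deriv_eq hab (hψ.sub (hρ.const_mul m)) (by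
      rw [integral_sub (integrable_Ioo hψc) (integrable_Ioo (by fun_prop)), integral_const_mul,
        hρ1, hm]
      ring)
    have h1 := h ζ hζ
    rw [hζd] at h1
    have e : ∫ x in Set.Ioo a b, (w x - c) * ψ x =
        (∫ x in Set.Ioo a b, w x * (ψ x - m * ρ x)) +
          (m * (∫ x in Set.Ioo a b, w x * ρ x) - c * ∫ x in Set.Ioo a b, ψ x) := by
      rw [← integral_const_mul, ← integral_const_mul, ← integral_sub (integrable_Ioo (by fun_prop))
        (integrable_Ioo (by fun_prop)), ← integral_add (integrable_Ioo (by fun_prop))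
        (integrable_Ioo (by fun_prop))]
      refine integral_congr_ae (Eventually.of_forall fun x => ?_)
      beta_reduce
      ring
    rw [e, h1, ← hc, ← hm]
    ring
  have hae := isOpen_Ioo.ae_eq_zero_of_integral_contDiff_smul_eq_zero (μ := volume)
    (f := fun x => w x - c) (U := Set.Ioo a b)
    ((hw.sub continuous_const).locallyIntegrable.locallyIntegrableOn _) fun ψ h1 h2 h3 => by
      rw [← key ψ ⟨h1, h2, h3⟩, setIntegral_eq_integral_of_forall_compl_eq_zero]
      · simp only [smul_eq_mul, mul_comm]
      · intro x hx
        rw [IsLineTest.eq_zero ⟨h1, h2, h3⟩ hx, mul_zero]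
  have hEq : Set.EqOn w (fun _ => c) (Set.Ioo a b) := by
    refine Measure.eqOn_open_of_ae_eq (μ := volume) ?_ isOpen_Ioo hw.continuousOn
      continuousOn_const
    rw [Filter.EventuallyEq, ae_restrict_iff' measurableSet_Ioo]
    filter_upwards [hae] with x hx hxI using sub_eq_zero.1 (hx hxI)
  exact hEq

lemma exists_eq_affine_of_integral_mul_deriv_deriv {a b : ℝ} (hab : a < b) {w : ℝ → ℝ}
    (hw : Continuous w)
    (h : ∀ ζ, IsLineTest (Set.Ioo a b) ζ → ∫ x in Set.Ioo a b, w x * deriv (deriv ζ) x = 0) :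
    ∃ c₀ c₁, ∀ x ∈ Set.Ioo a b, w x = c₀ + c₁ * x := by
  obtain ⟨ρ, hρ, hρ1⟩ := exists_lineTest_integral_eq_one hab
  have hρc := hρ.continuous
  have hρc' := hρ.deriv.continuous
  set c := ∫ x in Set.Ioo a b, w x * deriv ρ x with hc
  obtain ⟨c₀, hc₀⟩ := exists_eq_const_of_integral_mul_deriv hab (w := fun x => w x + c * x)
    (by fun_prop) fun ψ hψ => by
    have hψc := hψ.continuous
    have hψc' := hψ.deriv.continuous
    set m := ∫ x in Set.Ioo a b, ψ x with hm
    obtain ⟨ζ, hζ, hζd⟩ := exists_lineTest_deriv_eq hab (hψ.sub (hρ.const_mul m)) (by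
      rw [integral_sub (integrable_Ioo hψc) (integrable_Ioo (by fun_prop)), integral_const_mul,
        hρ1, hm]
      ring)
    have h1 := h ζ hζ
    have hd : ∀ x, deriv (deriv ζ) x = deriv ψ x - m * deriv ρ x := fun x => by
      rw [hζd]
      exact ((hψ.hasDerivAt x).sub ((hρ.hasDerivAt x).const_mul m)).deriv
    simp only [hd] at h1
    have h2 := integral_deriv_mul_lineTest hab.le (F := fun x => x) (F' := fun _ => 1)
      (fun x _ => hasDerivAt_id x) continuousOn_const hψ
    simp only [one_mul] at h2
    have e : ∫ x in Set.Ioo a b, (w x + c * x) * deriv ψ x =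
        (∫ x in Set.Ioo a b, w x * (deriv ψ x - m * deriv ρ x)) +
          (m * (∫ x in Set.Ioo a b, w x * deriv ρ x) + c * ∫ x in Set.Ioo a b, x * deriv ψ x) := by
      rw [← integral_const_mul, ← integral_const_mul, ← integral_add (integrable_Ioo (by fun_prop))
        (integrable_Ioo (by fun_prop)), ← integral_add (integrable_Ioo (by fun_prop))
        (integrable_Ioo (by fun_prop))]
      refine integral_congr_ae (Eventually.of_forall fun x => ?_)
      beta_reduce
      ring
    rw [e, h1, ← hc]
    linear_combination c * h2
  exact ⟨c₀, -c, fun x hx => by linear_combination hc₀ x hx⟩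

/-- A continuous weak solution of `f'' = Q` is a classical one. -/
lemma hasDerivAt_deriv_of_weak {a b : ℝ} {f Q : ℝ → ℝ} (hf : Continuous f)
    (hQ : Continuous Q) (h : ∀ ζ, IsLineTest (Set.Ioo a b) ζ →
      ∫ x in Set.Ioo a b, f x * deriv (deriv ζ) x = ∫ x in Set.Ioo a b, Q x * ζ x)
    {x : ℝ} (hx : x ∈ Set.Ioo a b) :
    HasDerivAt f (deriv f x) x ∧ HasDerivAt (deriv f) (Q x) x := by
  have hab : a < b := hx.1.trans hx.2
  set Q₁ : ℝ → ℝ := fun y => ∫ t in a..y, Q t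
  have hd1 : ∀ y, HasDerivAt Q₁ (Q y) y := fun y =>
    (hQ.integral_hasStrictDerivAt a y).hasDerivAt
  have hQ₁ : Continuous Q₁ := continuous_iff_continuousAt.2 fun y => (hd1 y).continuousAt
  set Q₂ : ℝ → ℝ := fun y => ∫ t in a..y, Q₁ t
  have hd2 : ∀ y, HasDerivAt Q₂ (Q₁ y) y := fun y =>
    (hQ₁.integral_hasStrictDerivAt a y).hasDerivAt
  have hQ₂ : Continuous Q₂ := continuous_iff_continuousAt.2 fun y => (hd2 y).continuousAt
  obtain ⟨c₀, c₁, hc⟩ := exists_eq_affine_of_integral_mul_deriv_deriv hab (hf.sub hQ₂)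
    fun ζ hζ => by
      have h1 := integral_deriv_mul_lineTest hab.le (fun y _ => hd1 y) hQ.continuousOn hζ
      have h2 := integral_deriv_mul_lineTest hab.le (fun y _ => hd2 y) hQ₁.continuousOn hζ.deriv
      have hz2 := hζ.deriv.deriv.continuous
      simp only [Pi.sub_apply, sub_mul]
      rw [integral_sub (integrable_Ioo (by fun_prop)) (integrable_Ioo (by fun_prop)), h ζ hζ,
        h1, h2]
      ring
  have hf1 : ∀ y ∈ Set.Ioo a b, HasDerivAt f (Q₁ y + c₁) y := by
    intro y hy
    have h1 : HasDerivAt (fun z => Q₂ z + (c₀ + c₁ * z)) (Q₁ y + c₁) y := by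
      have := (hd2 y).add (((hasDerivAt_id y).const_mul c₁).const_add c₀)
      rwa [mul_one] at this
    refine h1.congr_of_eventuallyEq ?_
    filter_upwards [Ioo_mem_nhds hy.1 hy.2] with z hz
    have : f z - Q₂ z = c₀ + c₁ * z := hc z hz
    linarith
  refine ⟨(hf1 x hx).differentiableAt.hasDerivAt, ?_⟩
  refine ((hd1 x).add_const c₁).congr_of_eventuallyEq ?_
  filter_upwards [Ioo_mem_nhds hx.1 hx.2] with z hz using (hf1 z hz).deriv

/-- The Euler–Lagrange equation `f'' = p λ⁺ f ^ (p - 1) - β² f` where `f` is positive. -/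
lemma IsProfile.equation {p lamP lamM : ℝ} {f : ℝ → ℝ} (hp0 : 0 < p) (hp1 : p < 1)
    (hP : 0 < lamP) (h : IsProfile p lamP lamM f) {x : ℝ} (hx : 0 < f x) :
    HasDerivAt f (deriv f x) x ∧
      HasDerivAt (deriv f) (p * lamP * f x ^ (p - 1) - beta p ^ 2 * f x) x := by
  have hxI : x ∈ angles := by
    by_contra hc
    rw [h.2 x hc] at hx
    exact hx.false
  set δ := f x / 2 with hδ
  have hδ0 : 0 < δ := by positivity
  have hnhds : {y | δ < f y} ∩ angles ∈ 𝓝 x :=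
    inter_mem ((isOpen_lt continuous_const h.1).mem_nhds (show δ < f x by linarith))
      (isOpen_Ioo.mem_nhds hxI)
  obtain ⟨a, b, hab, hsub⟩ := mem_nhds_iff_exists_Ioo_subset.1 hnhds
  have hcont := continuous_max_rpow h.1 hδ0 (p - 1)
  have hfc := h.1
  have key := hasDerivAt_deriv_of_weak (a := a) (b := b) hfc
    (Q := fun y => p * lamP * (max (f y) δ) ^ (p - 1) - beta p ^ 2 * f y)
    ((hcont.const_mul (p * lamP)).sub (hfc.const_mul _)) (fun ζ hζ => ?_) hab
  · rwa [max_eq_left (by linarith : δ ≤ f x)] at key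
  have hζI : IsLineTest angles ζ := hζ.mono fun y hy => (hsub hy).2
  have hw := h.weak_equation hp0 hp1 hP hδ0 hζI fun θ hθ => by
    by_contra hc
    exact hθ (hζ.eq_zero fun h' => hc (le_of_lt (hsub h').1))
  have hz := hζ.continuous
  have hz2 := hζ.deriv.deriv.continuous
  have r1 : ∫ y in angles, f y * (deriv (deriv ζ) y + beta p ^ 2 * ζ y) =
      ∫ y in Set.Ioo a b, f y * (deriv (deriv ζ) y + beta p ^ 2 * ζ y) :=
    setIntegral_eq_of_subset_of_forall_sdiff_eq_zero measurableSet_Ioo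
      (fun y hy => (hsub hy).2) fun y hy => by
        rw [hζ.deriv.deriv.eq_zero hy.2, hζ.eq_zero hy.2]
        ring
  have r2 : ∫ y in angles, p * lamP * (max (f y) δ) ^ (p - 1) * ζ y =
      ∫ y in Set.Ioo a b, p * lamP * (max (f y) δ) ^ (p - 1) * ζ y :=
    setIntegral_eq_of_subset_of_forall_sdiff_eq_zero measurableSet_Ioo
      (fun y hy => (hsub hy).2) fun y hy => by
        rw [hζ.eq_zero hy.2]
        ring
  rw [r1, r2] at hw
  have e1 : ∫ y in Set.Ioo a b, f y * (deriv (deriv ζ) y + beta p ^ 2 * ζ y) =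
      (∫ y in Set.Ioo a b, f y * deriv (deriv ζ) y) +
        ∫ y in Set.Ioo a b, beta p ^ 2 * f y * ζ y := by
    rw [← integral_add (integrable_Ioo (by fun_prop)) (integrable_Ioo (by fun_prop))]
    refine integral_congr_ae (Eventually.of_forall fun y => ?_)
    beta_reduce
    ring
  have hc2 : Continuous fun y => p * lamP * (max (f y) δ) ^ (p - 1) * ζ y :=
    (hcont.const_mul (p * lamP)).mul hz
  simp only [sub_mul]
  rw [integral_sub (integrable_Ioo hc2)
    (integrable_Ioo (by fun_prop)), ← hw, e1]
  ring

/-! ### Arcs of the angular equation -/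

/-- `f` is a positive solution of `f'' = p λ f ^ (p - 1) - β² f` on `(a, b)` that vanishes at both
end points. -/
structure IsArc (p lam : ℝ) (f : ℝ → ℝ) (a b : ℝ) : Prop where
  lt : a < b
  continuous : Continuous f
  left : f a = 0
  right : f b = 0
  pos : ∀ x ∈ Set.Ioo a b, 0 < f x
  hasDerivAt : ∀ x ∈ Set.Ioo a b, HasDerivAt f (deriv f x) x
  hasDerivAt_deriv : ∀ x ∈ Set.Ioo a b,
    HasDerivAt (deriv f) (p * lam * f x ^ (p - 1) - beta p ^ 2 * f x) x

lemma IsArc.comp_neg {p lam : ℝ} {f : ℝ → ℝ} {a b : ℝ} (h : IsArc p lam f a b) :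
    IsArc p lam (fun x => f (-x)) (-b) (-a) := by
  have hmem : ∀ x ∈ Set.Ioo (-b) (-a), -x ∈ Set.Ioo a b := fun x hx =>
    ⟨by linarith [hx.2], by linarith [hx.1]⟩
  have hd : deriv (fun x => f (-x)) = fun x => -deriv f (-x) := by
    funext x
    exact deriv_comp_neg f x
  refine ⟨neg_lt_neg h.lt, h.continuous.comp continuous_neg, by simp [h.right], by simp [h.left],
    fun x hx => h.pos _ (hmem x hx), fun x hx => ?_, fun x hx => ?_⟩
  · rw [hd]
    have := (h.hasDerivAt _ (hmem x hx)).comp x (hasDerivAt_neg x)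
    simpa using! this
  · rw [hd]
    have := ((h.hasDerivAt_deriv _ (hmem x hx)).comp x (hasDerivAt_neg x)).neg
    simpa using! this

/-- The conserved quantity `f'² + β² f² - 2 λ f ^ p` of the angular equation. -/
noncomputable def arcEnergy (p lam : ℝ) (f : ℝ → ℝ) (x : ℝ) : ℝ :=
  deriv f x ^ 2 + beta p ^ 2 * f x ^ 2 - 2 * lam * f x ^ p

lemma eq_of_hasDerivAt_zero {a b : ℝ} {w : ℝ → ℝ}
    (h : ∀ x ∈ Set.Ioo a b, HasDerivAt w 0 x) {x y : ℝ} (hx : x ∈ Set.Ioo a b)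
    (hy : y ∈ Set.Ioo a b) : w x = w y :=
  isOpen_Ioo.is_const_of_deriv_eq_zero (convex_Ioo a b).isPreconnected
    (fun z hz => (h z hz).differentiableAt.differentiableWithinAt)
    (fun z hz => (h z hz).deriv) hx hy

lemma lt_of_hasDerivAt_pos {a b α γ : ℝ} (hab : a < b) {w w' : ℝ → ℝ}
    (h : ∀ x ∈ Set.Ioo a b, HasDerivAt w (w' x) x) (hpos : ∀ x ∈ Set.Ioo a b, 0 < w' x)
    (hα : Tendsto w (𝓝[>] a) (𝓝 α)) (hγ : Tendsto w (𝓝[<] b) (𝓝 γ)) : α < γ := by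
  have hmono : StrictMonoOn w (Set.Ioo a b) := by
    refine strictMonoOn_of_deriv_pos (convex_Ioo a b)
      (fun x hx => (h x hx).continuousAt.continuousWithinAt) fun x hx => ?_
    rw [interior_Ioo] at hx
    rw [(h x hx).deriv]
    exact hpos x hx
  have h1 : a + (b - a) / 3 ∈ Set.Ioo a b := ⟨by linarith, by linarith⟩
  have h2 : a + 2 * (b - a) / 3 ∈ Set.Ioo a b := ⟨by linarith, by linarith⟩
  have h3 : α ≤ w (a + (b - a) / 3) := by
    refine le_of_tendsto hα ?_
    filter_upwards [Ioo_mem_nhdsGT h1.1] with x hx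
    exact (hmono ⟨hx.1, hx.2.trans h1.2⟩ h1 hx.2).le
  have h4 : w (a + 2 * (b - a) / 3) ≤ γ := by
    refine ge_of_tendsto hγ ?_
    filter_upwards [Ioo_mem_nhdsLT h2.2] with x hx
    exact (hmono h2 ⟨h2.1.trans hx.1, hx.2⟩ hx.1).le
  exact h3.trans_lt ((hmono h1 h2 (by linarith)).trans_le h4)

lemma IsArc.energy_eq {p lam : ℝ} {f : ℝ → ℝ} {a b : ℝ} (h : IsArc p lam f a b)
    {x y : ℝ} (hx : x ∈ Set.Ioo a b) (hy : y ∈ Set.Ioo a b) :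
    arcEnergy p lam f x = arcEnergy p lam f y := by
  refine eq_of_hasDerivAt_zero (fun z hz => ?_) hx hy
  have hf := h.hasDerivAt z hz
  have hf' := h.hasDerivAt_deriv z hz
  have hd := ((hf'.pow 2).add ((hf.pow 2).const_mul (beta p ^ 2))).sub
    ((hf.rpow_const (p := p) (Or.inl (h.pos z hz).ne')).const_mul (2 * lam))
  refine hd.congr_deriv ?_
  push_cast
  ring

lemma IsArc.exists_energy {p lam : ℝ} {f : ℝ → ℝ} {a b : ℝ} (h : IsArc p lam f a b) :
    ∃ E, ∀ x ∈ Set.Ioo a b, arcEnergy p lam f x = E :=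
  ⟨arcEnergy p lam f ((a + b) / 2), fun _ hx =>
    h.energy_eq hx ⟨by linarith [h.lt], by linarith [h.lt]⟩⟩

lemma arcEnergy_comp_neg (p lam : ℝ) (f : ℝ → ℝ) (x : ℝ) :
    arcEnergy p lam (fun y => f (-y)) x = arcEnergy p lam f (-x) := by
  simp only [arcEnergy, deriv_comp_neg f x, neg_sq]

section

variable {p lam : ℝ} {f : ℝ → ℝ} {a b E : ℝ}

lemma IsArc.tendsto_left (h : IsArc p lam f a b) : Tendsto f (𝓝[>] a) (𝓝 0) := by
  have := (h.continuous.tendsto a).mono_left (nhdsWithin_le_nhds (s := Set.Ioi a))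
  rwa [h.left] at this

lemma IsArc.tendsto_deriv_sq (hp : 0 < p) (h : IsArc p lam f a b)
    (hE : ∀ x ∈ Set.Ioo a b, arcEnergy p lam f x = E) :
    Tendsto (fun x => deriv f x ^ 2) (𝓝[>] a) (𝓝 E) := by
  have h1 : Tendsto (fun x => E - beta p ^ 2 * f x ^ 2 + 2 * lam * f x ^ p) (𝓝[>] a)
      (𝓝 (E - beta p ^ 2 * 0 ^ 2 + 2 * lam * 0 ^ p)) :=
    (tendsto_const_nhds.sub ((h.tendsto_left.pow 2).const_mul _)).add
      ((h.tendsto_left.rpow_const (Or.inr hp.le)).const_mul _)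
  rw [Real.zero_rpow hp.ne'] at h1
  simp only [ne_eq, OfNat.ofNat_ne_zero, not_false_eq_true, zero_pow, mul_zero, sub_zero,
    add_zero] at h1
  refine h1.congr' ?_
  filter_upwards [Ioo_mem_nhdsGT h.lt] with x hx
  rw [← hE x hx, arcEnergy]
  ring

lemma IsArc.energy_nonneg (hp : 0 < p) (h : IsArc p lam f a b)
    (hE : ∀ x ∈ Set.Ioo a b, arcEnergy p lam f x = E) : 0 ≤ E :=
  ge_of_tendsto' (h.tendsto_deriv_sq hp hE) fun _ => sq_nonneg _

lemma IsArc.tendsto_deriv_left (hp : 0 < p) (h : IsArc p lam f a b)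
    (hE : ∀ x ∈ Set.Ioo a b, arcEnergy p lam f x = E) :
    Tendsto (deriv f) (𝓝[>] a) (𝓝 (√E)) := by
  have hsq := h.tendsto_deriv_sq hp hE
  have habs : Tendsto (fun x => |deriv f x|) (𝓝[>] a) (𝓝 (√E)) := by
    simpa only [Real.sqrt_sq_eq_abs] using hsq.sqrt
  rcases (h.energy_nonneg hp hE).eq_or_lt with h0 | h0
  · rw [← h0, Real.sqrt_zero] at habs ⊢
    exact (tendsto_zero_iff_abs_tendsto_zero _).2 habs
  -- Near `a` the derivative has no zero, and by the mean value theorem it is positive somewhere.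
  have hne := (hsq.eventually_const_lt h0).and (Ioo_mem_nhdsGT h.lt)
  obtain ⟨c, hc, hsub⟩ := (mem_nhdsGT_iff_exists_Ioo_subset).1 hne
  refine habs.congr' ?_
  filter_upwards [Ioo_mem_nhdsGT hc] with x hx
  refine abs_of_pos ?_
  have hxab : x ∈ Set.Ioo a b := (hsub hx).2
  obtain ⟨y, hy, hyd⟩ := exists_deriv_eq_slope f hx.1 h.continuous.continuousOn
    (fun z hz => (h.hasDerivAt z ⟨hz.1, hz.2.trans hxab.2⟩).differentiableAt.differentiableWithinAt)
  have hypos : 0 < deriv f y := by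
    rw [hyd, h.left, sub_zero]
    exact div_pos (h.pos x hxab) (sub_pos.2 hx.1)
  by_contra hneg
  have hcont : ContinuousOn (deriv f) (Set.Icc y x) := fun z hz =>
    (h.hasDerivAt_deriv z
      ⟨hy.1.trans_le hz.1, hz.2.trans_lt hxab.2⟩).continuousAt.continuousWithinAt
  obtain ⟨z, hz, hz0⟩ := intermediate_value_Icc' hy.2.le hcont ⟨not_lt.1 hneg, hypos.le⟩
  have := (hsub ⟨hy.1.trans_le hz.1, hz.2.trans_lt hx.2⟩).1
  simp [hz0] at this

lemma IsArc.tendsto_slope_left (hp : 0 < p) (h : IsArc p lam f a b)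
    (hE : ∀ x ∈ Set.Ioo a b, arcEnergy p lam f x = E) :
    Tendsto (fun x => f x / (x - a)) (𝓝[>] a) (𝓝 (√E)) := by
  have hd := hasDerivWithinAt_Ici_of_tendsto_deriv (s := Set.Ioo a b)
    (fun z hz => (h.hasDerivAt z hz).differentiableAt.differentiableWithinAt)
    h.continuous.continuousWithinAt (Ioo_mem_nhdsGT h.lt) (h.tendsto_deriv_left hp hE)
  have := (hasDerivWithinAt_iff_tendsto_slope' (Set.self_notMem_Ioi)).1
    (hd.mono Set.Ioi_subset_Ici_self)
  refine this.congr fun x => ?_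
  rw [slope_def_field, h.left, sub_zero]

lemma tendsto_neg_nhdsLT (b : ℝ) : Tendsto (fun x : ℝ => -x) (𝓝[<] b) (𝓝[>] (-b)) := by
  refine tendsto_nhdsWithin_iff.2 ⟨(continuous_neg.tendsto b).mono_left nhdsWithin_le_nhds, ?_⟩
  filter_upwards [self_mem_nhdsWithin] with x hx
  exact neg_lt_neg (Set.mem_Iio.1 hx)

lemma IsArc.energy_comp_neg (hE : ∀ x ∈ Set.Ioo a b, arcEnergy p lam f x = E) :
    ∀ x ∈ Set.Ioo (-b) (-a), arcEnergy p lam (fun y => f (-y)) x = E := fun x hx => by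
  rw [arcEnergy_comp_neg]
  exact hE _ ⟨by linarith [hx.2], by linarith [hx.1]⟩

lemma IsArc.tendsto_deriv_right (hp : 0 < p) (h : IsArc p lam f a b)
    (hE : ∀ x ∈ Set.Ioo a b, arcEnergy p lam f x = E) :
    Tendsto (deriv f) (𝓝[<] b) (𝓝 (-√E)) := by
  have h1 := (h.comp_neg.tendsto_deriv_left hp (IsArc.energy_comp_neg hE)).comp
    (tendsto_neg_nhdsLT b)
  refine h1.neg.congr fun x => ?_
  simp [deriv_comp_neg f]

lemma IsArc.tendsto_right (h : IsArc p lam f a b) : Tendsto f (𝓝[<] b) (𝓝 0) := by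
  have := (h.continuous.tendsto b).mono_left (nhdsWithin_le_nhds (s := Set.Iio b))
  rwa [h.right] at this

/-- An arc is longer than a half period of `f'' = -β² f`, by Sturm comparison. -/
lemma IsArc.pi_div_beta_lt (hp0 : 0 < p) (hp1 : p < 1) (hlam : 0 < lam) (h : IsArc p lam f a b) :
    Real.pi / beta p < b - a := by
  obtain ⟨E, hE⟩ := h.exists_energy
  have hβ := one_lt_beta hp0 hp1
  have hβ0 : 0 < beta p := by linarith
  by_contra! hle
  rw [le_div_iff₀ hβ0, mul_comm] at hle
  have hd : ∀ x ∈ Set.Ioo a b, HasDerivAt (fun y => deriv f y * Real.sin (beta p * (y - a)) -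
      beta p * f y * Real.cos (beta p * (y - a)))
      (p * lam * f x ^ (p - 1) * Real.sin (beta p * (x - a))) x := by
    intro x hx
    have hlin : HasDerivAt (fun y => beta p * (y - a)) (beta p) x := by
      simpa using ((hasDerivAt_id x).sub_const a).const_mul (beta p)
    have := ((h.hasDerivAt_deriv x hx).mul hlin.sin).sub
      (((h.hasDerivAt x hx).const_mul (beta p)).mul hlin.cos)
    refine this.congr_deriv ?_
    ring
  have hcs : ∀ c : ℝ, ∀ F : Filter ℝ, F ≤ 𝓝 c →
      Tendsto (fun y => Real.sin (beta p * (y - a))) F (𝓝 (Real.sin (beta p * (c - a)))) ∧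
      Tendsto (fun y => Real.cos (beta p * (y - a))) F (𝓝 (Real.cos (beta p * (c - a)))) :=
    fun c F hF => ⟨(Continuous.tendsto (by fun_prop) c).mono_left hF,
      (Continuous.tendsto (by fun_prop) c).mono_left hF⟩
  have hl := hcs a (𝓝[>] a) nhdsWithin_le_nhds
  have hr := hcs b (𝓝[<] b) nhdsWithin_le_nhds
  have tl := ((h.tendsto_deriv_left hp0 hE).mul hl.1).sub
    ((h.tendsto_left.const_mul (beta p)).mul hl.2)
  have tr := ((h.tendsto_deriv_right hp0 hE).mul hr.1).sub
    ((h.tendsto_right.const_mul (beta p)).mul hr.2)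
  have hlt := lt_of_hasDerivAt_pos h.lt hd (fun x hx => ?_) tl tr
  · have hsin : 0 ≤ Real.sin (beta p * (b - a)) :=
      Real.sin_nonneg_of_nonneg_of_le_pi (mul_nonneg hβ0.le (sub_nonneg.2 h.lt.le)) hle
    simp at hlt
    nlinarith [Real.sqrt_nonneg E]
  · have hx1 : 0 < x - a := sub_pos.2 hx.1
    have hsin : 0 < Real.sin (beta p * (x - a)) := by
      refine Real.sin_pos_of_pos_of_lt_pi (by positivity) (lt_of_lt_of_le ?_ hle)
      exact mul_lt_mul_of_pos_left (by linarith [hx.2]) hβ0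
    have := Real.rpow_pos_of_pos (h.pos x hx) (p - 1)
    positivity

lemma IsArc.pi_div_two_lt (hp0 : 0 < p) (hp1 : p < 1) (hlam : 0 < lam) (h : IsArc p lam f a b) :
    Real.pi / 2 < b - a :=
  (div_lt_div_of_pos_left Real.pi_pos (by linarith [one_lt_beta hp0 hp1]) (beta_lt_two hp1)).trans
    (h.pi_div_beta_lt hp0 hp1 hlam)

/-- Up to the factor `β`, the Wronskian of `f ^ (1 / β)` and `sin (x - a)`. -/
noncomputable def arcWronskian (p : ℝ) (f : ℝ → ℝ) (a x : ℝ) : ℝ :=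
  f x ^ (-(p / 2)) * (deriv f x * Real.sin (x - a) - beta p * f x * Real.cos (x - a))

/-- In terms of `g = f ^ (1 / β)` and the energy `E`, the angular equation reads
`g'' + g = -(β - 1) E β⁻² g ^ (1 - 2 β)`. -/
lemma IsArc.hasDerivAt_wronskian (hp1 : p < 1) (h : IsArc p lam f a b)
    (hE : ∀ x ∈ Set.Ioo a b, arcEnergy p lam f x = E) {x : ℝ} (hx : x ∈ Set.Ioo a b) :
    HasDerivAt (arcWronskian p f a)
      (-(p * E / 2 * f x ^ (-(p / 2) - 1) * Real.sin (x - a))) x := by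
  have hf := h.hasDerivAt x hx
  have hpos := h.pos x hx
  have hlin : HasDerivAt (fun y => y - a) 1 x := (hasDerivAt_id x).sub_const a
  have hd := (hf.rpow_const (p := -(p / 2)) (Or.inl hpos.ne')).mul
    (((h.hasDerivAt_deriv x hx).mul hlin.sin).sub ((hf.const_mul (beta p)).mul hlin.cos))
  refine hd.congr_deriv ?_
  have hβ := beta_mul hp1
  have e1 : f x ^ (-(p / 2)) = f x ^ (-(p / 2) - 1) * f x := by
    rw [← Real.rpow_add_one hpos.ne']
    congr 1
    ring
  have e2 : f x ^ p = f x ^ (p - 1) * f x := by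
    rw [← Real.rpow_add_one hpos.ne']
    congr 1
    ring
  have hEx := hE x hx
  rw [arcEnergy, e2] at hEx
  rw [e1, ← hEx]
  simp only [Pi.sub_apply, Pi.mul_apply]
  linear_combination (-(f x ^ (-(p / 2) - 1) * f x * Real.cos (x - a) * deriv f x / 2) -
    f x ^ (-(p / 2) - 1) * f x * Real.sin (x - a) * f x * beta p / 2) * hβ

end

section

variable {p lam : ℝ} {f : ℝ → ℝ} {a b E : ℝ}

lemma tendsto_sub_nhdsGT (a : ℝ) : Tendsto (fun x : ℝ => x - a) (𝓝[>] a) (𝓝 0) := by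
  have : Tendsto (fun x : ℝ => x - a) (𝓝 a) (𝓝 (a - a)) := (continuous_sub_right a).tendsto a
  rw [sub_self] at this
  exact this.mono_left nhdsWithin_le_nhds

lemma tendsto_sin_div (a : ℝ) :
    Tendsto (fun x : ℝ => Real.sin (x - a) / (x - a)) (𝓝[>] a) (𝓝 1) := by
  have h1 : HasDerivAt (fun x => Real.sin (x - a)) 1 a := by
    have := ((hasDerivAt_id a).sub_const a).sin
    simpa using this
  have := (hasDerivWithinAt_iff_tendsto_slope' (Set.self_notMem_Ioi)).1
    (h1.hasDerivWithinAt (s := Set.Ioi a))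
  refine this.congr fun x => ?_
  rw [slope_def_field, sub_self, Real.sin_zero, sub_zero]

lemma IsArc.tendsto_wronskian_left (hp0 : 0 < p) (hp1 : p < 1)
    (h : IsArc p lam f a b) (hE : ∀ x ∈ Set.Ioo a b, arcEnergy p lam f x = E) :
    Tendsto (arcWronskian p f a) (𝓝[>] a) (𝓝 0) := by
  have hcos : Tendsto (fun x => Real.cos (x - a)) (𝓝[>] a) (𝓝 (Real.cos 0)) :=
    (Real.continuous_cos.tendsto 0).comp (tendsto_sub_nhdsGT a)
  have hsin : Tendsto (fun x => Real.sin (x - a)) (𝓝[>] a) (𝓝 (Real.sin 0)) :=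
    (Real.continuous_sin.tendsto 0).comp (tendsto_sub_nhdsGT a)
  rw [Real.sin_zero] at hsin
  have h2 : Tendsto (fun x => beta p * f x ^ (1 - p / 2) * Real.cos (x - a)) (𝓝[>] a) (𝓝 0) := by
    have h3 := h.tendsto_left.rpow_const (p := 1 - p / 2) (Or.inr (by linarith))
    rw [Real.zero_rpow (by linarith)] at h3
    simpa using (h3.const_mul (beta p)).mul hcos
  suffices h1 : Tendsto (fun x => deriv f x * f x ^ (-(p / 2)) * Real.sin (x - a)) (𝓝[>] a)
      (𝓝 0) by
    have h3 := h1.sub h2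
    rw [sub_zero] at h3
    refine h3.congr' ?_
    filter_upwards [Ioo_mem_nhdsGT h.lt] with x hx
    have hpos := h.pos x hx
    have : f x ^ (1 - p / 2) = f x ^ (-(p / 2)) * f x := by
      rw [← Real.rpow_add_one hpos.ne']
      congr 1
      ring
    rw [arcWronskian, this]
    ring
  rcases (h.energy_nonneg hp0 hE).eq_or_lt with h0 | h0
  · -- For energy zero, `f' f ^ (-p / 2)` is bounded.
    have hb : ∀ x ∈ Set.Ioo a b, |deriv f x * f x ^ (-(p / 2))| ≤ √(2 * lam) := by
      intro x hx
      have hpos := h.pos x hx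
      have hEx := hE x hx
      rw [← h0, arcEnergy] at hEx
      refine Real.abs_le_sqrt ?_
      have e : (f x ^ (-(p / 2))) ^ 2 * f x ^ p = 1 := by
        rw [← Real.rpow_natCast, ← Real.rpow_mul hpos.le, ← Real.rpow_add hpos]
        push_cast
        rw [show -(p / 2) * 2 + p = 0 by ring, Real.rpow_zero]
      have hq : 0 ≤ (f x ^ (-(p / 2))) ^ 2 * (beta p ^ 2 * f x ^ 2) := by positivity
      calc (deriv f x * f x ^ (-(p / 2))) ^ 2
          = 2 * lam * ((f x ^ (-(p / 2))) ^ 2 * f x ^ p) -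
            (f x ^ (-(p / 2))) ^ 2 * (beta p ^ 2 * f x ^ 2) := by
              linear_combination (f x ^ (-(p / 2))) ^ 2 * hEx
        _ ≤ 2 * lam := by
              rw [e]
              linarith
    refine squeeze_zero_norm' (a := fun x => √(2 * lam) * |Real.sin (x - a)|) ?_ ?_
    · filter_upwards [Ioo_mem_nhdsGT h.lt] with x hx
      rw [Real.norm_eq_abs, abs_mul]
      exact mul_le_mul_of_nonneg_right (hb x hx) (abs_nonneg _)
    · simpa using hsin.abs.const_mul (√(2 * lam))
  · -- For positive energy, `f` is comparable to `x - a`.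
    have hs := Real.sqrt_pos.2 h0
    have t1 := (h.tendsto_slope_left hp0 hE).rpow_const (p := -(p / 2)) (Or.inl hs.ne')
    have t2 := (tendsto_sub_nhdsGT a).rpow_const (p := 1 - p / 2) (Or.inr (by linarith))
    rw [Real.zero_rpow (by linarith)] at t2
    have t := ((h.tendsto_deriv_left hp0 hE).mul t1).mul ((tendsto_sin_div a).mul t2)
    simp only [mul_zero] at t
    refine t.congr' ?_
    filter_upwards [Ioo_mem_nhdsGT h.lt] with x hx
    have hpos := h.pos x hx
    have hxa : 0 < x - a := sub_pos.2 hx.1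
    have e1 : (x - a) ^ (1 - p / 2) = (x - a) ^ (-(p / 2)) * (x - a) := by
      rw [← Real.rpow_add_one hxa.ne']
      congr 1
      ring
    rw [Real.div_rpow hpos.le hxa.le, e1]
    have : (x - a) ^ (-(p / 2)) ≠ 0 := (Real.rpow_pos_of_pos hxa _).ne'
    field_simp

lemma sin_sub_pos {a b x : ℝ} (hab : b - a ≤ Real.pi) (hx : x ∈ Set.Ioo a b) :
    0 < Real.sin (x - a) :=
  Real.sin_pos_of_pos_of_lt_pi (sub_pos.2 hx.1) (by linarith [hx.2])

/-- On an arc of length `π` the Wronskian would vanish at both end points, but for positive energy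
it is strictly monotone. -/
lemma IsArc.sub_ne_pi (hp0 : 0 < p) (hp1 : p < 1) (h : IsArc p lam f a b)
    (hE : ∀ x ∈ Set.Ioo a b, arcEnergy p lam f x = E) (hE0 : 0 < E) : b - a ≠ Real.pi := by
  intro hpi
  have tl := (h.tendsto_wronskian_left hp0 hp1 hE).neg
  have hr := (h.comp_neg.tendsto_wronskian_left hp0 hp1 (IsArc.energy_comp_neg hE)).comp
    (tendsto_neg_nhdsLT b)
  have tr : Tendsto (fun x => -arcWronskian p f a x) (𝓝[<] b) (𝓝 0) := by
    refine hr.congr fun x => ?_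
    have e1 : -x - -b = Real.pi - (x - a) := by linarith
    simp only [Function.comp_apply, arcWronskian, deriv_comp_neg f, neg_neg, e1, Real.sin_pi_sub,
      Real.cos_pi_sub]
    ring
  rw [neg_zero] at tl
  refine (lt_of_hasDerivAt_pos h.lt (fun x hx => (h.hasDerivAt_wronskian hp1 hE hx).neg)
    (fun x hx => ?_) tl tr).false
  have h1 := Real.rpow_pos_of_pos (h.pos x hx) (-(p / 2) - 1)
  have h2 := sin_sub_pos hpi.le hx
  rw [neg_neg]
  positivity

/-- The coefficient of the one-dimensional solution `c (x₁⁺) ^ β`. -/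
noncomputable def amplitude (p lam : ℝ) : ℝ := (2 * lam / beta p ^ 2) ^ (1 / (2 - p))

lemma amplitude_pos (hp0 : 0 < p) (hp1 : p < 1) (hlam : 0 < lam) : 0 < amplitude p lam := by
  have := one_lt_beta hp0 hp1
  unfold amplitude
  positivity

/-- For energy zero the Wronskian vanishes, which integrates to the one-dimensional solution. -/
lemma IsArc.eq_of_energy_zero (hp0 : 0 < p) (hp1 : p < 1)
    (h : IsArc p lam f a b) (hab : b - a ≤ Real.pi)
    (hE : ∀ x ∈ Set.Ioo a b, arcEnergy p lam f x = 0) :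
    b - a = Real.pi ∧ ∀ x ∈ Set.Ioo a b, f x = amplitude p lam * Real.sin (x - a) ^ beta p := by
  have hβ := one_lt_beta hp0 hp1
  have hW : ∀ x ∈ Set.Ioo a b, arcWronskian p f a x = 0 := by
    intro x hx
    refine tendsto_nhds_unique (tendsto_const_nhds (f := 𝓝[>] a) |>.congr' ?_)
      (h.tendsto_wronskian_left hp0 hp1 hE)
    filter_upwards [Ioo_mem_nhdsGT h.lt] with y hy
    refine eq_of_hasDerivAt_zero (fun z hz => ?_) hx hy
    simpa using h.hasDerivAt_wronskian hp1 hE hz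
  have hode : ∀ x ∈ Set.Ioo a b,
      deriv f x * Real.sin (x - a) = beta p * f x * Real.cos (x - a) := by
    intro x hx
    have h1 := hW x hx
    rw [arcWronskian, mul_eq_zero, or_iff_right (Real.rpow_pos_of_pos (h.pos x hx) _).ne'] at h1
    exact sub_eq_zero.1 h1
  have hmid : (a + b) / 2 ∈ Set.Ioo a b := ⟨by linarith [h.lt], by linarith [h.lt]⟩
  set κ := f ((a + b) / 2) * Real.sin ((a + b) / 2 - a) ^ (-beta p) with hκ
  have hsinpos : ∀ x ∈ Set.Ioo a b, 0 < Real.sin (x - a) := fun x hx => sin_sub_pos hab hx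
  have hκpos : 0 < κ := mul_pos (h.pos _ hmid) (Real.rpow_pos_of_pos (hsinpos _ hmid) _)
  have hf : ∀ x ∈ Set.Ioo a b, f x = κ * Real.sin (x - a) ^ beta p := by
    intro x hx
    have hc : f x * Real.sin (x - a) ^ (-beta p) = κ := by
      refine eq_of_hasDerivAt_zero (w := fun y => f y * Real.sin (y - a) ^ (-beta p))
        (fun z hz => ?_) hx hmid
      have hs := hsinpos z hz
      have hlin : HasDerivAt (fun y => y - a) 1 z := (hasDerivAt_id z).sub_const a
      refine ((h.hasDerivAt z hz).mul (hlin.sin.rpow_const (p := -beta p)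
        (Or.inl hs.ne'))).congr_deriv ?_
      have e : Real.sin (z - a) ^ (-beta p) =
          Real.sin (z - a) ^ (-beta p - 1) * Real.sin (z - a) := by
        rw [← Real.rpow_add_one hs.ne']
        congr 1
        ring
      rw [e]
      linear_combination Real.sin (z - a) ^ (-beta p - 1) * hode z hz
    rw [← hc, mul_assoc, ← Real.rpow_add (hsinpos x hx)]
    simp
  have hcont : Continuous fun x => κ * Real.sin (x - a) ^ beta p :=
    continuous_const.mul ((by fun_prop : Continuous fun x => Real.sin (x - a)).rpow_const
      fun _ => Or.inr (by linarith))
  have hπ : b - a = Real.pi := by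
    have h1 : f b = κ * Real.sin (b - a) ^ beta p := by
      refine tendsto_nhds_unique ((h.continuous.tendsto b).mono_left
        (nhdsWithin_le_nhds (s := Set.Iio b))) (((hcont.tendsto b).mono_left
        (nhdsWithin_le_nhds (s := Set.Iio b))).congr' ?_)
      filter_upwards [Ioo_mem_nhdsLT h.lt] with x hx using (hf x hx).symm
    by_contra hne
    have hs : 0 < Real.sin (b - a) :=
      Real.sin_pos_of_pos_of_lt_pi (sub_pos.2 h.lt) (lt_of_le_of_ne hab hne)
    have := mul_pos hκpos (Real.rpow_pos_of_pos hs (beta p))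
    rw [← h1, h.right] at this
    exact this.false
  refine ⟨hπ, ?_⟩
  -- The energy at the midpoint, where `f' = 0`, determines the coefficient.
  have hsm : (a + b) / 2 - a = Real.pi / 2 := by linarith
  have hd := hode _ hmid
  have hκ' : κ = f ((a + b) / 2) := by
    rw [hκ, hsm, Real.sin_pi_div_two, Real.one_rpow, mul_one]
  rw [hsm, Real.sin_pi_div_two, Real.cos_pi_div_two, mul_one, mul_zero] at hd
  have hEm := hE _ hmid
  rw [arcEnergy, hd, ← hκ'] at hEm
  have hamp : κ = amplitude p lam := by
    have e : 2 * lam / beta p ^ 2 = κ ^ (2 - p) := by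
      rw [Real.rpow_sub hκpos, Real.rpow_two, div_eq_div_iff (by positivity)
        (Real.rpow_pos_of_pos hκpos p).ne']
      linear_combination -hEm
    rw [amplitude, e, ← Real.rpow_mul hκpos.le, mul_one_div_cancel (by linarith), Real.rpow_one]
  rw [← hamp]
  exact hf

end

/-! ### No kinks at the boundary of the phases -/

lemma integral_angles_comp_neg (w : ℝ → ℝ) : ∫ θ in angles, w (-θ) = ∫ θ in angles, w θ := by
  rw [← integral_indicator measurableSet_Ioo, ← integral_indicator measurableSet_Ioo,
    ← integral_neg_eq_self (angles.indicator w)]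
  congr 1
  funext x
  have : -x ∈ angles ↔ x ∈ angles := ⟨fun h => ⟨by linarith [h.2], by linarith [h.1]⟩,
    fun h => ⟨by linarith [h.2], by linarith [h.1]⟩⟩
  by_cases hx : x ∈ angles
  · rw [Set.indicator_of_mem hx, Set.indicator_of_mem (this.2 hx)]
  · rw [Set.indicator_of_notMem hx, Set.indicator_of_notMem fun h => hx (this.1 h)]

lemma HasKinkBound.comp_neg {p : ℝ} {f : ℝ → ℝ} (h : HasKinkBound p f) :
    HasKinkBound p fun x => f (-x) := by
  obtain ⟨K, hK, hb⟩ := h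
  refine ⟨K, hK, fun ζ hζ => ?_⟩
  have hζ' : IsLineTest angles fun x => ζ (-x) := by
    refine ⟨hζ.1.comp contDiff_neg, hζ.2.comp_homeomorph (Homeomorph.neg ℝ), ?_⟩
    rw [show (fun x => ζ (-x)) = ζ ∘ Homeomorph.neg ℝ from rfl,
      tsupport_comp_eq_preimage ζ (Homeomorph.neg ℝ)]
    intro x hx
    have : -x ∈ angles := hζ.3 hx
    exact ⟨by linarith [this.2], by linarith [this.1]⟩
  have hd : deriv (fun x => ζ (-x)) = fun x => -deriv ζ (-x) := funext fun x => deriv_comp_neg ζ x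
  have hd2 : ∀ x, deriv (deriv fun x => ζ (-x)) x = deriv (deriv ζ) (-x) := fun x => by
    rw [hd, deriv.fun_neg, deriv_comp_neg (deriv ζ), neg_neg]
  have h1 := hb _ hζ'
  simp only [hd2] at h1
  simp only [hd, neg_sq] at h1
  rw [integral_angles_comp_neg (fun θ => deriv ζ θ ^ 2),
    integral_angles_comp_neg (fun θ => ζ θ ^ 2),
    integral_angles_comp_neg (fun θ => |ζ θ| ^ p), ← integral_angles_comp_neg] at h1
  simpa only [neg_neg] using h1

/-- A smooth bump function on the line, supported in `[-1/2, 1/2]`. -/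
noncomputable def lineBump : ContDiffBump (0 : ℝ) :=
  ⟨1 / 4, 1 / 2, by norm_num, by norm_num⟩

lemma isLineTest_lineBump : IsLineTest (Set.Ioo (-1) 1) lineBump := by
  refine ⟨lineBump.contDiff, lineBump.hasCompactSupport, ?_⟩
  rw [lineBump.tsupport_eq, Real.closedBall_eq_Icc]
  rintro x ⟨h1, h2⟩
  simp only [lineBump] at h1 h2
  exact ⟨by linarith, by linarith⟩

lemma lineBump_zero : lineBump (0 : ℝ) = 1 :=
  lineBump.one_of_mem_closedBall (mem_closedBall_self lineBump.rIn_pos.le)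

lemma integral_angles_rescale {w : ℝ → ℝ} (hw : ∀ θ, θ ∉ angles → w θ = 0) (b : ℝ) {δ : ℝ}
    (hδ : 0 < δ) : ∫ θ in angles, w θ = δ * ∫ y, w (b + δ * y) := by
  rw [setIntegral_eq_integral_of_forall_compl_eq_zero fun x hx => hw x hx,
    Measure.integral_comp_mul_left (fun z => w (b + z)) δ, integral_add_left_eq_self,
    abs_of_pos (inv_pos.2 hδ), smul_eq_mul, mul_inv_cancel_left₀ hδ.ne']

lemma hasDerivAt_rescale {ψ : ℝ → ℝ} (hψ : Differentiable ℝ ψ) (b δ θ : ℝ) :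
    HasDerivAt (fun t => ψ ((t - b) / δ)) (deriv ψ ((θ - b) / δ) / δ) θ := by
  have h1 : HasDerivAt (fun t => (t - b) / δ) (1 / δ) θ :=
    ((hasDerivAt_id θ).sub_const b).div_const δ
  refine ((hψ _).hasDerivAt.comp θ h1).congr_deriv ?_
  ring

/-- The kink bound for the test function `s δ ψ ((θ - b) / δ)`, divided by `s`. -/
lemma HasKinkBound.rescaled {p : ℝ} {f : ℝ → ℝ} {K : ℝ} (hb : ∀ ζ, IsLineTest angles ζ →
    ∫ θ in angles, f θ * (deriv (deriv ζ) θ + beta p ^ 2 * ζ θ) ≤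
      K * ((∫ θ in angles, deriv ζ θ ^ 2) + (∫ θ in angles, ζ θ ^ 2) +
        ∫ θ in angles, |ζ θ| ^ p)) (hp0 : 0 < p) {ψ : ℝ → ℝ}
    (hψ : IsLineTest (Set.Ioo (-1) 1) ψ) {b δ s : ℝ} (hδ : 0 < δ) (hs : 0 < s)
    (h1 : -(Real.pi / 2) < b - δ) (h2 : b + δ < Real.pi / 2) :
    ∫ y, f (b + δ * y) / δ * (deriv (deriv ψ) y + beta p ^ 2 * δ ^ 2 * ψ y) ≤
      K * (s * (∫ y, deriv ψ y ^ 2) + s * δ ^ 2 * (∫ y, ψ y ^ 2) +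
        (s * δ) ^ p / s * ∫ y, |ψ y| ^ p) := by
  set ζ : ℝ → ℝ := fun θ => s * (δ * ψ ((θ - b) / δ)) with hζ
  have hd : deriv ζ = fun θ => s * deriv ψ ((θ - b) / δ) := by
    funext θ
    rw [(((hasDerivAt_rescale hψ.differentiable b δ θ).const_mul δ).const_mul s).deriv]
    field_simp
  have hd2 : deriv (deriv ζ) = fun θ => s / δ * deriv (deriv ψ) ((θ - b) / δ) := by
    funext θ
    rw [hd, ((hasDerivAt_rescale hψ.deriv.differentiable b δ θ).const_mul s).deriv]
    ring
  have hζt : IsLineTest angles ζ := by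
    have hts : tsupport ζ ⊆ Set.Icc (b - δ) (b + δ) := by
      refine closure_minimal (fun x hx => ?_) isClosed_Icc
      have hx' : ψ ((x - b) / δ) ≠ 0 := fun h => hx (by simp [hζ, h])
      have hmem : (x - b) / δ ∈ Set.Ioo (-1 : ℝ) 1 := by
        by_contra h
        exact hx' (hψ.eq_zero h)
      have e1 := (lt_div_iff₀ hδ).1 hmem.1
      have e2 := (div_lt_iff₀ hδ).1 hmem.2
      exact ⟨by linarith, by linarith⟩
    refine ⟨?_, isCompact_Icc.of_isClosed_subset (isClosed_tsupport _) hts, fun x hx => ?_⟩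
    · exact contDiff_const.mul (contDiff_const.mul
        (hψ.1.comp ((contDiff_id.sub contDiff_const).div_const δ)))
    · exact ⟨h1.trans_le (hts hx).1, (hts hx).2.trans_lt h2⟩
  have h := hb ζ hζt
  have hz : ∀ θ, θ ∉ angles → ζ θ = 0 := fun θ hθ => hζt.eq_zero hθ
  have hz1 : ∀ θ, θ ∉ angles → deriv ζ θ = 0 := fun θ hθ => hζt.deriv.eq_zero hθ
  have hz2 : ∀ θ, θ ∉ angles → deriv (deriv ζ) θ = 0 := fun θ hθ => hζt.deriv.deriv.eq_zero hθ
  have harg : ∀ y, (b + δ * y - b) / δ = y := fun y => by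
    field_simp
    ring
  rw [integral_angles_rescale (fun θ hθ => by rw [hz θ hθ, hz2 θ hθ]; ring) b hδ,
    integral_angles_rescale (w := fun θ => deriv ζ θ ^ 2) (fun θ hθ => by simp [hz1 θ hθ]) b hδ,
    integral_angles_rescale (w := fun θ => ζ θ ^ 2) (fun θ hθ => by simp [hz θ hθ]) b hδ,
    integral_angles_rescale (w := fun θ => |ζ θ| ^ p)
      (fun θ hθ => by simp [hz θ hθ, hp0.ne']) b hδ] at h
  have hζv : ∀ y, ζ (b + δ * y) = s * (δ * ψ y) := fun y => by simp only [hζ, harg]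
  have hd_v : ∀ y, deriv ζ (b + δ * y) = s * deriv ψ y := fun y => by simp only [hd, harg]
  have hd2_v : ∀ y, deriv (deriv ζ) (b + δ * y) = s / δ * deriv (deriv ψ) y := fun y => by
    simp only [hd2, harg]
  simp only [hζv, hd_v, hd2_v] at h
  have e1 : ∫ y, f (b + δ * y) * (s / δ * deriv (deriv ψ) y + beta p ^ 2 * (s * (δ * ψ y))) =
      s * ∫ y, f (b + δ * y) / δ * (deriv (deriv ψ) y + beta p ^ 2 * δ ^ 2 * ψ y) := by
    rw [← integral_const_mul]
    congr 1
    funext y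
    field_simp
  have e2 : ∫ y, (s * deriv ψ y) ^ 2 = s ^ 2 * ∫ y, deriv ψ y ^ 2 := by
    rw [← integral_const_mul]
    simp only [mul_pow]
  have e3 : ∫ y, (s * (δ * ψ y)) ^ 2 = s ^ 2 * δ ^ 2 * ∫ y, ψ y ^ 2 := by
    rw [← integral_const_mul]
    simp only [mul_pow, mul_assoc]
  have e4 : ∫ y, |s * (δ * ψ y)| ^ p = (s * δ) ^ p * ∫ y, |ψ y| ^ p := by
    rw [← integral_const_mul]
    congr 1
    funext y
    rw [← mul_assoc, abs_mul, abs_of_pos (mul_pos hs hδ),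
      Real.mul_rpow (mul_pos hs hδ).le (abs_nonneg _)]
  rw [e1, e2, e3, e4] at h
  refine le_of_mul_le_mul_left ?_ (mul_pos hδ hs)
  refine (le_of_eq ?_).trans (h.trans_eq ?_)
  · ring
  · field_simp

/-- The second derivative of the negative part is the Dirac measure at zero. -/
lemma integral_negPart_mul_deriv_deriv {ψ : ℝ → ℝ} (hψ : IsLineTest (Set.Ioo (-1) 1) ψ) :
    ∫ y, max (-y) 0 * deriv (deriv ψ) y = ψ 0 := by
  have hsupp : Function.support (fun y => max (-y) 0 * deriv (deriv ψ) y) ⊆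
      Set.Ioc (-1 : ℝ) 0 := by
    intro y hy
    have h1 : deriv (deriv ψ) y ≠ 0 := right_ne_zero_of_mul hy
    have h2 : max (-y) 0 ≠ 0 := left_ne_zero_of_mul hy
    refine ⟨?_, ?_⟩
    · by_contra h
      exact h1 (hψ.deriv.deriv.eq_zero fun h' => h h'.1)
    · by_contra h
      exact h2 (max_eq_right (by linarith))
  rw [← intervalIntegral.integral_eq_integral_of_support_subset hsupp]
  have e : ∫ y in (-1 : ℝ)..0, max (-y) 0 * deriv (deriv ψ) y =
      ∫ y in (-1 : ℝ)..0, (-y) * deriv (deriv ψ) y := by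
    refine intervalIntegral.integral_congr fun y hy => ?_
    rw [Set.uIcc_of_le (by norm_num)] at hy
    simp only [max_eq_left (neg_nonneg.2 hy.2)]
  rw [e, intervalIntegral.integral_mul_deriv_eq_deriv_mul (u' := fun _ => -1)
    (fun y _ => hasDerivAt_neg y) (fun y _ => hψ.deriv.hasDerivAt y)
    intervalIntegrable_const (hψ.deriv.deriv.continuous.intervalIntegrable _ _),
    hψ.deriv.eq_zero (x := -1) (by simp), intervalIntegral.integral_const_mul,
    intervalIntegral.integral_deriv_eq_sub (fun y _ => hψ.differentiable y)
    (hψ.deriv.continuous.intervalIntegrable _ _), hψ.eq_zero (x := -1) (by simp)]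
  ring

/-- A profile cannot leave a phase with nonzero slope if it is zero beyond: near a kink, a
perturbation of size `s δ` at scale `δ` gains Dirichlet energy of order `s δ`, but costs only
`s² δ` in the second-order term and `(s δ) ^ p δ` in the potential. -/
lemma HasKinkBound.false_of_slope {p : ℝ} {f : ℝ → ℝ} (hp0 : 0 < p) (hf : Continuous f)
    (hK : HasKinkBound p f) {b m : ℝ} (hb : b ∈ angles) (hm : 0 < m)
    (hleft : Tendsto (fun x => f x / (b - x)) (𝓝[<] b) (𝓝 m))
    (hright : ∀ᶠ x in 𝓝[≥] b, f x = 0) : False := by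
  obtain ⟨K, hK0, hbound⟩ := hK
  set ψ : ℝ → ℝ := ⇑lineBump with hψdef
  have hψ : IsLineTest (Set.Ioo (-1) 1) ψ := isLineTest_lineBump
  have hψc := hψ.continuous
  have hψc2 := hψ.deriv.deriv.continuous
  -- The rescaled profiles converge to `m` times the negative part.
  obtain ⟨c, hc, hcsub⟩ : ∃ c, c < b ∧ ∀ x ∈ Set.Ioo c b, |f x / (b - x)| ≤ 2 * m := by
    have h1 : ∀ᶠ x in 𝓝[<] b, |f x / (b - x)| ≤ 2 * m := by
      have := (hleft.abs).eventually_lt_const (u := 2 * m) (by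
        rw [abs_of_pos hm]
        linarith)
      exact this.mono fun x hx => hx.le
    obtain ⟨c, hc, hsub⟩ := mem_nhdsLT_iff_exists_Ioo_subset.1 h1
    exact ⟨c, hc, fun x hx => hsub hx⟩
  obtain ⟨d, hd, hdsub⟩ : ∃ d, b < d ∧ ∀ x ∈ Set.Ico b d, f x = 0 := by
    obtain ⟨d, hd, hsub⟩ := mem_nhdsGE_iff_exists_Ico_subset.1 hright
    exact ⟨d, hd, fun x hx => hsub hx⟩
  have hsmall : ∀ᶠ δ in 𝓝[>] (0 : ℝ), 0 < δ ∧ δ < b - c ∧ δ < d - b ∧ δ < 1 ∧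
      δ < b + Real.pi / 2 ∧ δ < Real.pi / 2 - b := by
    have hlt : ∀ e : ℝ, 0 < e → ∀ᶠ δ in 𝓝[>] (0 : ℝ), δ < e := fun e he => by
      filter_upwards [Ioo_mem_nhdsGT he] with x hx using hx.2
    filter_upwards [self_mem_nhdsWithin, hlt _ (sub_pos.2 hc), hlt _ (sub_pos.2 hd),
      hlt 1 one_pos, hlt (b + Real.pi / 2) (by linarith [hb.1]),
      hlt (Real.pi / 2 - b) (by linarith [hb.2])] with δ h1 h2 h3 h4 h5 h6
    exact ⟨h1, h2, h3, h4, h5, h6⟩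
  have hlim : Tendsto (fun δ => ∫ y, f (b + δ * y) / δ *
      (deriv (deriv ψ) y + beta p ^ 2 * δ ^ 2 * ψ y)) (𝓝[>] 0)
      (𝓝 (∫ y, m * max (-y) 0 * deriv (deriv ψ) y)) := by
    refine tendsto_integral_filter_of_dominated_convergence
      (fun y => 2 * m * (|deriv (deriv ψ) y| + beta p ^ 2 * |ψ y|)) ?_ ?_ ?_ ?_
    · refine Eventually.of_forall fun δ => Continuous.aestronglyMeasurable ?_
      have : Continuous fun y => f (b + δ * y) / δ := by fun_prop
      fun_prop
    · filter_upwards [hsmall] with δ hδ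
      refine Eventually.of_forall fun y => ?_
      obtain ⟨h0, hδ1, hδ2, hδ3, -, -⟩ := hδ
      by_cases hy : y ∈ Set.Ioo (-1 : ℝ) 1
      · rw [norm_mul, Real.norm_eq_abs, Real.norm_eq_abs]
        refine mul_le_mul ?_ ?_ (abs_nonneg _) (by positivity)
        · rcases lt_or_ge y 0 with hy0 | hy0
          · have hneg : δ * y < 0 := mul_neg_of_pos_of_neg h0 hy0
            have hge : -δ < δ * y := by nlinarith [hy.1]
            have h1 := hcsub (b + δ * y) ⟨by linarith, by linarith⟩
            have e : f (b + δ * y) / δ = f (b + δ * y) / (b - (b + δ * y)) * (-y) := by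
              have : b - (b + δ * y) = δ * (-y) := by ring
              rw [this]
              have : y ≠ 0 := hy0.ne
              field_simp
            rw [e, abs_mul, abs_of_pos (neg_pos.2 hy0)]
            calc _ ≤ 2 * m * 1 := mul_le_mul h1 (by linarith [hy.1]) (by linarith) (by positivity)
              _ = 2 * m := mul_one _
          · have hlt : δ * y < δ := by nlinarith [hy.2]
            rw [hdsub (b + δ * y) ⟨by linarith [mul_nonneg h0.le hy0], by linarith⟩]
            simp [hm.le]
        · refine (abs_add_le _ _).trans (add_le_add le_rfl ?_)
          rw [abs_mul, abs_of_nonneg (by positivity : 0 ≤ beta p ^ 2 * δ ^ 2)]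
          refine mul_le_mul_of_nonneg_right ?_ (abs_nonneg _)
          have : δ ^ 2 ≤ 1 := by nlinarith
          nlinarith [sq_nonneg (beta p)]
      · rw [hψ.deriv.deriv.eq_zero hy, hψ.eq_zero hy]
        simp
    · refine Continuous.integrable_of_hasCompactSupport (by fun_prop) ?_
      refine HasCompactSupport.mul_left (HasCompactSupport.add ?_ ?_)
      · exact hψ.deriv.deriv.2.comp_left abs_zero
      · exact HasCompactSupport.mul_left (hψ.2.comp_left abs_zero)
    · refine Eventually.of_forall fun y => ?_
      have h2 : Tendsto (fun δ : ℝ => deriv (deriv ψ) y + beta p ^ 2 * δ ^ 2 * ψ y) (𝓝[>] 0)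
          (𝓝 (deriv (deriv ψ) y)) := by
        have : Tendsto (fun δ : ℝ => deriv (deriv ψ) y + beta p ^ 2 * δ ^ 2 * ψ y) (𝓝 0)
            (𝓝 (deriv (deriv ψ) y + beta p ^ 2 * 0 ^ 2 * ψ y)) :=
          Continuous.tendsto (by fun_prop) 0
        simp only [ne_eq, OfNat.ofNat_ne_zero, not_false_eq_true, zero_pow, mul_zero, zero_mul,
          add_zero] at this
        exact this.mono_left nhdsWithin_le_nhds
      refine Tendsto.mul ?_ h2
      have hzero : Tendsto (fun δ : ℝ => b + δ * y) (𝓝[>] 0) (𝓝 b) := by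
        have : Tendsto (fun δ : ℝ => b + δ * y) (𝓝 0) (𝓝 (b + 0 * y)) :=
          Continuous.tendsto (by fun_prop) 0
        rw [zero_mul, add_zero] at this
        exact this.mono_left nhdsWithin_le_nhds
      rcases lt_or_ge y 0 with hy0 | hy0
      · rw [max_eq_left (neg_pos.2 hy0).le]
        have h3 : Tendsto (fun δ : ℝ => b + δ * y) (𝓝[>] 0) (𝓝[<] b) := by
          refine tendsto_nhdsWithin_iff.2 ⟨hzero, ?_⟩
          filter_upwards [self_mem_nhdsWithin] with δ hδ
          have : δ * y < 0 := mul_neg_of_pos_of_neg hδ hy0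
          change b + δ * y < b
          linarith
        refine ((hleft.comp h3).mul_const (-y)).congr' ?_
        filter_upwards [self_mem_nhdsWithin] with δ hδ
        have hδ0 : δ ≠ 0 := (Set.mem_Ioi.1 hδ).ne'
        have e1 : b - (b + δ * y) = δ * (-y) := by ring
        have : y ≠ 0 := hy0.ne
        rw [Function.comp_apply, e1]
        field_simp
      · rw [max_eq_right (neg_nonpos.2 hy0), mul_zero]
        have h3 : Tendsto (fun δ : ℝ => b + δ * y) (𝓝[>] 0) (𝓝[≥] b) := by
          refine tendsto_nhdsWithin_iff.2 ⟨hzero, ?_⟩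
          filter_upwards [self_mem_nhdsWithin] with δ hδ
          have : 0 ≤ δ * y := mul_nonneg (le_of_lt hδ) hy0
          change b ≤ b + δ * y
          linarith
        refine tendsto_const_nhds.congr' ?_
        filter_upwards [h3.eventually hright] with δ hδ
        rw [hδ, zero_div]
  have hval : ∫ y, m * max (-y) 0 * deriv (deriv ψ) y = m := by
    simp only [mul_assoc]
    rw [integral_const_mul, integral_negPart_mul_deriv_deriv hψ, hψdef, lineBump_zero, mul_one]
  rw [hval] at hlim
  set A := ∫ y, deriv ψ y ^ 2
  have hle : ∀ s : ℝ, 0 < s → m ≤ K * (s * A) := by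
    intro s hs
    have hR : Tendsto (fun δ : ℝ => K * (s * A + s * δ ^ 2 * (∫ y, ψ y ^ 2) +
        (s * δ) ^ p / s * ∫ y, |ψ y| ^ p)) (𝓝[>] 0) (𝓝 (K * (s * A))) := by
      have h1 : Continuous fun δ : ℝ => (s * δ) ^ p :=
        (continuous_const.mul continuous_id).rpow_const fun _ => Or.inr hp0.le
      have h2 : Tendsto (fun δ : ℝ => K * (s * A + s * δ ^ 2 * (∫ y, ψ y ^ 2) +
        (s * δ) ^ p / s * ∫ y, |ψ y| ^ p)) (𝓝 0) (𝓝 (K * (s * A + s * 0 ^ 2 * (∫ y, ψ y ^ 2) +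
        (s * 0) ^ p / s * ∫ y, |ψ y| ^ p))) := Continuous.tendsto (by fun_prop) 0
      simp only [ne_eq, OfNat.ofNat_ne_zero, not_false_eq_true, zero_pow, mul_zero, zero_mul,
        Real.zero_rpow hp0.ne', zero_div, add_zero] at h2
      exact h2.mono_left nhdsWithin_le_nhds
    refine le_of_tendsto_of_tendsto hlim hR ?_
    filter_upwards [hsmall] with δ hδ
    exact HasKinkBound.rescaled hbound hp0 hψ hδ.1 hs (by linarith [hδ.2.2.2.2.1])
      (by linarith [hδ.2.2.2.2.2])
  have hA : 0 ≤ A := integral_nonneg fun _ => sq_nonneg _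
  have h1 := hle (m / (2 * (K * A + 1))) (by positivity)
  have h2 : K * (m / (2 * (K * A + 1)) * A) = m * (K * A) / (2 * (K * A + 1)) := by ring
  have hKA : 0 ≤ K * A := by positivity
  rw [h2, le_div_iff₀ (by positivity)] at h1
  nlinarith

section

/-! ### Classification of the profiles -/

variable {p lamP lamM : ℝ} {f : ℝ → ℝ}

/-- The arc through a point of positivity is cut out by the nearest zeros on both sides. -/
lemma IsProfile.exists_isArc (hp0 : 0 < p) (hp1 : p < 1) (hP : 0 < lamP)
    (h : IsProfile p lamP lamM f) {x : ℝ} (hx : 0 < f x) :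
    ∃ a b, IsArc p lamP f a b ∧ x ∈ Set.Ioo a b ∧ -(Real.pi / 2) ≤ a ∧ b ≤ Real.pi / 2 := by
  have hxa : x ∈ angles := by
    by_contra hx'
    exact hx.ne' (h.eq_zero x hx')
  have hzero : IsClosed {y | f y = 0} := isClosed_eq h.continuous continuous_const
  obtain ⟨a, ⟨⟨ha1, hax⟩, ha0⟩, hamax⟩ := (isCompact_Icc.inter_right hzero).exists_isGreatest
    (s := Set.Icc (-(Real.pi / 2)) x ∩ {y | f y = 0})
    ⟨-(Real.pi / 2), ⟨le_rfl, hxa.1.le⟩, h.eq_zero _ fun h' => lt_irrefl _ h'.1⟩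
  obtain ⟨b, ⟨⟨hxb, hb1⟩, hb0⟩, hbmin⟩ := (isCompact_Icc.inter_right hzero).exists_isLeast
    (s := Set.Icc x (Real.pi / 2) ∩ {y | f y = 0})
    ⟨Real.pi / 2, ⟨hxa.2.le, le_rfl⟩, h.eq_zero _ fun h' => lt_irrefl _ h'.2⟩
  have hax' : a < x := lt_of_le_of_ne hax fun e => hx.ne' (e ▸ ha0)
  have hxb' : x < b := lt_of_le_of_ne hxb fun e => hx.ne' (e ▸ hb0)
  have hne : ∀ y ∈ Set.Ioo a b, f y ≠ 0 := fun y hy h0 => by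
    rcases le_total y x with hyx | hyx
    · exact hy.1.not_ge (hamax ⟨⟨ha1.trans hy.1.le, hyx⟩, h0⟩)
    · exact hy.2.not_ge (hbmin ⟨⟨hyx, hy.2.le.trans hb1⟩, h0⟩)
  have hpos : ∀ y ∈ Set.Ioo a b, 0 < f y := fun y hy => by
    by_contra hy0
    obtain ⟨z, hz, hz0⟩ := (convex_Ioo a b).isPreconnected.intermediate_value hy ⟨hax', hxb'⟩
      h.continuous.continuousOn (Set.mem_Icc.2 ⟨not_lt.1 hy0, hx.le⟩)
    exact hne z hz hz0
  exact ⟨a, b, ⟨hax'.trans hxb', h.continuous, ha0, hb0, hpos,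
    fun y hy => (h.equation hp0 hp1 hP (hpos y hy)).1,
    fun y hy => (h.equation hp0 hp1 hP (hpos y hy)).2⟩, ⟨hax', hxb'⟩, ha1, hb1⟩

lemma IsProfile.exists_long_interval (hp0 : 0 < p) (hp1 : p < 1) (hP : 0 < lamP) (hM : 0 < lamM)
    (h : IsProfile p lamP lamM f) {x : ℝ} (hx : f x ≠ 0) :
    ∃ a b, Real.pi / 2 < b - a ∧ x ∈ Set.Ioo a b ∧ -(Real.pi / 2) ≤ a ∧ b ≤ Real.pi / 2 ∧
      ∀ y ∈ Set.Ioo a b, f y ≠ 0 := by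
  rcases hx.lt_or_gt with hx | hx
  · obtain ⟨a, b, harc, hmem, ha, hb⟩ :=
      h.neg.exists_isArc hp0 hp1 hM (x := x) (neg_pos.2 hx)
    exact ⟨a, b, harc.pi_div_two_lt hp0 hp1 hM, hmem, ha, hb,
      fun y hy => (neg_pos.1 (harc.pos y hy)).ne⟩
  · obtain ⟨a, b, harc, hmem, ha, hb⟩ := h.exists_isArc hp0 hp1 hP hx
    exact ⟨a, b, harc.pi_div_two_lt hp0 hp1 hP, hmem, ha, hb, fun y hy => (harc.pos y hy).ne'⟩

/-- Two arcs of either sign do not fit side by side, each being longer than `π / 2`. -/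
lemma IsProfile.eq_zero_of_notMem (hp0 : 0 < p) (hp1 : p < 1) (hP : 0 < lamP) (hM : 0 < lamM)
    (h : IsProfile p lamP lamM f) {a b : ℝ} (harc : IsArc p lamP f a b)
    (ha : -(Real.pi / 2) ≤ a) (hb : b ≤ Real.pi / 2) {x : ℝ} (hx : x ∉ Set.Ioo a b) :
    f x = 0 := by
  by_contra hx0
  obtain ⟨c, d, hcd, hxcd, hc, hd, hne⟩ := h.exists_long_interval hp0 hp1 hP hM hx0
  have hab := harc.pi_div_two_lt hp0 hp1 hP
  have hac : a ∉ Set.Ioo c d := fun h' => hne a h' harc.left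
  have hbc : b ∉ Set.Ioo c d := fun h' => hne b h' harc.right
  rcases le_or_gt x a with hxa | hxa
  · have : d ≤ a := by
      by_contra hda
      exact hac ⟨hxcd.1.trans_le hxa, not_le.1 hda⟩
    linarith
  · have hbx : b ≤ x := by
      by_contra hbx
      exact hx ⟨hxa, not_le.1 hbx⟩
    have : b ≤ c := by
      by_contra hcb
      exact hbc ⟨not_le.1 hcb, hbx.trans_lt hxcd.2⟩
    linarith

lemma IsArc.false_of_kink (hp0 : 0 < p) {a b E : ℝ} (harc : IsArc p lamP f a b)
    (hE : ∀ x ∈ Set.Ioo a b, arcEnergy p lamP f x = E) (hE0 : 0 < E) (hK : HasKinkBound p f)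
    (hb : b ∈ angles) (hz : ∀ x ∉ Set.Ioo a b, f x = 0) : False := by
  refine hK.false_of_slope hp0 harc.continuous hb (Real.sqrt_pos.2 hE0) ?_
    (eventually_nhdsWithin_of_forall fun x hx => hz x fun h => hx.not_gt h.2)
  refine ((harc.comp_neg.tendsto_slope_left hp0 (IsArc.energy_comp_neg hE)).comp
    (tendsto_neg_nhdsLT b)).congr fun x => ?_
  simp only [Function.comp_apply, neg_neg]
  congr 1
  ring

lemma IsProfile.eq_of_pos (hp0 : 0 < p) (hp1 : p < 1) (hP : 0 < lamP) (hM : 0 < lamM)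
    (h : IsProfile p lamP lamM f) {x : ℝ} (hx : 0 < f x) :
    ∀ θ ∈ angles, f θ = amplitude p lamP * Real.cos θ ^ beta p := by
  obtain ⟨a, b, harc, -, ha, hb⟩ := h.exists_isArc hp0 hp1 hP hx
  obtain ⟨E, hE⟩ := harc.exists_energy
  have hz : ∀ y ∉ Set.Ioo a b, f y = 0 := fun y hy =>
    h.eq_zero_of_notMem hp0 hp1 hP hM harc ha hb hy
  have hlt := harc.lt
  rcases (harc.energy_nonneg hp0 hE).eq_or_lt with hE0 | hE0
  · obtain ⟨hab, hf⟩ := harc.eq_of_energy_zero hp0 hp1 (by linarith)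
      (fun y hy => (hE y hy).trans hE0.symm)
    have ha' : a = -(Real.pi / 2) := by linarith
    have hb' : b = Real.pi / 2 := by linarith
    intro θ hθ
    rw [hf θ (by rw [ha', hb']; exact hθ), ha', sub_neg_eq_add, Real.sin_add_pi_div_two]
  · exfalso
    have hK : HasKinkBound p f := h.hasKinkBound hp0 hp1 hP hM
    have hne := harc.sub_ne_pi hp0 hp1 hE hE0
    rcases hb.lt_or_eq with hb' | hb'
    · exact harc.false_of_kink hp0 hE hE0 hK ⟨by linarith, hb'⟩ hz
    · have ha' : -(Real.pi / 2) < a := ha.lt_of_ne fun e => hne (by linarith)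
      refine harc.comp_neg.false_of_kink hp0 (IsArc.energy_comp_neg hE) hE0 hK.comp_neg
        ⟨by linarith, by linarith⟩ fun y hy => hz _ fun hy' => hy ?_
      exact ⟨by linarith [hy'.2], by linarith [hy'.1]⟩

/-! ### The phases of the model solutions -/

lemma zero_mem_frontier_halfPlane : (0 : Plane) ∈ frontier halfPlane := by
  rw [isOpen_halfPlane.frontier_eq]
  refine ⟨?_, fun h => lt_irrefl (0 : ℝ) h⟩
  have hlim : Tendsto (fun t : ℝ => t • polar (1, 0)) (𝓝[>] 0) (𝓝 0) := by
    have : Tendsto (fun t : ℝ => t • polar (1, 0)) (𝓝 0) (𝓝 ((0 : ℝ) • polar (1, 0))) :=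
      Continuous.tendsto (by fun_prop) 0
    rw [zero_smul] at this
    exact this.mono_left nhdsWithin_le_nhds
  refine mem_closure_of_tendsto hlim ?_
  filter_upwards [self_mem_nhdsWithin] with t ht
  have h1 : polar (1, 0) ∈ halfPlane := polar_mem_halfPlane one_pos
    ⟨by linarith [Real.pi_pos], by linarith [Real.pi_pos]⟩
  exact mul_pos (Set.mem_Ioi.1 ht) (show 0 < polar (1, 0) 0 from h1)

/-- At an interior point of the half plane the means of a function that is almost everywhere equal
to a continuous one converge to the value of the latter. -/
lemma tendsto_average_ball {u g : Plane → ℝ} (hg : Continuous g)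
    (hu : ∀ᵐ x ∂(volume.restrict halfPlane), u x = g x) {x : Plane} (hx : x ∈ halfPlane) :
    Tendsto (fun r => ⨍ y in ball x r, u y) (𝓝[>] 0) (𝓝 (g x)) := by
  rw [Metric.tendsto_nhds]
  intro ε hε
  obtain ⟨δ, hδ, hball⟩ := Metric.continuousAt_iff.1 hg.continuousAt (ε / 2) (half_pos hε)
  obtain ⟨ρ, hρ, hsub⟩ := Metric.isOpen_iff.1 isOpen_halfPlane x hx
  filter_upwards [Ioo_mem_nhdsGT (lt_min hδ hρ)] with r hr
  have hr0 : 0 < r := hr.1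
  have hrδ : r < δ := hr.2.trans_le (min_le_left _ _)
  have hrρ : r < ρ := hr.2.trans_le (min_le_right _ _)
  have hae : ∀ᵐ y ∂(volume.restrict (ball x r)), u y = g y :=
    ae_restrict_of_ae_restrict_of_subset ((ball_subset_ball hrρ.le).trans hsub) hu
  have hmem : (⨍ y in ball x r, g y) ∈ closedBall (g x) (ε / 2) := by
    refine (convex_closedBall _ _).set_average_mem isClosed_closedBall
      (measure_ball_pos _ _ hr0).ne' measure_ball_lt_top.ne ?_ ?_
    · filter_upwards [ae_restrict_mem measurableSet_ball] with y hy
      exact (hball ((mem_ball.1 hy).trans hrδ)).le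
    · exact (hg.continuousOn.integrableOn_compact (isCompact_closedBall x r)).mono_set
        ball_subset_closedBall
  rw [average_congr hae]
  exact (mem_closedBall.1 hmem).trans_lt (half_lt_self hε)

lemma posPhase_eq {u g : Plane → ℝ} (hg : Continuous g)
    (hu : ∀ᵐ x ∂(volume.restrict halfPlane), u x = g x) :
    posPhase u = {x ∈ halfPlane | 0 < g x} := by
  ext x
  refine and_congr_right fun hx => ⟨?_, fun h => ⟨_, h, tendsto_average_ball hg hu hx⟩⟩
  rintro ⟨l, hl, hlim⟩
  rwa [← tendsto_nhds_unique hlim (tendsto_average_ball hg hu hx)]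

lemma negPhase_eq {u g : Plane → ℝ} (hg : Continuous g)
    (hu : ∀ᵐ x ∂(volume.restrict halfPlane), u x = g x) :
    negPhase u = {x ∈ halfPlane | g x < 0} := by
  ext x
  refine and_congr_right fun hx => ⟨?_, fun h => ⟨_, h, tendsto_average_ball hg hu hx⟩⟩
  rintro ⟨l, hl, hlim⟩
  rwa [← tendsto_nhds_unique hlim (tendsto_average_ball hg hu hx)]

/-- The one-dimensional solution `c x₁ ^ β`. -/
noncomputable def model (p c : ℝ) (x : Plane) : ℝ := c * (max (x 0) 0) ^ beta p

lemma continuous_model (hp0 : 0 < p) (hp1 : p < 1) (c : ℝ) : Continuous (model p c) := by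
  have h1 : Continuous fun x : Plane => max (x 0) 0 := by fun_prop
  exact continuous_const.mul (h1.rpow_const fun _ =>
    Or.inr (zero_le_one.trans (one_lt_beta hp0 hp1).le))

lemma ae_eq_model (hp0 : 0 < p) (hp1 : p < 1) {u : Plane → ℝ} {c : ℝ}
    (hum : AEStronglyMeasurable u (volume.restrict halfPlane))
    (hu : ∀ᵐ q ∂polarMeasure, u (polar q) = q.1 ^ beta p * f q.2)
    (hf : ∀ θ ∈ angles, f θ = c * Real.cos θ ^ beta p) :
    ∀ᵐ x ∂(volume.restrict halfPlane), u x = model p c x := by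
  obtain ⟨v, hv, huv⟩ := hum
  have hmk : ∀ᵐ x ∂(volume.restrict halfPlane), v x = model p c x := by
    rw [← measurePreserving_polar.map_eq, ae_map_iff continuous_polar.aemeasurable
      (measurableSet_eq_fun hv.measurable
        (continuous_model hp0 hp1 c).measurable)]
    filter_upwards [hu, measurePreserving_polar.quasiMeasurePreserving.ae huv,
      ae_polarMeasure_mem] with q hq hq' hmem
    have hcos : 0 < Real.cos q.2 := Real.cos_pos_of_mem_Ioo hmem.2
    rw [← hq', hq, hf _ hmem.2, model, polar_zero, max_eq_left (mul_pos hmem.1 hcos).le,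
      Real.mul_rpow hmem.1.le hcos.le]
    ring
  filter_upwards [hmk, huv] with x hx hx'
  rw [hx', hx]

lemma posPhase_of_model_pos (hp0 : 0 < p) (hp1 : p < 1) {u : Plane → ℝ} {c : ℝ} (hc : 0 < c)
    (hu : ∀ᵐ x ∂(volume.restrict halfPlane), u x = model p c x) :
    posPhase u = halfPlane ∧ negPhase u = ∅ := by
  have hpos : ∀ x ∈ halfPlane, 0 < model p c x := fun x hx =>
    mul_pos hc (Real.rpow_pos_of_pos (lt_max_of_lt_left hx) _)
  rw [posPhase_eq (continuous_model hp0 hp1 c) hu, negPhase_eq (continuous_model hp0 hp1 c) hu]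
  exact ⟨Set.sep_eq_self_iff_mem_true.2 hpos,
    Set.sep_eq_empty_iff_mem_false.2 fun x hx => (hpos x hx).not_gt⟩

lemma negPhase_of_model_neg (hp0 : 0 < p) (hp1 : p < 1) {u : Plane → ℝ} {c : ℝ} (hc : c < 0)
    (hu : ∀ᵐ x ∂(volume.restrict halfPlane), u x = model p c x) :
    negPhase u = halfPlane ∧ posPhase u = ∅ := by
  have hneg : ∀ x ∈ halfPlane, model p c x < 0 := fun x hx =>
    mul_neg_of_neg_of_pos hc (Real.rpow_pos_of_pos (lt_max_of_lt_left hx) _)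
  rw [posPhase_eq (continuous_model hp0 hp1 c) hu, negPhase_eq (continuous_model hp0 hp1 c) hu]
  exact ⟨Set.sep_eq_self_iff_mem_true.2 hneg,
    Set.sep_eq_empty_iff_mem_false.2 fun x hx => (hneg x hx).not_gt⟩

end

end TwoPhase

theorem theorem4p3 (p lamP lamM : ℝ) (hp0 : 0 < p) (hp1 : p < 1)
    (hlamP : 0 < lamP) (hlamM : 0 < lamM) :
    ∃ cP cM : ℝ, 0 < cP ∧ 0 < cM ∧
      ∀ (M : ℝ) (u : TwoPhase.Plane → ℝ), 0 < M →
        TwoPhase.PInfty p lamP lamM M u →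
        TwoPhase.IsHomogeneous (TwoPhase.beta p) u →
        ((0 ∈ TwoPhase.GammaP u \ TwoPhase.GammaM u ∧
            ∀ᵐ x ∂(volume.restrict TwoPhase.halfPlane),
              u x = cP * (max (x 0) 0) ^ TwoPhase.beta p) ∨
          (0 ∈ TwoPhase.GammaM u \ TwoPhase.GammaP u ∧
            ∀ᵐ x ∂(volume.restrict TwoPhase.halfPlane),
              u x = -cM * (max (x 0) 0) ^ TwoPhase.beta p)) := by
  refine ⟨TwoPhase.amplitude p lamP, TwoPhase.amplitude p lamM,
    TwoPhase.amplitude_pos hp0 hp1 hlamP, TwoPhase.amplitude_pos hp0 hp1 hlamM,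
    fun M u _ hu hom => ?_⟩
  obtain ⟨f, hf, huf⟩ := TwoPhase.exists_isProfile hp0 hp1 hu.minimizer hom
  have hum := hu.minimizer.aestronglyMeasurable
  by_cases hpos : ∃ x, 0 < f x
  · left
    obtain ⟨x, hx⟩ := hpos
    have hmodel := TwoPhase.ae_eq_model hp0 hp1 hum huf (hf.eq_of_pos hp0 hp1 hlamP hlamM hx)
    obtain ⟨h1, h2⟩ := TwoPhase.posPhase_of_model_pos hp0 hp1
      (TwoPhase.amplitude_pos hp0 hp1 hlamP) hmodel
    refine ⟨⟨?_, ?_⟩, hmodel⟩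
    · rw [TwoPhase.GammaP, h1]
      exact TwoPhase.zero_mem_frontier_halfPlane
    · simp [TwoPhase.GammaM, h2]
  by_cases hneg : ∃ x, f x < 0
  · right
    obtain ⟨x, hx⟩ := hneg
    have hmodel := TwoPhase.ae_eq_model (c := -TwoPhase.amplitude p lamM) hp0 hp1 hum huf
      fun θ hθ => by
        rw [neg_mul, ← hf.neg.eq_of_pos hp0 hp1 hlamM hlamP (neg_pos.2 hx) θ hθ, neg_neg]
    obtain ⟨h1, h2⟩ := TwoPhase.negPhase_of_model_neg hp0 hp1
      (neg_neg_of_pos (TwoPhase.amplitude_pos hp0 hp1 hlamM)) hmodel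
    refine ⟨⟨?_, ?_⟩, hmodel⟩
    · rw [TwoPhase.GammaM, h1]
      exact TwoPhase.zero_mem_frontier_halfPlane
    · simp [TwoPhase.GammaP, h2]
  -- The zero solution has empty phases, so that the origin is on neither free boundary.
  · exfalso
    have hf0 : ∀ x, f x = 0 := fun x =>
      le_antisymm (not_lt.1 fun h => hpos ⟨x, h⟩) (not_lt.1 fun h => hneg ⟨x, h⟩)
    have hmodel := TwoPhase.ae_eq_model (c := 0) hp0 hp1 hum huf fun θ _ => by
      rw [hf0, zero_mul]
    have hc := TwoPhase.continuous_model hp0 hp1 0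
    have h0 := hu.zero_mem
    rw [TwoPhase.GammaP, TwoPhase.GammaM, TwoPhase.posPhase_eq hc hmodel,
      TwoPhase.negPhase_eq hc hmodel] at h0
    simp [TwoPhase.model] at h0
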